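/- Let $G$ be a group with a finite generating set $A$ that is closed under inversion and in which no element represents the identity $\epsilon$; let $\Gamma$ be the Cayley graph with path metric $d_\Gamma$, and for $w\in A^*$ let $l(w)$ be its length and $\rho(w)\in G$ the element it represents. Suppose there is a set $\mathcal C=\{y_g\mid g\in G\}\subset A^*$ of normal forms (that is, $\rho$ restricts to a bijection $\mathcal C\to G$), containing the empty word, such that: (a) every $y\in\mathcal C$ labels a simple path in $\Gamma$; (b) there are constants $\lambda,\lambda'\ge 1$ such that every $y\in\mathcal C$ is a $(\lambda,\lambda')$-quasi-geodesic, i.e. $l(y_2)\le\lambda\, d_\Gamma(\epsilon,\rho(y_2))+\lambda'$ whenever $y=y_1y_2y_3$; (c) for some constant $K\ge 1$, $\mathcal C$ satisfies the $K$-fellow traveller property: whenever $ga=h$ with $g,h\in G$, $a\in A$, then for all $i\ge 0$ the elements represented by the prefixes of length $i$ of $y_g$ and $y_h$ (the whole word if it is shorter than $i$) are at distance at most $K$ in $\Gamma$. Then $G$ has a finite symmetric presentation $\mathcal P=\langle A\mid R\rangle$ over $A$ for which there are a linear intrinsic tame filling function and a linear extrinsic tame filling function, where a linear function is one of the form $n\mapsto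 an+b$ with integers $a\ge 1$, $b\ge 0$. Here $\langle A\mid R\rangle$ is symmetric if $R\subset A^*\setminus\{1\}$ is closed under inversion and cyclic conjugation and contains the freely reduced form of each of its elements, if nonempty. For a combinatorial 2-complex $Y$ with base vertex $y$, the coarse distance $\tilde d_Y(y,p)$ of a point $p$ is the path distance from $y$ to $p$ in the 1-skeleton if $p$ is a vertex; $\min\{\tilde d_Y(y,v)\mid v\in\partial e\}+\frac12$ if $p$ is in the interior of an edge $e$; and $\max\{\tilde d_Y(y,q)\mid q\in\partial\sigma\setminus Y^{(0)}\}-\frac14$ if $p$ is in the interior of a 2-cell $\sigma$. A van Kampen diagram $\Delta$ for a word $w$ over $\mathcal P$ is a finite, planar, contractible combinatorial 2-complex whose directed edges are labelled by $A$ (inverse edges having inverse labels), whose boundary path, read counterclockwise from a base vertex $*$, is labelled $w$, and whose 2-cells have boundary labels in $R$; $\pi_\Delta:\Delta\to X$ is the cellular map to the Cayley 2-complex $X$ of $\mathcal P$ that sends $*$ to $\epsilon$ and preserves labels and orientations. A 1-combing of $(\Delta,\partial\Delta)$ at $*$ is a continuous map $\Psi:\partial\Delta\times[0,1]\to\Delta$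 with $\Psi(p,0)=*$ and $\Psi(p,1)=p$ for all $p$, with $\Psi(*,t)=*$ for all $t$, and with $\Psi(p,t)\in\Delta^{(1)}$ for all $t$ whenever $p$ is a vertex. Let $\mathbb N[\frac14]$ be the set of nonnegative integer multiples of $\frac14$. A nondecreasing $f:\mathbb N[\frac14]\to\mathbb N[\frac14]$ is an intrinsic [respectively, extrinsic] tame filling function for $G$ over $\mathcal P$ if for every $w\in A^*$ with $\rho(w)=\epsilon$ there are a van Kampen diagram $\Delta$ for $w$ over $\mathcal P$ and a 1-combing $\Psi$ of $(\Delta,\partial\Delta)$ at $*$ such that, for all $p\in\partial\Delta$ and $0\le s<t\le1$, $$\tilde d_\Delta(*,\Psi(p,s))\le f\bigl(\tilde d_\Delta(*,\Psi(p,t))\bigr)\quad\bigl[\text{respectively, }\tilde d_X(\epsilon,\pi_\Delta\Psi(p,s))\le f\bigl(\tilde d_X(\epsilon,\pi_\Delta\Psi(p,t))\bigr)\bigr].$$ -/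

import Mathlib

namespace TameFilling

/-! ### Combinatorial complexes, path metric and coarse distance -/

/-- A graph: `D` is the set of directed edges, `rev d` is the same edge with the opposite direction,
and `src d` is the initial vertex of `d`. -/
structure OneComplex.{u, v} where
  V : Type u
  D : Type v
  src : D → V
  rev : D → D
  rev_rev : ∀ d, rev (rev d) = d

/-- The terminal vertex of a directed edge. -/
def OneComplex.tgt (Y : OneComplex) (d : Y.D) : Y.V := Y.src (Y.rev d)

/-- Adjacency of vertices; `Y.graph.dist` is the path metric of the graph on its vertices. -/
def OneComplex.graph (Y : OneComplex) : SimpleGraph Y.V :=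
  SimpleGraph.fromRel fun v v' => ∃ d, Y.src d = v ∧ Y.tgt d = v'

/-- A combinatorial 2-complex, with as much of the attaching data as the coarse distance needs:
`bdry f` is the set of directed edges that the boundary circuit of the 2-cell `f` traverses. -/
structure TwoComplex.{u, v, w} extends OneComplex.{u, v} where
  F : Type w
  bdry : F → Set D

/-- The open cells of a 2-complex (`edge d` and `edge (rev d)` denote the same open 1-cell). -/
inductive TwoComplex.Cell (Y : TwoComplex)
  | vert (v : Y.V)
  | edge (d : Y.D)
  | face (f : Y.F)

/-- Coarse distance from `y` to the points of an open edge: the distance to its midpoint. -/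
noncomputable def TwoComplex.coarseEdge (Y : TwoComplex) (y : Y.V) (d : Y.D) : ℝ :=
  min (Y.graph.dist y (Y.src d) : ℝ) (Y.graph.dist y (Y.tgt d)) + 1 / 2

/-- Coarse distance from the vertex `y` to any point of an open cell. -/
noncomputable def TwoComplex.coarse (Y : TwoComplex) (y : Y.V) : Y.Cell → ℝ
  | .vert v => Y.graph.dist y v
  | .edge d => Y.coarseEdge y d
  | .face f => sSup (Y.coarseEdge y '' Y.bdry f) - 1 / 4

theorem TwoComplex.coarseEdge_rev (Y : TwoComplex) (y : Y.V) (d : Y.D) :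
    Y.coarseEdge y (Y.rev d) = Y.coarseEdge y d := by
  unfold TwoComplex.coarseEdge OneComplex.tgt
  rw [Y.rev_rev, min_comm]

theorem TwoComplex.coarse_rev (Y : TwoComplex) (y : Y.V) (d : Y.D) :
    Y.coarse y (.edge (Y.rev d)) = Y.coarse y (.edge d) :=
  Y.coarseEdge_rev y d

/-! ### Words, generating sets, presentations -/

section Words

variable {A : Type*} [InvolutiveInv A]

/-- The formal inverse of a word. -/
def wordInv (w : List A) : List A := (w.map fun a => a⁻¹).reverse

/-- One free cancellation. -/
inductive FreeCancel : List A → List A → Prop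
  | cancel (u v : List A) (a : A) : FreeCancel (u ++ a :: a⁻¹ :: v) (u ++ v)

/-- `r'` is the freely reduced representative of `r`. -/
def IsFreeReduction (r r' : List A) : Prop :=
  Relation.ReflTransGen FreeCancel r r' ∧ ∀ r'', ¬ FreeCancel r' r''

end Words

/-- An alphabet `A`, closed under a formal inversion, whose letters represent nontrivial elements
of the group `G` and generate `G`. -/
structure SymmGen (G : Type*) [Group G] (A : Type*) [InvolutiveInv A] where
  rep : A → G
  rep_inv : ∀ a, rep a⁻¹ = (rep a)⁻¹
  rep_ne_one : ∀ a, rep a ≠ 1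
  closure_range : Subgroup.closure (Set.range rep) = ⊤

section Cayley

variable {G : Type*} [Group G] {A : Type*} [InvolutiveInv A]

/-- The element of `G` that a word represents. -/
def SymmGen.ev (S : SymmGen G A) (w : List A) : G := (w.map S.rep).prod

/-- `⟨A | R⟩` is a finite symmetric presentation of `G`: `R` is a finite set of nonempty words,
closed under inversion, cyclic conjugation and free reduction (except to the empty word), and the
kernel of the map from the free group on `A` to `G` is normally generated by `R` together with the
relations expressing that the letter `a⁻¹` is the inverse of the letter `a`. -/
structure IsFiniteSymmPresentation (S : SymmGen G A) (R : Set (List A)) : Prop where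
  finite : R.Finite
  nil_notMem : [] ∉ R
  inv_mem : ∀ r ∈ R, wordInv r ∈ R
  rotate_mem : ∀ r ∈ R, ∀ n, r.rotate n ∈ R
  reduced_mem : ∀ r ∈ R, ∀ r', IsFreeReduction r r' → r' ≠ [] → r' ∈ R
  ker_eq : (FreeGroup.lift S.rep).ker = Subgroup.normalClosure
    ({x | ∃ a : A, x = FreeGroup.of a * FreeGroup.of a⁻¹} ∪
     {x | ∃ r ∈ R, x = (r.map FreeGroup.of).prod})

/-- The Cayley graph: the directed edge `(g, a)` goes from `g` to `g a`, and it has the same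
underlying edge as `(g a, a⁻¹)`. -/
def cayleyGraph (S : SymmGen G A) : OneComplex where
  V := G
  D := G × A
  src e := e.1
  rev e := (e.1 * S.rep e.2, e.2⁻¹)
  rev_rev e := by simp [S.rep_inv]

/-- Path distance in the Cayley graph. -/
noncomputable def cayleyDist (S : SymmGen G A) (g h : G) : ℕ := (cayleyGraph S).graph.dist g h

/-- The Cayley complex: a 2-cell `(g, r)` for every vertex `g` and relator `r`, attached along the
path labelled `r` that starts at `g`. (Loops that differ only by their starting point or direction
give separate 2-cells with the same boundary, which have the same coarse distances.) -/
def cayleyComplex (S : SymmGen G A) (R : Set (List A)) : TwoComplex where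
  toOneComplex := cayleyGraph S
  F := G × R
  bdry f := {e | ∃ (i : ℕ) (h : i < f.2.1.length), e = (f.1 * S.ev (f.2.1.take i), f.2.1[i])}

/-! ### Hypotheses on a language of normal forms -/

/-- A set of normal forms: it maps bijectively onto `G` and contains the empty word. -/
def IsNormalFormSet (S : SymmGen G A) (C : Set (List A)) : Prop :=
  Set.BijOn S.ev C Set.univ ∧ [] ∈ C

/-- The word labels a simple path in the Cayley graph: the path from the identity repeats no
vertex (hence no edge). -/
def IsSimpleWord (S : SymmGen G A) (w : List A) : Prop :=
  Set.InjOn (fun i => S.ev (w.take i)) {i | i ≤ w.length}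

/-- The (synchronous) `K`-fellow traveller property: normal forms `u`, `v` of two vertices joined by
an edge are at distance at most `K` at all times `i`, where the shorter word waits at its end
(`List.take i` of a word of length at most `i` is the whole word). -/
def FellowTraveller (S : SymmGen G A) (K : ℕ) (C : Set (List A)) : Prop :=
  ∀ u ∈ C, ∀ v ∈ C, ∀ a : A, S.ev u * S.rep a = S.ev v →
    ∀ i : ℕ, cayleyDist S (S.ev (u.take i)) (S.ev (v.take i)) ≤ K

/-- A `(l, l')`-quasi-geodesic word. -/
def IsQuasiGeodesic (S : SymmGen G A) (l l' : ℝ) (y : List A) : Prop :=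
  ∀ y₁ y₂ y₃ : List A, y = y₁ ++ y₂ ++ y₃ →
    (y₂.length : ℝ) ≤ l * cayleyDist S 1 (S.ev y₂) + l'

/-- A quasi-geodesic language: the same constants work for all of its words. -/
def IsQuasiGeodesicSet (S : SymmGen G A) (C : Set (List A)) : Prop :=
  ∃ l l' : ℝ, 1 ≤ l ∧ 1 ≤ l' ∧ ∀ y ∈ C, IsQuasiGeodesic S l l' y

end Cayley

/-! ### Planar contractible 2-complexes and their topological realization -/

/-- A finite, planar, contractible combinatorial 2-complex, given as a planar map (rotation system).
`next d` is the directed edge that follows `d` on the boundary of the face on the left of `d`;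
`face d` is that face, `none` being the outer (unbounded) one. Then `next ∘ rev` rotates the
directed edges that leave a vertex, so vertices are its cycles and faces are the cycles of `next`.
Counting the outer face, `euler` says `|V| - |E| + |faces| = 2`: the faces together tile a sphere,
and the complex is this sphere with one open disc (the outer face) removed.
Without edges the complex is one point. -/
structure PlanarComplex extends OneComplex.{0, 0} where
  F : Type
  finite_V : Finite V
  finite_D : Finite D
  finite_F : Finite F
  rev_ne : ∀ d, rev d ≠ d
  next : Equiv.Perm D
  face : D → Option F
  src_eq_iff : ∀ d d', src d = src d' ↔
    (next * Function.Involutive.toPerm rev rev_rev).SameCycle d d'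
  face_eq_iff : ∀ d d', face d = face d' ↔ next.SameCycle d d'
  face_surj : ∀ f, ∃ d, face d = some f
  connected : toOneComplex.graph.Connected
  euler : 2 * (Nat.card V + Nat.card F) = Nat.card D + 2

namespace PlanarComplex

open unitInterval

theorem src_next (Y : PlanarComplex) (d : Y.D) : Y.src (Y.next d) = Y.tgt d := by
  refine ((Y.src_eq_iff (Y.rev d) (Y.next d)).2 ⟨1, ?_⟩).symm
  change Y.next (Y.rev (Y.rev d)) = Y.next d
  rw [Y.rev_rev]

/-- The underlying 2-complex (the outer face is not a 2-cell). -/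
def toTwoComplex (Y : PlanarComplex) : TwoComplex.{0, 0, 0} where
  toOneComplex := Y.toOneComplex
  F := Y.F
  bdry f := {d | Y.face d = some f}

/-- The sides of the 2-cells: directed edges with a 2-cell on the left. -/
def Side (Y : PlanarComplex) : Type := {d : Y.D // (Y.face d).isSome}

/-- The 2-cell that a side belongs to. -/
def Side.cell {Y : PlanarComplex} (d : Y.Side) : Y.F := (Y.face d.1).get d.2

/-- Disjoint union of the vertices, of a unit interval for every directed edge, and of a square for
every side of a 2-cell. The square over the side `d` carries coordinates `(s, r)`: `s` is the
position along `d` and `r` the height above it, so that `r = 0` is the edge itself and the top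
`r = 1` gets collapsed to the centre of the 2-cell. -/
abbrev Raw (Y : PlanarComplex) : Type :=
  (Σ _ : Y.V, Unit) ⊕ (Σ _ : Y.D, I) ⊕ (Σ _ : Y.Side, I × I)

def rawVert (Y : PlanarComplex) (v : Y.V) : Y.Raw := .inl ⟨v, ()⟩
def rawEdge (Y : PlanarComplex) (d : Y.D) (s : I) : Y.Raw := .inr (.inl ⟨d, s⟩)
def rawFace (Y : PlanarComplex) (d : Y.Side) (s r : I) : Y.Raw := .inr (.inr ⟨d, (s, r)⟩)

/-- The identifications. The squares over the sides of a 2-cell become a cone over its boundary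
circuit, that is, a closed polygon attached along this circuit. -/
inductive Glue (Y : PlanarComplex) : Y.Raw → Y.Raw → Prop
  | start (d : Y.D) : Glue Y (Y.rawEdge d 0) (Y.rawVert (Y.src d))
  | rev (d : Y.D) (s : I) : Glue Y (Y.rawEdge (Y.rev d) (σ s)) (Y.rawEdge d s)
  | side (d : Y.Side) (s : I) : Glue Y (Y.rawFace d s 0) (Y.rawEdge d.1 s)
  | turn (d d' : Y.Side) (h : Y.next d.1 = d'.1) (r : I) :
      Glue Y (Y.rawFace d 1 r) (Y.rawFace d' 0 r)
  | centre (d d' : Y.Side) (h : d.cell = d'.cell) (s s' : I) :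
      Glue Y (Y.rawFace d s 1) (Y.rawFace d' s' 1)

/-- The topological space underlying the complex, with the quotient topology. -/
abbrev Space (Y : PlanarComplex) : Type := Quot Y.Glue

def vertPt (Y : PlanarComplex) (v : Y.V) : Y.Space := Quot.mk _ (Y.rawVert v)
def edgePt (Y : PlanarComplex) (d : Y.D) (s : I) : Y.Space := Quot.mk _ (Y.rawEdge d s)

/-- The 1-skeleton, as a subset of the space. -/
def oneSkeleton (Y : PlanarComplex) : Set Y.Space :=
  Set.range Y.vertPt ∪ {p | ∃ d s, p = Y.edgePt d s}

open Classical in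
/-- The open cell that contains a point of the edge `d`. -/
noncomputable def edgeCell (Y : PlanarComplex) (d : Y.D) (s : I) : Y.toTwoComplex.Cell :=
  if s = 0 then .vert (Y.src d) else if s = 1 then .vert (Y.tgt d) else .edge d

open Classical in
/-- The open cell that contains a point. -/
noncomputable def rawCell (Y : PlanarComplex) : Y.Raw → Y.toTwoComplex.Cell
  | .inl ⟨v, _⟩ => .vert v
  | .inr (.inl ⟨d, s⟩) => Y.edgeCell d s
  | .inr (.inr ⟨d, (s, r)⟩) => if r = 0 then Y.edgeCell d.1 s else .face d.cell

theorem edgeCell_rev (Y : PlanarComplex) (c : Y.toTwoComplex.Cell → ℝ)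
    (hc : ∀ d, c (.edge (Y.rev d)) = c (.edge d)) (d : Y.D) (s : I) :
    c (Y.edgeCell (Y.rev d) (σ s)) = c (Y.edgeCell d s) := by
  unfold edgeCell OneComplex.tgt
  by_cases h0 : s = 0
  · subst h0; simp [Y.rev_rev]
  · by_cases h1 : s = 1
    · subst h1; simp
    · have h2 : σ s ≠ 0 := fun h => h1 (by simpa using congrArg σ h)
      have h3 : σ s ≠ 1 := fun h => h0 (by simpa using congrArg σ h)
      simp only [h0, h1, h2, h3, if_false]
      exact hc d

/-- A function `c` of open cells, as a function of points: evaluate `c` on the open cell that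
contains the point. -/
noncomputable def onPoints (Y : PlanarComplex) (c : Y.toTwoComplex.Cell → ℝ)
    (hc : ∀ d, c (.edge (Y.rev d)) = c (.edge d)) : Y.Space → ℝ :=
  Quot.lift (fun x => c (Y.rawCell x)) (by
    intro x y h
    cases h with
    | start d => simp [rawCell, rawEdge, rawVert, edgeCell]
    | rev d s => exact Y.edgeCell_rev c hc d s
    | side d s => simp [rawCell, rawEdge, rawFace]
    | turn d d' h r =>
      by_cases hr : r = 0
      · simp [rawCell, rawFace, hr, edgeCell, ← h, Y.src_next]
      · have h' : Y.face d.1 = Y.face d'.1 := (Y.face_eq_iff _ _).2 ⟨1, by simpa using h⟩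
        simp [rawCell, rawFace, hr, Side.cell, h']
    | centre d d' h s s' => simp [rawCell, rawFace, h])

end PlanarComplex

/-! ### Van Kampen diagrams, 1-combings and tame filling functions -/

/-- The word read along the boundary circuit of the face on the left of `d`, starting with `d`. -/
noncomputable def PlanarComplex.faceWord (Y : PlanarComplex) {A : Type*} (label : Y.D → A)
    (d : Y.D) : List A :=
  (List.range (Function.minimalPeriod Y.next d)).map fun i => label ((Y.next ^ i) d)

/-- A van Kampen diagram for the word `w` over `⟨A | R⟩`. The list `boundary` is the counterclockwise
boundary path from the basepoint: it keeps the outer face on its right, so its reverse runs once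
around the outer face in the order given by `next`. -/
structure VanKampenDiagram {A : Type*} [InvolutiveInv A] (R : Set (List A)) (w : List A)
    extends PlanarComplex where
  label : D → A
  label_rev : ∀ d, label (rev d) = (label d)⁻¹
  relator : ∀ d, (face d).isSome → toPlanarComplex.faceWord label d ∈ R
  base : V
  boundary : Fin w.length → D
  boundary_injective : Function.Injective boundary
  mem_boundary : ∀ d, d ∈ Set.range boundary ↔ face (rev d) = none
  boundary_next : ∀ i, next (rev (boundary (finRotate w.length i))) = rev (boundary i)
  boundary_start : ∀ i, i.val = 0 → src (boundary i) = base
  boundary_label : ∀ i, label (boundary i) = w[i]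

section Tame

open unitInterval

variable {G : Type*} [Group G] {A : Type*} [InvolutiveInv A]

/-- The basepoint of a diagram, as a point of its space. -/
def VanKampenDiagram.basePt {R : Set (List A)} {w : List A} (Δ : VanKampenDiagram R w) :
    Δ.toPlanarComplex.Space :=
  Δ.toPlanarComplex.vertPt Δ.base

/-- The boundary of a diagram: the union of the closed edges of the boundary path (a single vertex
when this path is constant). -/
def VanKampenDiagram.bdrySet {R : Set (List A)} {w : List A} (Δ : VanKampenDiagram R w) :
    Set Δ.toPlanarComplex.Space :=
  {Δ.basePt} ∪ {p | ∃ i s, p = Δ.toPlanarComplex.edgePt (Δ.boundary i) s}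

/-- A 1-combing of the pair (diagram, boundary) at the basepoint. -/
structure IsOneCombing {R : Set (List A)} {w : List A} (Δ : VanKampenDiagram R w)
    (ψ : Δ.bdrySet × I → Δ.toPlanarComplex.Space) : Prop where
  continuous : Continuous ψ
  zero : ∀ p, ψ (p, 0) = Δ.basePt
  one : ∀ p, ψ (p, 1) = p.1
  base : ∀ p : Δ.bdrySet, p.1 = Δ.basePt → ∀ t, ψ (p, t) = Δ.basePt
  vert : ∀ p : Δ.bdrySet, p.1 ∈ Set.range Δ.toPlanarComplex.vertPt →
    ∀ t, ψ (p, t) ∈ Δ.toPlanarComplex.oneSkeleton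

/-- The cellular map from a diagram to the Cayley complex that sends the basepoint to the identity
and preserves labels and orientations of edges and boundaries of 2-cells (directed edges go to
`(onV (src d), label d)`). -/
structure CellularProjection (S : SymmGen G A) {R : Set (List A)} {w : List A}
    (Δ : VanKampenDiagram R w) where
  onV : Δ.V → G
  onF : Δ.F → G × R
  onV_base : onV Δ.base = 1
  onV_tgt : ∀ d, onV (Δ.tgt d) = onV (Δ.src d) * S.rep (Δ.label d)
  onF_spec : ∀ f, ∃ d, Δ.face d = some f ∧ (onF f).1 = onV (Δ.src d) ∧
    (onF f).2.1 = Δ.toPlanarComplex.faceWord Δ.label d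

/-- The projection on open cells. -/
def CellularProjection.onCell {S : SymmGen G A} {R : Set (List A)} {w : List A}
    {Δ : VanKampenDiagram R w} (π : CellularProjection S Δ) :
    Δ.toPlanarComplex.toTwoComplex.Cell → (cayleyComplex S R).Cell
  | .vert v => .vert (π.onV v)
  | .edge d => .edge (π.onV (Δ.src d), Δ.label d)
  | .face f => .face (π.onF f)

/-- Intrinsic coarse distance from the basepoint to a point of the diagram. -/
noncomputable def VanKampenDiagram.intrinsic {R : Set (List A)} {w : List A}
    (Δ : VanKampenDiagram R w) : Δ.toPlanarComplex.Space → ℝ :=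
  Δ.toPlanarComplex.onPoints (Δ.toPlanarComplex.toTwoComplex.coarse Δ.base)
    (fun d => TwoComplex.coarse_rev Δ.toPlanarComplex.toTwoComplex Δ.base d)

/-- Extrinsic coarse distance: the coarse distance in the Cayley complex from the identity to the
image of the point under the projection (which lies in the image of the open cell of the point). -/
noncomputable def CellularProjection.extrinsic {S : SymmGen G A} {R : Set (List A)} {w : List A}
    {Δ : VanKampenDiagram R w} (π : CellularProjection S Δ) : Δ.toPlanarComplex.Space → ℝ :=
  Δ.toPlanarComplex.onPoints
    (fun c => (cayleyComplex S R).coarse (1 : G) (π.onCell c))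
    (fun d => by
      have h : ((π.onV (Δ.src (Δ.rev d)), Δ.label (Δ.rev d)) : G × A) =
          (π.onV (Δ.src d) * S.rep (Δ.label d), (Δ.label d)⁻¹) :=
        Prod.ext (π.onV_tgt d) (Δ.label_rev d)
      have h' := TwoComplex.coarse_rev (cayleyComplex S R) (1 : G) (π.onV (Δ.src d), Δ.label d)
      refine Eq.trans ?_ h'
      exact congrArg (fun e : G × A => (cayleyComplex S R).coarse (1 : G) (.edge e)) h)

/-- A family of paths `ψ` is `f`-tame with respect to the coarse distance `c` from the basepoint. -/
def IsTame {Z Y : Type*} (c : Y → ℝ) (f : ℝ → ℝ) (ψ : Z × I → Y) : Prop :=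
  ∀ (p : Z) (s t : I), s < t → c (ψ (p, s)) ≤ f (c (ψ (p, t)))

/-- The set `ℕ[1/4]` of nonnegative multiples of `1/4`, in which coarse distances lie. -/
def quarterNat : Set ℝ := {x | ∃ n : ℕ, x = n / 4}

/-- `f` is a nondecreasing function from `ℕ[1/4]` to itself (values elsewhere are irrelevant). -/
def IsNondecreasing (f : ℝ → ℝ) : Prop :=
  Set.MapsTo f quarterNat quarterNat ∧ MonotoneOn f quarterNat

/-- `f` is an intrinsic tame filling function for `G` over `⟨A | R⟩`. -/
def IsIntrinsicTFF (S : SymmGen G A) (R : Set (List A)) (f : ℝ → ℝ) : Prop :=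
  IsNondecreasing f ∧ ∀ w : List A, S.ev w = 1 →
    ∃ (Δ : VanKampenDiagram R w) (ψ : Δ.bdrySet × I → Δ.toPlanarComplex.Space),
      IsOneCombing Δ ψ ∧ IsTame Δ.intrinsic f ψ

/-- `f` is an extrinsic tame filling function for `G` over `⟨A | R⟩`. -/
def IsExtrinsicTFF (S : SymmGen G A) (R : Set (List A)) (f : ℝ → ℝ) : Prop :=
  IsNondecreasing f ∧ ∀ w : List A, S.ev w = 1 →
    ∃ (Δ : VanKampenDiagram R w) (π : CellularProjection S Δ)
      (ψ : Δ.bdrySet × I → Δ.toPlanarComplex.Space),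
      IsOneCombing Δ ψ ∧ IsTame π.extrinsic f ψ

/-- A linear function on `ℕ[1/4]`. -/
def IsLinearFun (f : ℝ → ℝ) : Prop :=
  ∃ a b : ℕ, 0 < a ∧ ∀ x ∈ quarterNat, f x = a * x + b

end Tame

end TameFilling

/-! Let |w| = m + 1, let g_i be the element represented by the first i letters of w, and let R be
the set of all nonempty words of length at most M = 4(K + 2) that represent the identity. The
diagram for w is a fan: the normal forms of g_0, ..., g_{m+1} are columns issuing from the
basepoint, and for every level j the prefixes of length j of neighbouring normal forms are joined by
a rung, which is short by the fellow traveller property. Columns and rungs bound quadrilaterals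
whose boundary labels lie in R. The two outer columns are normal forms of the identity, hence empty,
so they collapse to the basepoint, as does the bottom row.

Normal forms have different lengths and may share vertices. To keep the planar map independent of
the words, all columns are padded to a common height L and nothing else is collapsed: a step between
equal elements carries a word a a⁻¹. Edges of the grid `Grid.complex m L` are thus labelled by
nonempty words of length at most B = K + 2 (`exists_gridLabelling_of_normalForms`), and the diagram
is the grid with its edges subdivided into letters (`GridLabelling.diagram`).

A boundary point on the i-th top rung is combed through strip i, cell by cell upwards (`Grid.comb`).
Neighbouring strips induce the same path on their common column, so the paths fit together over the
boundary; continuity follows because the boundary is a quotient of a compact space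
(`isQuotientMap_bdryParam`). While a path is in a closed cell, its coarse distance differs by at
most M + 1 from the distance of one corner (`abs_onPoints_facePt_sub_le`). Hence tameness only has
to be checked for two vertices of the same column at levels j ≤ j' (`exists_oneCombing`).

Extrinsically, the lower vertex is at distance at most the length of the prefix ending at the upper
one, and the quasi-geodesic inequality bounds this length linearly by the distance of the upper
vertex (`exists_extrinsic_tame`). Intrinsically, min(i, j, m + 1 - i) changes by at most one along
grid edges, so it bounds the distance to the basepoint from below; going down the column, or along
rungs to either outer column, bounds the distance above by B times this minimum, which does not
decrease with j (`gridDist_le_mul`, `exists_intrinsic_tame`).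

That R presents G is proved with the same ladders between neighbouring normal forms, read in the
group presented by R (`ker_eq_relatorClosure`). -/

namespace TameFilling

/-! ### Path metrics of graphs -/

namespace OneComplex

theorem tgt_rev (Y : OneComplex) (d : Y.D) : Y.tgt (Y.rev d) = Y.src d := by
  simp [OneComplex.tgt, Y.rev_rev]

theorem graph_adj_iff (Y : OneComplex) (v v' : Y.V) :
    Y.graph.Adj v v' ↔ v ≠ v' ∧ ∃ d, Y.src d = v ∧ Y.tgt d = v' := by
  rw [OneComplex.graph, SimpleGraph.fromRel_adj]
  refine and_congr_right fun _ => ⟨?_, Or.inl⟩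
  rintro (h | ⟨d, h1, h2⟩)
  · exact h
  · exact ⟨Y.rev d, h2, by rw [Y.tgt_rev, h1]⟩

theorem reachable_src_tgt (Y : OneComplex) (d : Y.D) :
    Y.graph.Reachable (Y.src d) (Y.tgt d) := by
  by_cases h : Y.src d = Y.tgt d
  · rw [h]
  · exact ((Y.graph_adj_iff _ _).2 ⟨h, d, rfl, rfl⟩).reachable

theorem dist_src_tgt_le (Y : OneComplex) (d : Y.D) : Y.graph.dist (Y.src d) (Y.tgt d) ≤ 1 := by
  by_cases h : Y.src d = Y.tgt d
  · rw [h]; simp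
  · exact (SimpleGraph.dist_eq_one_iff_adj.2 ((Y.graph_adj_iff _ _).2 ⟨h, d, rfl, rfl⟩)).le

theorem dist_tgt_le (Y : OneComplex) (hc : Y.graph.Connected) (u : Y.V) (d : Y.D) :
    Y.graph.dist u (Y.tgt d) ≤ Y.graph.dist u (Y.src d) + 1 :=
  hc.dist_triangle.trans (Nat.add_le_add_left (Y.dist_src_tgt_le d) _)

/-- A function on vertices that grows by at most one along every edge is bounded by the distance. -/
theorem le_add_dist_of_forall_tgt_le (Y : OneComplex) (hc : Y.graph.Connected) (f : Y.V → ℕ)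
    (hf : ∀ d, f (Y.tgt d) ≤ f (Y.src d) + 1) (u v : Y.V) : f v ≤ f u + Y.graph.dist u v := by
  obtain ⟨p, hp⟩ := hc.exists_walk_length_eq_dist u v
  rw [← hp]
  clear hp
  induction p with
  | nil => simp
  | cons h p ih =>
    obtain ⟨-, d, h1, h2⟩ := (Y.graph_adj_iff _ _).1 h
    have := hf d
    rw [h1, h2] at this
    rw [SimpleGraph.Walk.length_cons]
    omega

end OneComplex

/-! ### Words -/

section Words

variable {G : Type*} [Group G] {A : Type*} [InvolutiveInv A] (S : SymmGen G A)

theorem SymmGen.ev_nil : S.ev [] = 1 := rfl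

theorem SymmGen.ev_cons (a : A) (w : List A) : S.ev (a :: w) = S.rep a * S.ev w := by
  simp [SymmGen.ev]

theorem SymmGen.ev_append (u v : List A) : S.ev (u ++ v) = S.ev u * S.ev v := by
  simp [SymmGen.ev]

theorem SymmGen.ev_singleton (a : A) : S.ev [a] = S.rep a := by
  simp [SymmGen.ev]

theorem length_wordInv (w : List A) : (wordInv w).length = w.length := by
  simp [wordInv]

theorem SymmGen.ev_wordInv (w : List A) : S.ev (wordInv w) = (S.ev w)⁻¹ := by
  induction w with
  | nil => simp [wordInv, SymmGen.ev]
  | cons a w ih =>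
    have : wordInv (a :: w) = wordInv w ++ [a⁻¹] := by simp [wordInv]
    rw [this, S.ev_append, ih, S.ev_singleton, S.ev_cons, S.rep_inv, mul_inv_rev]

theorem SymmGen.ev_take_succ (w : List A) (i : ℕ) (h : i < w.length) :
    S.ev (w.take (i + 1)) = S.ev (w.take i) * S.rep w[i] := by
  rw [List.take_succ_eq_append_getElem h, S.ev_append, S.ev_singleton]

theorem SymmGen.ev_rotate_eq_one (w : List A) (h : S.ev w = 1) (n : ℕ) : S.ev (w.rotate n) = 1 := by
  rw [List.rotate_eq_drop_append_take_mod, S.ev_append]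
  rw [← List.take_append_drop (n % w.length) w, S.ev_append] at h
  exact mul_eq_one_comm.1 h

theorem FreeCancel.ev_eq {w w' : List A} (h : FreeCancel w w') : S.ev w = S.ev w' := by
  cases h with
  | cancel u v a => simp [S.ev_append, S.ev_cons, S.rep_inv]

theorem FreeCancel.length_le {w w' : List A} (h : FreeCancel w w') : w'.length ≤ w.length := by
  cases h with
  | cancel u v a => simp; omega

theorem cayley_reachable_mul_ev (w : List A) (g : G) :
    (cayleyGraph S).graph.Reachable g (g * S.ev w) := by
  induction w generalizing g with
  | nil => rw [S.ev_nil, mul_one]; exact SimpleGraph.Reachable.refl _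
  | cons a w ih =>
    have h := ih (g * S.rep a)
    rw [mul_assoc, ← S.ev_cons] at h
    exact ((cayleyGraph S).reachable_src_tgt (g, a)).trans h

theorem exists_word_ev_eq (g : G) : ∃ w : List A, S.ev w = g := by
  have hg : g ∈ Subgroup.closure (Set.range S.rep) := S.closure_range ▸ Subgroup.mem_top g
  induction hg using Subgroup.closure_induction with
  | mem x hx => obtain ⟨a, rfl⟩ := hx; exact ⟨[a], S.ev_singleton a⟩
  | one => exact ⟨[], rfl⟩
  | mul x y _ _ hx hy =>
    obtain ⟨u, rfl⟩ := hx
    obtain ⟨v, rfl⟩ := hy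
    exact ⟨u ++ v, S.ev_append u v⟩
  | inv x _ hx =>
    obtain ⟨u, rfl⟩ := hx
    exact ⟨wordInv u, S.ev_wordInv u⟩

theorem cayley_connected : (cayleyGraph S).graph.Connected := by
  have : Nonempty (cayleyGraph S).V := ⟨(1 : G)⟩
  refine SimpleGraph.Connected.mk fun (g h : G) => ?_
  obtain ⟨w, hw⟩ := exists_word_ev_eq S (g⁻¹ * h)
  have := cayley_reachable_mul_ev S w g
  rwa [hw, mul_inv_cancel_left] at this

theorem cayleyDist_mul_rep_le (u g : G) (a : A) :
    cayleyDist S u (g * S.rep a) ≤ cayleyDist S u g + 1 :=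
  (cayleyGraph S).dist_tgt_le (cayley_connected S) u (g, a)

theorem cayleyDist_self (g : G) : cayleyDist S g g = 0 :=
  SimpleGraph.dist_self

theorem cayleyDist_mul_ev_le (u g : G) (w : List A) :
    cayleyDist S u (g * S.ev w) ≤ cayleyDist S u g + w.length := by
  induction w generalizing g with
  | nil => simp [S.ev_nil]
  | cons a w ih =>
    rw [S.ev_cons, ← mul_assoc, List.length_cons]
    have h1 := ih (g * S.rep a)
    have h2 := cayleyDist_mul_rep_le S u g a
    omega

theorem cayleyDist_ev_le (w : List A) : cayleyDist S 1 (S.ev w) ≤ w.length := by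
  have := cayleyDist_mul_ev_le S 1 1 w
  rwa [one_mul, cayleyDist_self, zero_add] at this

theorem exists_geodesic_word (g h : G) :
    ∃ w : List A, w.length = cayleyDist S g h ∧ g * S.ev w = h := by
  obtain ⟨p, hp⟩ := (cayley_connected S).exists_walk_length_eq_dist (g : (cayleyGraph S).V) h
  unfold cayleyDist
  rw [← hp]
  clear hp
  induction p with
  | nil => exact ⟨[], rfl, by rw [S.ev_nil]; exact mul_one _⟩
  | cons hadj p ih =>
    obtain ⟨-, d, h1, h2⟩ := ((cayleyGraph S).graph_adj_iff _ _).1 hadj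
    obtain ⟨w, hw, hw'⟩ := ih
    refine ⟨d.2 :: w, congrArg (· + 1) hw, ?_⟩
    rw [S.ev_cons, ← mul_assoc, ← hw', ← h2, ← h1]
    rfl

/-- Nearby vertices are joined by a nonempty path of bounded length. -/
theorem exists_nonempty_word [Nonempty A] {k : ℕ} (hk : 2 ≤ k) {g h : G}
    (hgh : cayleyDist S g h ≤ k) : ∃ w : List A, w ≠ [] ∧ w.length ≤ k ∧ g * S.ev w = h := by
  obtain ⟨w, hw, hw'⟩ := exists_geodesic_word S g h
  by_cases hn : w = []
  · obtain ⟨a⟩ := ‹Nonempty A›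
    -- The empty geodesic is replaced by a backtrack, so that no edge of the grid ever degenerates;
    -- this costs `2 ≤ k`.
    refine ⟨[a, a⁻¹], by simp, by simpa using hk, ?_⟩
    rw [← hw', hn]
    simp [S.ev_cons, S.ev_nil, S.rep_inv]
  · exact ⟨w, hn, hw ▸ hgh, hw'⟩

/-! ### The presentation by all short relators -/

/-- All nonempty words of length at most `M` that represent the identity. -/
def shortRelators (M : ℕ) : Set (List A) := {r | r ≠ [] ∧ r.length ≤ M ∧ S.ev r = 1}

/-- The normal closure of short relators, in the free group. -/
def relatorClosure (M : ℕ) : Subgroup (FreeGroup A) := Subgroup.normalClosure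
    ({x | ∃ a : A, x = FreeGroup.of a * FreeGroup.of a⁻¹} ∪
     {x | ∃ r ∈ shortRelators S M, x = (r.map FreeGroup.of).prod})

instance (M : ℕ) : (relatorClosure S M).Normal := Subgroup.normalClosure_normal

/-- The class of a word in the group presented by the short relators. -/
def wordClass (M : ℕ) (w : List A) : FreeGroup A ⧸ relatorClosure S M :=
  QuotientGroup.mk ((w.map FreeGroup.of).prod)

variable {S}

theorem wordClass_append (M : ℕ) (u v : List A) :
    wordClass S M (u ++ v) = wordClass S M u * wordClass S M v := by
  simp [wordClass]

theorem wordClass_nil (M : ℕ) : wordClass S M [] = 1 := by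
  simp [wordClass]

theorem wordClass_eq_one {M : ℕ} {w : List A} (hw : w.length ≤ M) (h : S.ev w = 1) :
    wordClass S M w = 1 := by
  by_cases hn : w = []
  · rw [hn, wordClass_nil]
  · exact (QuotientGroup.eq_one_iff _).2
      (Subgroup.subset_normalClosure (Or.inr ⟨w, ⟨hn, hw, h⟩, rfl⟩))

theorem wordClass_wordInv (M : ℕ) (w : List A) :
    wordClass S M (wordInv w) = (wordClass S M w)⁻¹ := by
  induction w with
  | nil => simp [wordInv, wordClass]
  | cons a w ih =>
    have h : wordInv (a :: w) = wordInv w ++ [a⁻¹] := by simp [wordInv]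
    -- In the free group the letters `a` and `a⁻¹` are unrelated generators; the first family of
    -- relators makes their classes inverse.
    have h1 : wordClass S M [a] * wordClass S M [a⁻¹] = 1 := by
      have : FreeGroup.of a * FreeGroup.of a⁻¹ ∈ relatorClosure S M :=
        Subgroup.subset_normalClosure (Or.inl ⟨a, rfl⟩)
      simpa [wordClass] using (QuotientGroup.eq_one_iff _).2 this
    rw [h, wordClass_append, ih, eq_inv_of_mul_eq_one_right h1, ← mul_inv_rev, ← wordClass_append,
      List.singleton_append]

theorem wordClass_eq_of_ev_eq {M : ℕ} {u v : List A} (hlen : u.length + v.length ≤ M)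
    (h : S.ev u = S.ev v) : wordClass S M u = wordClass S M v := by
  have h1 : wordClass S M (u ++ wordInv v) = 1 := by
    refine wordClass_eq_one (by simpa [length_wordInv] using hlen) ?_
    rw [S.ev_append, S.ev_wordInv, h, mul_inv_cancel]
  rw [wordClass_append, wordClass_wordInv] at h1
  exact mul_inv_eq_one.1 h1

/-- Along fellow-travelling words, cancelling short relators level by level. -/
theorem wordClass_take_mul {M K : ℕ} (hM : 2 * K + 2 ≤ M) {u v : List A}
    (h : ∀ i : ℕ, cayleyDist S (S.ev (u.take i)) (S.ev (v.take i)) ≤ K) (i : ℕ) (r : List A)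
    (hr : r.length ≤ K) (hur : S.ev (u.take i) * S.ev r = S.ev (v.take i)) :
    wordClass S M (u.take i) * wordClass S M r = wordClass S M (v.take i) := by
  -- One more level appends at most one letter, and none once the word has ended. Hence synchronous
  -- levels never need more than two letters besides the two rungs.
  have key : ∀ (w : List A) (i : ℕ), ∃ x : List A, x.length ≤ 1 ∧ w.take (i + 1) = w.take i ++ x := by
    intro w i
    refine ⟨w[i]?.toList, ?_, List.take_add_one⟩
    cases w[i]? <;> simp
  induction i generalizing r with
  | zero =>
    simp only [List.take_zero, S.ev_nil, wordClass_nil, one_mul] at hur ⊢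
    exact wordClass_eq_one (by omega) hur
  | succ i ih =>
    obtain ⟨q, hq, hq'⟩ := exists_geodesic_word S (S.ev (u.take i)) (S.ev (v.take i))
    have hqK : q.length ≤ K := hq ▸ h i
    have hi := ih q hqK hq'
    obtain ⟨x, hx, hxu⟩ := key u i
    obtain ⟨y, hy, hyv⟩ := key v i
    -- One cell of the ladder: its sides are `x`, `r`, `q`, `y`, of total length at most 2K + 2.
    have h2 : wordClass S M (x ++ r) = wordClass S M (q ++ y) := by
      refine wordClass_eq_of_ev_eq (by simp; omega) ?_
      rw [hxu, hyv, S.ev_append, S.ev_append, ← hq', mul_assoc, mul_assoc, mul_right_inj] at hur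
      rw [S.ev_append, S.ev_append, hur]
    rw [hxu, hyv, wordClass_append, wordClass_append, mul_assoc, ← wordClass_append, h2,
      wordClass_append, ← mul_assoc, hi]

/-- Modulo short relators, multiplying the normal form of g on the right by x gives the normal form
of g times the image of x: for a letter this is the ladder `wordClass_take_mul`, and it extends to
the free group by induction. An x in the kernel therefore fixes the class of the normal form of 1,
and cancelling that class shows that x is trivial in the quotient. -/
theorem ker_eq_relatorClosure {M K : ℕ} (hK : 1 ≤ K) (hM : 2 * K + 2 ≤ M) {C : Set (List A)}
    (hC : IsNormalFormSet S C) (hft : FellowTraveller S K C) :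
    (FreeGroup.lift S.rep).ker = relatorClosure S M := by
  have hlift : ∀ w : List A, FreeGroup.lift S.rep ((w.map FreeGroup.of).prod) = S.ev w := by
    intro w
    simp [SymmGen.ev, map_list_prod, Function.comp_def]
  have hle : relatorClosure S M ≤ (FreeGroup.lift S.rep).ker := by
    refine Subgroup.normalClosure_le_normal ?_
    rintro x (⟨a, rfl⟩ | ⟨r, hr, rfl⟩)
    · change FreeGroup.lift S.rep _ = 1
      simp [S.rep_inv]
    · change FreeGroup.lift S.rep _ = 1
      rw [hlift, hr.2.2]
  refine le_antisymm ?_ hle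
  choose y hyC hy using fun g : G => hC.1.surjOn (Set.mem_univ g)
  have hya : ∀ (g : G) (a : A),
      wordClass S M (y g) * wordClass S M [a] = wordClass S M (y (g * S.rep a)) := by
    intro g a
    have h := hft _ (hyC g) _ (hyC (g * S.rep a)) a (by rw [hy, hy])
    -- A level beyond both lengths turns the prefixes into whole words; the last rung is the letter
    -- `a`, short enough since `1 ≤ K`.
    have h3 := wordClass_take_mul hM h ((y g).length + (y (g * S.rep a)).length) [a] (by simpa)
    rw [List.take_of_length_le (by omega), List.take_of_length_le (by omega)] at h3
    exact h3 (by rw [hy, hy, S.ev_singleton])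
  have hx : ∀ (x : FreeGroup A) (g : G), wordClass S M (y g) * QuotientGroup.mk x =
      wordClass S M (y (g * FreeGroup.lift S.rep x)) := by
    intro x
    induction x using FreeGroup.induction_on with
    | C1 => intro g; simp
    | of a =>
      intro g
      have := hya g a
      simpa [wordClass] using this
    | inv_of a ih =>
      intro g
      have := ih (g * (S.rep a)⁻¹)
      simp only [FreeGroup.lift_apply_of, inv_mul_cancel_right] at this
      rw [map_inv, FreeGroup.lift_apply_of, ← this, QuotientGroup.mk_inv, mul_inv_cancel_right]
    | mul x z hx hz =>
      intro g
      rw [QuotientGroup.mk_mul, ← mul_assoc, hx, hz, map_mul, mul_assoc]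
  intro x hxk
  have h := hx x 1
  rw [show FreeGroup.lift S.rep x = 1 from hxk, mul_one] at h
  exact (QuotientGroup.eq_one_iff x).1 (mul_eq_left.1 h)

/-- Taking all short relators makes symmetry automatic: inversion, rotation and free cancellation
neither lengthen a word nor destroy its triviality in G. -/
theorem isFiniteSymmPresentation_shortRelators [Finite A] {M K : ℕ} (hK : 1 ≤ K)
    (hM : 2 * K + 2 ≤ M) {C : Set (List A)} (hC : IsNormalFormSet S C)
    (hft : FellowTraveller S K C) : IsFiniteSymmPresentation S (shortRelators S M) where
  finite := (List.finite_length_le A M).subset fun _ hr => hr.2.1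
  nil_notMem h := h.1 rfl
  inv_mem r hr := ⟨fun h => hr.1 (List.length_eq_zero_iff.1 (by rw [← length_wordInv, h]; rfl)),
    (length_wordInv r).trans_le hr.2.1, by rw [S.ev_wordInv, hr.2.2, inv_one]⟩
  rotate_mem r hr n := ⟨fun h => hr.1 (List.rotate_eq_nil_iff.1 h),
    (List.length_rotate r n).trans_le hr.2.1, S.ev_rotate_eq_one r hr.2.2 n⟩
  reduced_mem r hr r' h hne := by
    have : r'.length ≤ r.length ∧ S.ev r = S.ev r' := by
      have h1 := h.1
      clear h hne
      induction h1 with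
      | refl => exact ⟨le_rfl, rfl⟩
      | tail _ h2 ih => exact ⟨(h2.length_le).trans ih.1, ih.2.trans (h2.ev_eq S)⟩
    exact ⟨hne, this.1.trans hr.2.1, this.2 ▸ hr.2.2⟩
  ker_eq := ker_eq_relatorClosure hK hM hC hft

end Words

end TameFilling

namespace TameFilling

open unitInterval

/-! ### Concatenation of unit-speed pieces, and filling of squares -/

section Topology

variable {X Z : Type*}

/-- Run the pieces `f 0, …, f k` one after the other, each for one unit of time. -/
noncomputable def concatPieces (f : ℕ → Z → ℝ → X) : ℕ → Z → ℝ → X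
  | 0 => f 0
  | k + 1 => fun z x => if x ≤ (k : ℝ) + 1 then concatPieces f k z x else f (k + 1) z (x - (k + 1))

theorem concatPieces_apply (f : ℕ → Z → ℝ → X) (k : ℕ) (z : Z)
    (hf : ∀ p < k, f p z 1 = f (p + 1) z 0) (p : ℕ) (hp : p ≤ k) (x : ℝ) (h0 : p ≤ x)
    (h1 : x ≤ p + 1) : concatPieces f k z x = f p z (x - p) := by
  induction k generalizing p with
  | zero =>
    obtain rfl : p = 0 := by omega
    simp [concatPieces]
  | succ k ih =>
    have ih' := ih fun p hp => hf p (by omega)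
    rcases Nat.lt_or_ge p (k + 1) with hlt | hge
    · have : x ≤ (k : ℝ) + 1 := by
        have : (p : ℝ) ≤ k := by exact_mod_cast Nat.lt_succ_iff.1 hlt
        linarith
      simp only [concatPieces, if_pos this]
      exact ih' p (by omega) h0 h1
    · obtain rfl : p = k + 1 := by omega
      push_cast at h0 h1
      -- At a shared integer time the definition runs the earlier piece; the matching hypothesis
      -- identifies its end with the start of the later one.
      rcases h0.eq_or_lt with heq | hlt
      · simp only [concatPieces, if_pos heq.ge]
        rw [ih' k le_rfl (by linarith) (by linarith), ← heq]
        push_cast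
        rw [add_sub_cancel_left, sub_self, hf k (by omega)]
      · simp only [concatPieces, if_neg (not_le.2 hlt)]
        push_cast
        rfl

theorem continuous_concatPieces [TopologicalSpace X] [TopologicalSpace Z] (f : ℕ → Z → ℝ → X)
    (k : ℕ) (hc : ∀ p ≤ k, Continuous fun q : Z × ℝ => f p q.1 q.2)
    (hf : ∀ p < k, ∀ z, f p z 1 = f (p + 1) z 0) :
    Continuous fun q : Z × ℝ => concatPieces f k q.1 q.2 := by
  induction k with
  | zero => exact hc 0 le_rfl
  | succ k ih =>
    simp only [concatPieces]
    refine Continuous.if_le (ih (fun p hp => hc p (by omega)) fun p hp => hf p (by omega))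
      ((hc (k + 1) le_rfl).comp (continuous_fst.prodMk (continuous_snd.sub continuous_const)))
      continuous_snd continuous_const ?_
    rintro ⟨z, x⟩ hx
    change x = (k : ℝ) + 1 at hx
    change concatPieces f k z x = f (k + 1) z (x - (k + 1))
    rw [concatPieces_apply f k z (fun p hp => hf p (by omega) z) k le_rfl x (by linarith)
      (by linarith), hx, add_sub_cancel_left, sub_self, hf k (by omega)]

/-- The index of the piece that runs at time `x`. -/
noncomputable def pieceIndex (k : ℕ) (x : ℝ) : ℕ := min ⌊x⌋₊ k

theorem pieceIndex_le (k : ℕ) (x : ℝ) : pieceIndex k x ≤ k := min_le_right _ _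

theorem pieceIndex_mono (k : ℕ) : Monotone (pieceIndex k) := fun _ _ h =>
  min_le_min_right _ (Nat.floor_mono h)

theorem pieceIndex_cast_le (k : ℕ) {x : ℝ} (hx : 0 ≤ x) : (pieceIndex k x : ℝ) ≤ x :=
  (Nat.cast_le.2 (min_le_left _ _)).trans (Nat.floor_le hx)

/-- The cap at `k` assigns the final time `k + 1` to the last piece, where the floor alone would
overshoot. -/
theorem le_pieceIndex_add_one (k : ℕ) {x : ℝ} (hx : x ≤ k + 1) : x ≤ pieceIndex k x + 1 := by
  unfold pieceIndex
  rcases le_total ⌊x⌋₊ k with h | h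
  · rw [min_eq_left h]; exact (Nat.lt_floor_add_one x).le
  · rwa [min_eq_right h]

/-- Clamping of a real number to the unit interval. -/
noncomputable def clamp (x : ℝ) : ℝ := max 0 (min 1 x)

theorem clamp_mem (x : ℝ) : clamp x ∈ Set.Icc (0 : ℝ) 1 :=
  ⟨le_max_left _ _, max_le zero_le_one (min_le_left _ _)⟩

theorem clamp_of_le {x : ℝ} (h : x ≤ 0) : clamp x = 0 := by
  rw [clamp, min_eq_right (by linarith), max_eq_left h]

theorem clamp_of_ge {x : ℝ} (h : 1 ≤ x) : clamp x = 1 := by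
  rw [clamp, min_eq_left h, max_eq_right zero_le_one]

theorem clamp_of_mem {x : ℝ} (h : x ∈ Set.Icc (0 : ℝ) 1) : clamp x = x := by
  rw [clamp, min_eq_right h.2, max_eq_right h.1]

theorem clamp_one_sub (x : ℝ) : clamp (1 - x) = 1 - clamp x := by
  rcases le_total x 0 with h | h
  · rw [clamp_of_le h, clamp_of_ge (by linarith), sub_zero]
  · rcases le_total x 1 with h' | h'
    · rw [clamp_of_mem ⟨h, h'⟩, clamp_of_mem ⟨by linarith, by linarith⟩]
    · rw [clamp_of_ge h', clamp_of_le (by linarith), sub_self]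

theorem continuous_clamp : Continuous clamp := by
  unfold clamp
  fun_prop

/-- The filling of a square by four wedges with a common apex, one over each side: the top, right,
bottom, left side in this cyclic order. A wedge `W` has coordinates `W x r`, where `x` is the
position along the side and `r` the height above it. -/
noncomputable def squareFill (T R B L : ℝ → ℝ → X) (s t : ℝ) : X :=
  -- In a 3 × 3 partition of the square the central square goes to the apex, each corner square to
  -- the ray from a corner to the apex, and each of the other four squares covers one wedge. The
  -- sides are traversed cyclically, so the right and bottom ones run against the coordinates.
  if s ≤ 1 / 3 then L (clamp (3 * t - 1)) (clamp (min (3 * s) (min (3 * t) (3 - 3 * t))))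
  else if s ≤ 2 / 3 then
    (if t ≤ 1 / 2 then B (2 - 3 * s) (clamp (3 * t)) else T (3 * s - 1) (clamp (3 - 3 * t)))
  else R (clamp (2 - 3 * t)) (clamp (min (3 - 3 * s) (min (3 * t) (3 - 3 * t))))

section Fill

variable {T R B L : ℝ → ℝ → X}

/-- On each of the seams s = 1/3 and s = 2/3 both formulas give a corner ray for small t, the apex
for middle t and another corner ray for large t; the turn hypotheses match the rays and `c` is the
common apex. -/
theorem continuous_squareFill [TopologicalSpace X] (hT : Continuous fun q : ℝ × ℝ => T q.1 q.2)
    (hR : Continuous fun q : ℝ × ℝ => R q.1 q.2) (hB : Continuous fun q : ℝ × ℝ => B q.1 q.2)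
    (hL : Continuous fun q : ℝ × ℝ => L q.1 q.2) (c : X) (cT : ∀ x, T x 1 = c)
    (cR : ∀ x, R x 1 = c) (cB : ∀ x, B x 1 = c) (cL : ∀ x, L x 1 = c)
    (hTR : ∀ r, T 1 r = R 0 r) (hRB : ∀ r, R 1 r = B 0 r) (hBL : ∀ r, B 1 r = L 0 r)
    (hLT : ∀ r, L 1 r = T 0 r) : Continuous fun q : ℝ × ℝ => squareFill T R B L q.1 q.2 := by
  unfold squareFill
  have hcl := continuous_clamp
  refine Continuous.if_le ?_ (Continuous.if_le (Continuous.if_le ?_ ?_ ?_ ?_ ?_) ?_ ?_ ?_ ?_)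
    ?_ ?_ ?_
  · exact hL.comp (f := fun q : ℝ × ℝ => (clamp (3 * q.2 - 1),
      clamp (min (3 * q.1) (min (3 * q.2) (3 - 3 * q.2))))) (by fun_prop)
  · exact hB.comp (f := fun q : ℝ × ℝ => (2 - 3 * q.1, clamp (3 * q.2))) (by fun_prop)
  · exact hT.comp (f := fun q : ℝ × ℝ => (3 * q.1 - 1, clamp (3 - 3 * q.2))) (by fun_prop)
  · fun_prop
  · fun_prop
  · rintro ⟨s, t⟩ (rfl : t = 1 / 2)
    rw [clamp_of_ge (by norm_num), clamp_of_ge (by norm_num), cB, cT]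
  · exact hR.comp (f := fun q : ℝ × ℝ => (clamp (2 - 3 * q.2),
      clamp (min (3 - 3 * q.1) (min (3 * q.2) (3 - 3 * q.2))))) (by fun_prop)
  · fun_prop
  · fun_prop
  · rintro ⟨s, t⟩ (rfl : s = 2 / 3)
    dsimp only
    rcases le_total t (1 / 3) with h | h
    · rw [if_pos (by linarith), clamp_of_ge (show 1 ≤ 2 - 3 * t by linarith), hRB]
      norm_num
      rw [min_eq_left (show 3 * t ≤ 3 - 3 * t by linarith), min_eq_right (by linarith)]
    rcases le_total t (2 / 3) with h' | h'
    · rw [clamp_of_ge (x := min _ _) (by norm_num; constructor <;> linarith), cR]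
      split_ifs
      · rw [clamp_of_ge (by linarith), cB]
      · rw [clamp_of_ge (by linarith), cT]
    · rw [if_neg (by linarith), clamp_of_le (show 2 - 3 * t ≤ 0 by linarith), ← hTR]
      norm_num
      rw [min_eq_right (show 3 - 3 * t ≤ 3 * t by linarith), min_eq_right (by linarith)]
  · fun_prop
  · fun_prop
  · rintro ⟨s, t⟩ (rfl : s = 1 / 3)
    dsimp only
    rw [if_pos (by norm_num)]
    rcases le_total t (1 / 3) with h | h
    · rw [if_pos (by linarith), clamp_of_le (show 3 * t - 1 ≤ 0 by linarith), ← hBL]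
      norm_num
      rw [min_eq_left (show 3 * t ≤ 3 - 3 * t by linarith), min_eq_right (by linarith)]
    rcases le_total t (2 / 3) with h' | h'
    · rw [clamp_of_ge (x := min _ _) (by norm_num; constructor <;> linarith), cL]
      split_ifs
      · rw [clamp_of_ge (by linarith), cB]
      · rw [clamp_of_ge (by linarith), cT]
    · rw [if_neg (by linarith), clamp_of_ge (show 1 ≤ 3 * t - 1 by linarith), hLT]
      norm_num
      rw [min_eq_right (show 3 - 3 * t ≤ 3 * t by linarith), min_eq_right (by linarith)]

/-- On all four sides the position is `clamp (3 * · - 1)` up to reversal, constant near the corners.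
Because the formula is the same on every side, maps of neighbouring cells agree on their common
edge. -/
theorem squareFill_left {s t : ℝ} (hs : s = 0) (ht : t ∈ Set.Icc (0 : ℝ) 1) :
    squareFill T R B L s t = L (clamp (3 * t - 1)) 0 := by
  subst hs
  rw [squareFill, if_pos (by norm_num), mul_zero, min_eq_left, clamp_of_le le_rfl]
  exact le_min (by linarith [ht.1]) (by linarith [ht.2])

theorem squareFill_right {s t : ℝ} (hs : s = 1) (ht : t ∈ Set.Icc (0 : ℝ) 1) :
    squareFill T R B L s t = R (1 - clamp (3 * t - 1)) 0 := by
  subst hs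
  rw [squareFill, if_neg (by norm_num), if_neg (by norm_num), ← clamp_one_sub, mul_one, sub_self,
    min_eq_left, clamp_of_le le_rfl]
  · congr 2; ring
  · exact le_min (by linarith [ht.1]) (by linarith [ht.2])

theorem squareFill_bottom (hRB : ∀ r, R 1 r = B 0 r) (hBL : ∀ r, B 1 r = L 0 r) {s t : ℝ}
    (ht : t = 0) :
    squareFill T R B L s t = B (1 - clamp (3 * s - 1)) 0 := by
  subst ht
  unfold squareFill
  rw [← clamp_one_sub]
  split_ifs with h1 h2 h3
  · rw [clamp_of_le (by norm_num), ← hBL, clamp_of_ge (x := 1 - (3 * s - 1)) (by linarith),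
      clamp_of_le]
    norm_num
  · rw [mul_zero, clamp_of_le le_rfl, clamp_of_mem ⟨by linarith, by linarith⟩]
    congr 1; ring
  · norm_num at h3
  · rw [clamp_of_ge (by norm_num), hRB, clamp_of_le (x := 1 - (3 * s - 1)) (by linarith),
      clamp_of_le]
    norm_num

theorem squareFill_top (hTR : ∀ r, T 1 r = R 0 r) (hLT : ∀ r, L 1 r = T 0 r) {s t : ℝ}
    (ht : t = 1) :
    squareFill T R B L s t = T (clamp (3 * s - 1)) 0 := by
  subst ht
  unfold squareFill
  split_ifs with h1 h2 h3
  · rw [clamp_of_ge (by norm_num), hLT, clamp_of_le (x := 3 * s - 1) (by linarith), clamp_of_le]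
    norm_num
  · norm_num at h3
  · rw [clamp_of_le (x := 3 - 3 * 1) (by norm_num), clamp_of_mem ⟨by linarith, by linarith⟩]
  · rw [clamp_of_le (x := 2 - 3 * 1) (by norm_num), ← hTR, clamp_of_ge (x := 3 * s - 1) (by linarith),
      clamp_of_le]
    norm_num

theorem squareFill_mem (P : X → Prop) (hT : ∀ x r, P (T x r)) (hR : ∀ x r, P (R x r))
    (hB : ∀ x r, P (B x r)) (hL : ∀ x r, P (L x r)) (s t : ℝ) : P (squareFill T R B L s t) := by
  unfold squareFill
  split_ifs
  exacts [hL _ _, hB _ _, hT _ _, hR _ _]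

end Fill

end Topology

/-! ### The space of a planar complex -/

namespace PlanarComplex

variable (Y : PlanarComplex)

/-- The open square over a side, in real coordinates. -/
noncomputable def facePt (d : Y.Side) (s r : ℝ) : Y.Space :=
  Quot.mk _ (Y.rawFace d (Set.projIcc 0 1 zero_le_one s) (Set.projIcc 0 1 zero_le_one r))

theorem continuous_edgePt (d : Y.D) : Continuous (Y.edgePt d) :=
  continuous_quot_mk.comp (continuous_inr.comp (continuous_inl.comp
    (@continuous_sigmaMk _ (fun _ : Y.D => I) _ d)))

theorem continuous_facePt (d : Y.Side) : Continuous fun q : ℝ × ℝ => Y.facePt d q.1 q.2 :=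
  continuous_quot_mk.comp (continuous_inr.comp (continuous_inr.comp
    ((@continuous_sigmaMk _ (fun _ : Y.Side => I × I) _ d).comp
      ((continuous_projIcc.comp continuous_fst).prodMk (continuous_projIcc.comp continuous_snd)))))

theorem edgePt_zero (d : Y.D) : Y.edgePt d 0 = Y.vertPt (Y.src d) := Quot.sound (.start d)

theorem edgePt_rev (d : Y.D) (s : I) : Y.edgePt (Y.rev d) (σ s) = Y.edgePt d s :=
  Quot.sound (.rev d s)

theorem edgePt_one (d : Y.D) : Y.edgePt d 1 = Y.vertPt (Y.tgt d) := by
  rw [← Y.edgePt_rev d 1, unitInterval.symm_one, Y.edgePt_zero]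
  rfl

theorem facePt_zero (d : Y.Side) (s : ℝ) :
    Y.facePt d s 0 = Y.edgePt d.1 (Set.projIcc 0 1 zero_le_one s) := by
  unfold facePt
  rw [Set.projIcc_left]
  exact Quot.sound (.side d _)

theorem facePt_turn (d d' : Y.Side) (h : Y.next d.1 = d'.1) (r : ℝ) :
    Y.facePt d 1 r = Y.facePt d' 0 r := by
  unfold facePt
  rw [Set.projIcc_left, Set.projIcc_right]
  exact Quot.sound (.turn d d' h _)

theorem facePt_one (d d' : Y.Side) (h : d.cell = d'.cell) (s s' : ℝ) :
    Y.facePt d s 1 = Y.facePt d' s' 1 := by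
  unfold facePt
  rw [Set.projIcc_right]
  exact Quot.sound (.centre d d' h _ _)

open Classical in
/-- Coordinates on the 1-skeleton, before identification. -/
noncomputable def rawCoord : Y.Raw → (Y.V → ℝ) × (Y.D → ℝ)
  | .inl ⟨v, _⟩ => (Pi.single v 1, 0)
  -- The vertex coordinates alone cannot separate the points of a loop or of parallel edges. The two
  -- edge coordinates do, and they are exchanged by s ↦ 1 - s, as the identification of `d` with its
  -- reverse requires.
  | .inr (.inl ⟨d, s⟩) => ((1 - (s : ℝ)) • Pi.single (Y.src d) 1 + (s : ℝ) • Pi.single (Y.tgt d) 1,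
      ((s : ℝ) ^ 2 * (1 - s)) • Pi.single d 1 + ((s : ℝ) * (1 - s) ^ 2) • Pi.single (Y.rev d) 1)
  -- Scaling by 1 - r kills everything at the centre of the 2-cell, which makes the extension to
  -- faces well defined.
  | .inr (.inr ⟨d, (s, r)⟩) => (1 - (r : ℝ)) •
      ((1 - (s : ℝ)) • Pi.single (Y.src d.1) 1 + (s : ℝ) • Pi.single (Y.tgt d.1) 1,
      ((s : ℝ) ^ 2 * (1 - s)) • Pi.single d.1 1 + ((s : ℝ) * (1 - s) ^ 2) • Pi.single (Y.rev d.1) 1)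

/-- A map from the space to a vector space, which is injective on the 1-skeleton. -/
noncomputable def coord : Y.Space → (Y.V → ℝ) × (Y.D → ℝ) :=
  Quot.lift Y.rawCoord (by
    intro x y h
    cases h with
    | start d => simp [rawCoord, rawEdge, rawVert]
    | rev d s =>
      have h1 : Y.tgt (Y.rev d) = Y.src d := Y.tgt_rev d
      have h2 : Y.src (Y.rev d) = Y.tgt d := rfl
      simp only [rawCoord, rawEdge, unitInterval.coe_symm_eq, sub_sub_cancel, Y.rev_rev, h1, h2]
      refine Prod.ext (add_comm _ _) ?_
      dsimp only
      rw [add_comm, mul_comm (1 - (s : ℝ)), mul_comm ((1 - (s : ℝ)) ^ 2)]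
    | side d s => simp [rawCoord, rawEdge, rawFace]
    | turn d d' h r => simp [rawCoord, rawFace, ← h, Y.src_next]
    | centre d d' h s s' => simp [rawCoord, rawFace])

theorem continuous_coord : Continuous Y.coord := by
  refine continuous_quot_lift _ ?_
  rw [continuous_sum_dom, continuous_sum_dom]
  refine ⟨continuous_sigma fun v => continuous_const, continuous_sigma fun d => ?_,
    continuous_sigma fun d => ?_⟩
  · change Continuous fun s : I => (((1 - (s : ℝ)) • _ + (s : ℝ) • _, _ • _ + _ • _) :
      (Y.V → ℝ) × (Y.D → ℝ))
    fun_prop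
  · change Continuous fun s : I × I => (((1 - (s.2 : ℝ)) • ((1 - (s.1 : ℝ)) • _ + (s.1 : ℝ) • _,
      _ • _ + _ • _)) : (Y.V → ℝ) × (Y.D → ℝ))
    fun_prop

theorem coord_vertPt_fst (v v' : Y.V) : (Y.coord (Y.vertPt v)).1 v' = 1 ↔ v' = v := by
  classical
  change (Pi.single v 1 : Y.V → ℝ) v' = 1 ↔ _
  rw [Pi.single_apply]
  split_ifs <;> simp_all

theorem coord_vertPt_snd (v : Y.V) (d : Y.D) : (Y.coord (Y.vertPt v)).2 d = 0 := rfl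

theorem coord_edgePt_self (d : Y.D) (s : I) :
    (Y.coord (Y.edgePt d s)).2 d = (s : ℝ) ^ 2 * (1 - s) := by
  classical
  change (((s : ℝ) ^ 2 * (1 - s)) • Pi.single d 1 +
    ((s : ℝ) * (1 - s) ^ 2) • Pi.single (Y.rev d) 1 : Y.D → ℝ) d = _
  simp [(Y.rev_ne d).symm]

theorem coord_edgePt_rev (d : Y.D) (s : I) :
    (Y.coord (Y.edgePt d s)).2 (Y.rev d) = (s : ℝ) * (1 - s) ^ 2 := by
  classical
  change (((s : ℝ) ^ 2 * (1 - s)) • Pi.single d 1 +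
    ((s : ℝ) * (1 - s) ^ 2) • Pi.single (Y.rev d) 1 : Y.D → ℝ) (Y.rev d) = _
  simp [Y.rev_ne d]

theorem coord_edgePt_of_ne {d d' : Y.D} (h : d' ≠ d) (h' : d' ≠ Y.rev d) (s : I) :
    (Y.coord (Y.edgePt d s)).2 d' = 0 := by
  classical
  change (((s : ℝ) ^ 2 * (1 - s)) • Pi.single d 1 +
    ((s : ℝ) * (1 - s) ^ 2) • Pi.single (Y.rev d) 1 : Y.D → ℝ) d' = _
  simp [h, h']

theorem vertPt_injective : Function.Injective Y.vertPt := by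
  intro v v' h
  exact (Y.coord_vertPt_fst v' v).1 (h ▸ (Y.coord_vertPt_fst v v).2 rfl)

theorem coord_edgePt_self_pos (d : Y.D) (s : I) (h0 : s ≠ 0) (h1 : s ≠ 1) :
    0 < (Y.coord (Y.edgePt d s)).2 d := by
  rw [coord_edgePt_self]
  have := unitInterval.pos_iff_ne_zero.2 h0
  have h' := unitInterval.lt_one_iff_ne_one.2 h1
  have h2 : (s : ℝ) < 1 := h'
  have h3 : (0 : ℝ) < s := this
  have : 0 < 1 - (s : ℝ) := by linarith
  positivity

/-- The two coordinates s²(1 - s) and s(1 - s)² add up to s(1 - s), and the first is s times this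
sum, so s is recovered by division. -/
theorem coord_edgePt_self_inj {d : Y.D} {s s' : I} (h0 : s ≠ 0) (h1 : s ≠ 1)
    (h : Y.coord (Y.edgePt d s) = Y.coord (Y.edgePt d s')) : s = s' := by
  have e1 := Y.coord_edgePt_self d s
  have e2 := Y.coord_edgePt_rev d s
  rw [h, coord_edgePt_self] at e1
  rw [h, coord_edgePt_rev] at e2
  have h3 : (0 : ℝ) < s := unitInterval.pos_iff_ne_zero.2 h0
  have h4 : (s : ℝ) < 1 := unitInterval.lt_one_iff_ne_one.2 h1
  have hsum : (s' : ℝ) * (1 - s') = s * (1 - s) := by linear_combination e1 + e2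
  have h5 : (s : ℝ) * (1 - s) * (s' - s) = 0 := by linear_combination e1 - (s' : ℝ) * hsum
  have h6 : (s : ℝ) * (1 - s) ≠ 0 := (mul_pos h3 (by linarith)).ne'
  have := (mul_eq_zero.1 h5).resolve_left h6
  exact Subtype.ext (by linarith)

theorem edge_eq_of_coord_eq {d d' : Y.D} {s s' : I} (h0 : s ≠ 0) (h1 : s ≠ 1)
    (h : Y.coord (Y.edgePt d s) = Y.coord (Y.edgePt d' s')) :
    (d = d' ∧ s = s') ∨ (d = Y.rev d' ∧ s = σ s') := by
  have hpos := Y.coord_edgePt_self_pos d s h0 h1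
  by_cases hd : d = d'
  · subst hd
    exact Or.inl ⟨rfl, Y.coord_edgePt_self_inj h0 h1 h⟩
  by_cases hd' : d = Y.rev d'
  · subst hd'
    rw [← Y.edgePt_rev d' s'] at h
    exact Or.inr ⟨rfl, Y.coord_edgePt_self_inj h0 h1 h⟩
  · rw [h, Y.coord_edgePt_of_ne hd hd'] at hpos
    exact absurd hpos (lt_irrefl _)

theorem coord_edgePt_ne_vertPt (d : Y.D) (s : I) (h0 : s ≠ 0) (h1 : s ≠ 1) (v : Y.V) :
    Y.coord (Y.edgePt d s) ≠ Y.coord (Y.vertPt v) := by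
  intro h
  have hpos := Y.coord_edgePt_self_pos d s h0 h1
  rw [h, coord_vertPt_snd] at hpos
  exact lt_irrefl _ hpos

theorem edgePt_eq_vertPt_or (d : Y.D) (s : I) :
    (∃ v, Y.edgePt d s = Y.vertPt v) ∨ (s ≠ 0 ∧ s ≠ 1) := by
  by_cases h0 : s = 0
  · exact Or.inl ⟨_, h0 ▸ Y.edgePt_zero d⟩
  by_cases h1 : s = 1
  · exact Or.inl ⟨_, h1 ▸ Y.edgePt_one d⟩
  · exact Or.inr ⟨h0, h1⟩

/-- A continuous map to a Hausdorff space that is injective on the 1-skeleton gives the Hausdorff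
property there without any work in the quotient topology. -/
theorem coord_injOn : Set.InjOn Y.coord Y.oneSkeleton := by
  have key : ∀ p ∈ Y.oneSkeleton,
      (∃ v, p = Y.vertPt v) ∨ ∃ d s, p = Y.edgePt d s ∧ s ≠ 0 ∧ s ≠ 1 := by
    rintro p (⟨v, rfl⟩ | ⟨d, s, rfl⟩)
    · exact Or.inl ⟨v, rfl⟩
    · rcases Y.edgePt_eq_vertPt_or d s with h | h
      · exact Or.inl h
      · exact Or.inr ⟨d, s, rfl, h⟩
  intro p hp q hq h
  rcases key p hp with ⟨v, rfl⟩ | ⟨d, s, rfl, h0, h1⟩ <;>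
    rcases key q hq with ⟨v', rfl⟩ | ⟨d', s', rfl, h0', h1'⟩
  · rw [(Y.coord_vertPt_fst v' v).1 (h ▸ (Y.coord_vertPt_fst v v).2 rfl)]
  · exact absurd h.symm (Y.coord_edgePt_ne_vertPt d' s' h0' h1' v)
  · exact absurd h (Y.coord_edgePt_ne_vertPt d s h0 h1 v')
  · rcases Y.edge_eq_of_coord_eq h0 h1 h with ⟨rfl, rfl⟩ | ⟨rfl, rfl⟩
    · rfl
    · exact Y.edgePt_rev d' s'

theorem edgePt_mem_oneSkeleton (d : Y.D) (s : I) : Y.edgePt d s ∈ Y.oneSkeleton :=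
  Or.inr ⟨d, s, rfl⟩

end PlanarComplex

/-! ### Maps out of the boundary of a diagram -/

namespace VanKampenDiagram

variable {A : Type*} [InvolutiveInv A] {R : Set (List A)} {w : List A} (Δ : VanKampenDiagram R w)

theorem bdrySet_subset_oneSkeleton : Δ.bdrySet ⊆ Δ.toPlanarComplex.oneSkeleton := by
  rintro p (rfl | ⟨i, s, rfl⟩)
  · exact Or.inl ⟨_, rfl⟩
  · exact Or.inr ⟨_, _, rfl⟩

theorem basePt_eq (h : 0 < w.length) :
    Δ.basePt = Δ.toPlanarComplex.edgePt (Δ.boundary ⟨0, h⟩) 0 := by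
  rw [PlanarComplex.edgePt_zero, Δ.boundary_start ⟨0, h⟩ rfl]
  rfl

/-- The parametrization of the boundary by its edges. -/
def bdryParam (q : (Fin w.length × I) × I) : Δ.bdrySet × I :=
  (⟨Δ.toPlanarComplex.edgePt (Δ.boundary q.1.1) q.1.2, Or.inr ⟨_, _, rfl⟩⟩, q.2)

/-- A continuous surjection from a compact space to a Hausdorff one is a quotient map. The time
factor is included from the start, so that whole families of paths descend. -/
theorem isQuotientMap_bdryParam (h : 0 < w.length) :
    Topology.IsQuotientMap (Δ.bdryParam) := by
  have : T2Space Δ.bdrySet := by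
    refine T2Space.of_injective_continuous
      (f := fun p : Δ.bdrySet => Δ.toPlanarComplex.coord p.1) ?_
      (Δ.toPlanarComplex.continuous_coord.comp continuous_subtype_val)
    intro p q hpq
    exact Subtype.ext (Δ.toPlanarComplex.coord_injOn (Δ.bdrySet_subset_oneSkeleton p.2)
      (Δ.bdrySet_subset_oneSkeleton q.2) hpq)
  refine Topology.IsQuotientMap.of_surjective_continuous ?_ ?_
  · rintro ⟨⟨p, hp⟩, t⟩
    rcases hp with hp | ⟨i, s, rfl⟩
    · refine ⟨((⟨0, h⟩, 0), t), ?_⟩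
      exact Prod.ext (Subtype.ext ((Δ.basePt_eq h).symm.trans hp.symm)) rfl
    · exact ⟨((i, s), t), rfl⟩
  · refine Continuous.prodMk (Continuous.subtype_mk ?_ _) continuous_snd
    have : Continuous fun q : Fin w.length × I =>
        Δ.toPlanarComplex.edgePt (Δ.boundary q.1) q.2 :=
      continuous_prod_of_discrete_left.2
        fun i => Δ.toPlanarComplex.continuous_edgePt (Δ.boundary i)
    exact this.comp continuous_fst

/-- A family of paths to the points of the boundary edges, compatible where boundary edges meet,
is a continuous family of paths to the boundary points. -/
theorem exists_continuous_lift (h : 0 < w.length)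
    (Ψ : Fin w.length → I → I → Δ.toPlanarComplex.Space)
    (hc : ∀ i, Continuous fun q : I × I => Ψ i q.1 q.2)
    (hΨ : ∀ i i' s s', Δ.toPlanarComplex.edgePt (Δ.boundary i) s =
      Δ.toPlanarComplex.edgePt (Δ.boundary i') s' → ∀ t, Ψ i s t = Ψ i' s' t) :
    ∃ ψ : Δ.bdrySet × I → Δ.toPlanarComplex.Space, Continuous ψ ∧
      ∀ (p : Δ.bdrySet) i s, p.1 = Δ.toPlanarComplex.edgePt (Δ.boundary i) s →
        ∀ t, ψ (p, t) = Ψ i s t := by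
  have hq := Δ.isQuotientMap_bdryParam h
  have hΨc : Continuous fun q : (Fin w.length × I) × I => Ψ q.1.1 q.1.2 q.2 := by
    have : Continuous fun q : Fin w.length × (I × I) => Ψ q.1 q.2.1 q.2.2 :=
      continuous_prod_of_discrete_left.2 hc
    exact this.comp (f := fun q : (Fin w.length × I) × I => (q.1.1, (q.1.2, q.2))) (by fun_prop)
  have hfac : ∀ q q' : (Fin w.length × I) × I, Δ.bdryParam q = Δ.bdryParam q' →
      Ψ q.1.1 q.1.2 q.2 = Ψ q'.1.1 q'.1.2 q'.2 := by
    intro q q' hqq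
    rw [show q.2 = q'.2 from (Prod.ext_iff.1 hqq).2]
    exact hΨ _ _ _ _ (congrArg Subtype.val (Prod.ext_iff.1 hqq).1) _
  choose g hg using hq.surjective
  refine ⟨fun z => Ψ (g z).1.1 (g z).1.2 (g z).2, ?_, ?_⟩
  · rw [hq.continuous_iff]
    convert hΨc using 1
    funext q
    exact hfac _ _ (hg _)
  · intro p i s hp t
    refine hfac (g (p, t)) ((i, s), t) ?_
    rw [hg]
    exact Prod.ext (Subtype.ext hp) rfl

end VanKampenDiagram

end TameFilling

/-! ### Subdivision of the edges of a planar map -/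

namespace TameFilling

open unitInterval

/-- The relation of lying on a common cycle is the least equivalence relation containing the steps
of the permutation. -/
theorem rel_of_sameCycle {α : Type*} {f : Equiv.Perm α} {r : α → α → Prop} (hr : Equivalence r)
    (hf : ∀ x, r x (f x)) {x y : α} (h : f.SameCycle x y) : r x y := by
  have hnat : ∀ (n : ℕ) x, r x ((f ^ n) x) := by
    intro n
    induction n with
    | zero => intro x; exact hr.refl _
    | succ n ih => intro x; rw [pow_succ]; exact hr.trans (hf x) (ih (f x))
  obtain ⟨n | n, rfl⟩ := h
  · exact hnat n x
  · have := hnat (n + 1) ((f ^ (Int.negSucc n)) x)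
    rw [zpow_negSucc, ← Equiv.Perm.mul_apply, mul_inv_cancel, Equiv.Perm.one_apply] at this
    rw [zpow_negSucc]
    exact hr.symm this

theorem sameCycle_apply {α : Type*} (f : Equiv.Perm α) (x : α) : f.SameCycle x (f x) :=
  (Equiv.Perm.SameCycle.refl f x).apply_right

theorem concatPieces_mem {X Z : Type*} (f : ℕ → Z → ℝ → X) (k : ℕ) (z : Z) (x : ℝ) :
    ∃ p ≤ k, ∃ y, concatPieces f k z x = f p z y := by
  induction k with
  | zero => exact ⟨0, le_rfl, x, rfl⟩
  | succ k ih =>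
    simp only [concatPieces]
    split_ifs
    · obtain ⟨p, hp, y, h⟩ := ih
      exact ⟨p, by omega, y, h⟩
    · exact ⟨k + 1, le_rfl, _, rfl⟩

/-- A subdivision of the edges of a planar complex: the number of pieces of every edge, and a choice
of one direction for every edge. -/
structure EdgeSubdivision (Y : PlanarComplex) where
  len : Y.D → ℕ
  len_pos : ∀ d, 0 < len d
  len_rev : ∀ d, len (Y.rev d) = len d
  dir : Y.D → Prop
  dir_rev : ∀ d, dir (Y.rev d) ↔ ¬ dir d

namespace EdgeSubdivision

variable {Y : PlanarComplex} (U : EdgeSubdivision Y)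

/-- Directed edges of the subdivision. -/
abbrev Dart : Type := {x : Y.D × ℕ // x.2 < U.len x.1}

/-- Vertices in the interior of subdivided edges. -/
abbrev Mid : Type := {x : Y.D × ℕ // U.dir x.1 ∧ 0 < x.2 ∧ x.2 < U.len x.1}

/-- Vertices of the subdivision. -/
abbrev Vert : Type := Y.V ⊕ U.Mid

open Classical in
/-- The vertex at position `p` along the edge `d`. -/
noncomputable def vertAt (d : Y.D) (p : ℕ) : U.Vert :=
  if h : 0 < p ∧ p < U.len d then
    if hd : U.dir d then .inr ⟨(d, p), hd, h⟩
    -- Interior vertices are stored once, along the chosen direction; seen from the other direction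
    -- the position is counted from the opposite end.
    else .inr ⟨(Y.rev d, U.len d - p), (U.dir_rev d).2 hd, by simp; omega,
      by have := U.len_rev d; simp; omega⟩
  else if p = 0 then .inl (Y.src d) else .inl (Y.tgt d)

theorem vertAt_zero (d : Y.D) : U.vertAt d 0 = .inl (Y.src d) := by
  simp [vertAt]

theorem vertAt_len (d : Y.D) : U.vertAt d (U.len d) = .inl (Y.tgt d) := by
  have := U.len_pos d
  simp [vertAt, this.ne']

theorem vertAt_of_dir {d : Y.D} {p : ℕ} (hd : U.dir d) (h : 0 < p ∧ p < U.len d) :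
    U.vertAt d p = .inr ⟨(d, p), hd, h⟩ := by
  simp [vertAt, h, hd]

theorem vertAt_rev (d : Y.D) (p : ℕ) (hp : p ≤ U.len d) :
    U.vertAt (Y.rev d) (U.len d - p) = U.vertAt d p := by
  have hl := U.len_rev d
  rcases Nat.eq_zero_or_pos p with rfl | h0
  · rw [Nat.sub_zero, ← hl, vertAt_len, vertAt_zero, Y.tgt_rev]
  rcases hp.eq_or_lt with rfl | h1
  · rw [Nat.sub_self, vertAt_zero, vertAt_len]
    rfl
  have h2 : 0 < U.len d - p ∧ U.len d - p < U.len (Y.rev d) := by omega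
  by_cases hd : U.dir d
  · have hd' : ¬ U.dir (Y.rev d) := fun h => (U.dir_rev d).1 h hd
    rw [vertAt_of_dir U hd ⟨h0, h1⟩, vertAt, dif_pos h2, dif_neg hd']
    congr 3
    · exact Y.rev_rev d
    · omega
  · have hd' : U.dir (Y.rev d) := (U.dir_rev d).2 hd
    rw [vertAt_of_dir U hd' h2, vertAt, dif_pos ⟨h0, h1⟩, dif_neg hd]

theorem vertAt_eq_inl_iff {d : Y.D} {p : ℕ} (hp : p < U.len d) (v : Y.V) :
    U.vertAt d p = .inl v ↔ p = 0 ∧ Y.src d = v := by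
  rcases Nat.eq_zero_or_pos p with rfl | h0
  · simp [vertAt_zero]
  · have : p ≠ 0 := h0.ne'
    simp only [vertAt, h0, hp, and_self, dif_pos, this, false_and, iff_false]
    split_ifs <;> simp

theorem vertAt_eq_vertAt {d d' : Y.D} {p p' : ℕ} (h0 : 0 < p) (hp : p < U.len d) (h0' : 0 < p')
    (hp' : p' < U.len d') (h : U.vertAt d p = U.vertAt d' p') :
    (d' = d ∧ p' = p) ∨ (d' = Y.rev d ∧ p' = U.len d - p) := by
  have hl := U.len_rev d
  have hl' := U.len_rev d'
  by_cases hd : U.dir d <;> by_cases hd' : U.dir d'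
  · rw [vertAt_of_dir U hd ⟨h0, hp⟩, vertAt_of_dir U hd' ⟨h0', hp'⟩] at h
    simp only [Sum.inr.injEq, Subtype.mk.injEq, Prod.mk.injEq] at h
    exact Or.inl ⟨h.1.symm, h.2.symm⟩
  · rw [vertAt_of_dir U hd ⟨h0, hp⟩, ← U.vertAt_rev d' p' hp'.le,
      vertAt_of_dir U ((U.dir_rev d').2 hd') (by omega)] at h
    simp only [Sum.inr.injEq, Subtype.mk.injEq, Prod.mk.injEq] at h
    obtain ⟨rfl, h2⟩ := h
    exact Or.inr ⟨(Y.rev_rev d').symm, by omega⟩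
  · rw [vertAt_of_dir U hd' ⟨h0', hp'⟩, ← U.vertAt_rev d p hp.le,
      vertAt_of_dir U ((U.dir_rev d).2 hd) (by omega)] at h
    simp only [Sum.inr.injEq, Subtype.mk.injEq, Prod.mk.injEq] at h
    exact Or.inr ⟨h.1.symm, h.2.symm⟩
  · rw [← U.vertAt_rev d p hp.le, ← U.vertAt_rev d' p' hp'.le,
      vertAt_of_dir U ((U.dir_rev d).2 hd) (by omega),
      vertAt_of_dir U ((U.dir_rev d').2 hd') (by omega)] at h
    simp only [Sum.inr.injEq, Subtype.mk.injEq, Prod.mk.injEq] at h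
    have := Y.rev_rev d
    rw [h.1, Y.rev_rev] at this
    subst this
    exact Or.inl ⟨rfl, by omega⟩

/-- The initial directed edge of the subdivision of `d`. -/
def first (d : Y.D) : U.Dart := ⟨(d, 0), U.len_pos d⟩

/-- Reversal in the subdivision. -/
def revDart (x : U.Dart) : U.Dart :=
  -- The piece at position p runs from vertex p to vertex p + 1, hence the extra -1 compared with
  -- the reversal of vertex positions.
  ⟨(Y.rev x.1.1, U.len x.1.1 - 1 - x.1.2), by have := U.len_rev x.1.1; have := x.2; simp; omega⟩

theorem revDart_revDart (x : U.Dart) : U.revDart (U.revDart x) = x := by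
  obtain ⟨⟨d, p⟩, h⟩ := x
  have := U.len_rev d
  simp only [revDart, Subtype.mk.injEq, Prod.mk.injEq, Y.rev_rev, true_and]
  simp only at h
  omega

/-- The successor of a directed edge on the boundary of a face of the subdivision. -/
def nextDart (x : U.Dart) : U.Dart :=
  if h : x.1.2 + 1 < U.len x.1.1 then ⟨(x.1.1, x.1.2 + 1), h⟩ else U.first (Y.next x.1.1)

/-- The predecessor of a directed edge on the boundary of a face of the subdivision. -/
def prevDart (x : U.Dart) : U.Dart :=
  if x.1.2 = 0 then ⟨(Y.next.symm x.1.1, U.len (Y.next.symm x.1.1) - 1),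
    Nat.sub_lt (U.len_pos _) one_pos⟩
  else ⟨(x.1.1, x.1.2 - 1), by have := x.2; simp; omega⟩

/-- The boundary permutation of the subdivision. -/
def nextPerm : Equiv.Perm U.Dart where
  toFun := U.nextDart
  invFun := U.prevDart
  left_inv x := by
    obtain ⟨⟨d, p⟩, h⟩ := x
    simp only at h
    by_cases h1 : p + 1 < U.len d
    · simp [nextDart, prevDart, h1]
    · simp [nextDart, prevDart, h1, first]
      omega
  right_inv x := by
    obtain ⟨⟨d, p⟩, h⟩ := x
    simp only at h
    rcases Nat.eq_zero_or_pos p with rfl | h0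
    · have := U.len_pos (Y.next.symm d)
      simp [nextDart, prevDart, first]
      omega
    · have h1 : p - 1 + 1 = p := by omega
      simp [nextDart, prevDart, h0.ne', h1, h]

theorem nextPerm_of_lt {d : Y.D} {p : ℕ} (hp : p < U.len d) (h : p + 1 < U.len d) :
    U.nextPerm ⟨(d, p), hp⟩ = ⟨(d, p + 1), h⟩ := by
  simp [nextPerm, nextDart, h]

theorem nextPerm_last {d : Y.D} {p : ℕ} (hp : p < U.len d) (h : p + 1 = U.len d) :
    U.nextPerm ⟨(d, p), hp⟩ = U.first (Y.next d) := by
  simp [nextPerm, nextDart, h]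

theorem sameCycle_first (x : U.Dart) : U.nextPerm.SameCycle (U.first x.1.1) x := by
  obtain ⟨⟨d, p⟩, h⟩ := x
  simp only at h ⊢
  induction p with
  | zero => exact .refl _ _
  | succ p ih =>
    refine (ih (by omega)).trans ?_
    have := sameCycle_apply U.nextPerm ⟨(d, p), by simp; omega⟩
    rwa [nextPerm_of_lt U _ h] at this

/-- The rotation of the subdivision around its vertices. -/
def rotPerm : Equiv.Perm U.Dart :=
  U.nextPerm * Function.Involutive.toPerm U.revDart U.revDart_revDart

/-- Around old vertices the rotation is the old one, acting on initial pieces; around a new vertex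
(`rotPerm_of_pos`) it exchanges the two pieces that meet there. -/
theorem rotPerm_first (d : Y.D) : U.rotPerm (U.first d) = U.first (Y.next (Y.rev d)) := by
  have := U.len_rev d
  have := U.len_pos d
  exact U.nextPerm_last (d := Y.rev d) (p := U.len d - 1 - 0) _ (by omega)

theorem rotPerm_of_pos {d : Y.D} {p : ℕ} (hp : p < U.len d) (h : 0 < p) :
    U.rotPerm ⟨(d, p), hp⟩ = ⟨(Y.rev d, U.len d - p), by have := U.len_rev d; simp; omega⟩ := by
  have := U.len_rev d
  refine (U.nextPerm_of_lt (d := Y.rev d) (p := U.len d - 1 - p) (by omega) (by omega)).trans ?_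
  refine Subtype.ext (Prod.ext rfl ?_)
  simp only
  omega

theorem vertAt_rotPerm (x : U.Dart) :
    U.vertAt (U.rotPerm x).1.1 (U.rotPerm x).1.2 = U.vertAt x.1.1 x.1.2 := by
  obtain ⟨⟨d, p⟩, h⟩ := x
  simp only at h
  rcases Nat.eq_zero_or_pos p with rfl | h0
  · have h1 := U.rotPerm_first d
    unfold first at h1
    rw [h1]
    simp only
    rw [vertAt_zero, vertAt_zero, Y.src_next, Y.tgt_rev]
  · rw [rotPerm_of_pos U h h0]
    exact U.vertAt_rev d p h.le

theorem vertAt_eq_iff_sameCycle (x y : U.Dart) :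
    U.vertAt x.1.1 x.1.2 = U.vertAt y.1.1 y.1.2 ↔ U.rotPerm.SameCycle x y := by
  constructor
  · intro h
    obtain ⟨⟨d, p⟩, hp⟩ := x
    obtain ⟨⟨d', p'⟩, hp'⟩ := y
    simp only at h hp hp'
    rcases Nat.eq_zero_or_pos p with rfl | h0
    · rw [vertAt_zero, eq_comm, vertAt_eq_inl_iff U hp'] at h
      obtain ⟨rfl, h⟩ := h
      have hs := (Y.src_eq_iff d d').1 h.symm
      refine rel_of_sameCycle (r := fun d d' => U.rotPerm.SameCycle (U.first d) (U.first d'))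
        ⟨fun _ => .refl _ _, fun h => h.symm, fun h h' => h.trans h'⟩ ?_ hs
      intro e
      have := sameCycle_apply U.rotPerm (U.first e)
      rwa [rotPerm_first] at this
    rcases Nat.eq_zero_or_pos p' with rfl | h0'
    · rw [vertAt_zero, vertAt_eq_inl_iff U hp] at h
      omega
    · rcases U.vertAt_eq_vertAt h0 hp h0' hp' h with ⟨rfl, rfl⟩ | ⟨rfl, rfl⟩
      · exact .refl _ _
      · have := sameCycle_apply U.rotPerm ⟨(d, p), hp⟩
        rwa [rotPerm_of_pos U hp h0] at this
  · exact rel_of_sameCycle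
      (r := fun x y : U.Dart => U.vertAt x.1.1 x.1.2 = U.vertAt y.1.1 y.1.2)
      ⟨fun _ => rfl, fun h => h.symm, fun h h' => h.trans h'⟩ fun x => (U.vertAt_rotPerm x).symm

/-- Every piece lies on the cycle of the initial piece of its edge, and the initial pieces follow
each other as the old edges do. -/
theorem face_eq_iff_sameCycle (x y : U.Dart) :
    Y.face x.1.1 = Y.face y.1.1 ↔ U.nextPerm.SameCycle x y := by
  constructor
  · intro h
    refine (U.sameCycle_first x).symm.trans (.trans ?_ (U.sameCycle_first y))
    refine rel_of_sameCycle (r := fun d d' => U.nextPerm.SameCycle (U.first d) (U.first d'))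
      ⟨fun _ => .refl _ _, fun h => h.symm, fun h h' => h.trans h'⟩ ?_ ((Y.face_eq_iff _ _).1 h)
    intro e
    have h1 : U.len e - 1 < U.len e := Nat.sub_lt (U.len_pos e) one_pos
    have h2 := sameCycle_apply U.nextPerm ⟨(e, U.len e - 1), h1⟩
    rw [nextPerm_last U h1 (Nat.sub_add_cancel (U.len_pos e))] at h2
    exact (U.sameCycle_first ⟨(e, U.len e - 1), h1⟩).trans h2
  · refine rel_of_sameCycle (r := fun x y : U.Dart => Y.face x.1.1 = Y.face y.1.1)
      ⟨fun _ => rfl, fun h => h.symm, fun h h' => h.trans h'⟩ ?_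
    rintro ⟨⟨d, p⟩, hp⟩
    simp only at hp
    rcases Nat.lt_or_ge (p + 1) (U.len d) with h | h
    · rw [nextPerm_of_lt U hp h]
    · rw [nextPerm_last U hp (by omega)]
      exact (Y.face_eq_iff _ _).2 (sameCycle_apply _ _)

instance : Finite U.Dart := by
  have := Y.finite_D
  refine Finite.of_injective (β := Σ d : Y.D, Fin (U.len d)) (fun x => ⟨x.1.1, x.1.2, x.2⟩) ?_
  rintro ⟨⟨d, p⟩, h⟩ ⟨⟨d', p'⟩, h'⟩ e
  simp only [Sigma.mk.injEq] at e
  obtain ⟨rfl, e⟩ := e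
  simpa using e

instance : Finite U.Mid :=
  Finite.of_injective (β := U.Dart) (fun x => ⟨x.1, x.2.2.2⟩) fun x y h => by
    simpa [Subtype.ext_iff] using h

/-- A new vertex splits an edge in two and so adds two directed edges; this is why the Euler formula
survives subdivision. -/
theorem card_dart : Nat.card U.Dart = Nat.card Y.D + (Nat.card U.Mid + Nat.card U.Mid) := by
  have := Y.finite_D
  rw [← Nat.card_sum, ← Nat.card_sum]
  -- The directed edges are sorted into initial pieces, later pieces along the chosen direction, and
  -- later pieces against it.
  refine (Nat.card_congr (Equiv.ofBijective (Sum.elim U.first (Sum.elim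
    (fun x => ⟨x.1, x.2.2.2⟩) fun x => ⟨(Y.rev x.1.1, x.1.2), by
      rw [U.len_rev]; exact x.2.2.2⟩)) ⟨?_, ?_⟩)).symm
  · rintro (d | ⟨⟨d, p⟩, hd, h0, h⟩ | ⟨⟨d, p⟩, hd, h0, h⟩)
      (d' | ⟨⟨d', p'⟩, hd', h0', h'⟩ | ⟨⟨d', p'⟩, hd', h0', h'⟩) e <;>
      simp only [Sum.elim_inl, Sum.elim_inr, first, Subtype.mk.injEq, Prod.mk.injEq] at *
    · rw [e.1]
    · omega
    · omega
    · omega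
    · obtain ⟨rfl, rfl⟩ := e; rfl
    · rw [e.1, U.dir_rev] at hd
      exact absurd hd' hd
    · omega
    · rw [← e.1, U.dir_rev] at hd'
      exact absurd hd hd'
    · have hr := Y.rev_rev d
      rw [e.1, Y.rev_rev] at hr
      obtain ⟨-, rfl⟩ := e
      subst hr
      rfl
  · rintro ⟨⟨d, p⟩, h⟩
    simp only at h
    rcases Nat.eq_zero_or_pos p with rfl | h0
    · exact ⟨.inl d, rfl⟩
    by_cases hd : U.dir d
    · exact ⟨.inr (.inl ⟨(d, p), hd, h0, h⟩), rfl⟩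
    · refine ⟨.inr (.inr ⟨(Y.rev d, p), (U.dir_rev d).2 hd, h0, ?_⟩), ?_⟩
      · simpa only [U.len_rev] using h
      · simp [Y.rev_rev]

/-- The graph of the subdivision. -/
noncomputable def oneComplex : OneComplex.{0, 0} where
  V := U.Vert
  D := U.Dart
  src x := U.vertAt x.1.1 x.1.2
  rev := U.revDart
  rev_rev := U.revDart_revDart

theorem src_oneComplex (x : U.Dart) : U.oneComplex.src x = U.vertAt x.1.1 x.1.2 := rfl

theorem tgt_oneComplex (x : U.Dart) : U.oneComplex.tgt x = U.vertAt x.1.1 (x.1.2 + 1) := by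
  obtain ⟨⟨d, p⟩, hp⟩ := x
  simp only at hp
  rw [← U.vertAt_rev d (p + 1) hp, ← Nat.sub_sub, Nat.sub_right_comm]
  rfl

theorem reachable_vertAt (d : Y.D) (p : ℕ) (hp : p ≤ U.len d) :
    U.oneComplex.graph.Reachable (Sum.inl (Y.src d) : U.Vert) (U.vertAt d p) := by
  induction p with
  | zero => rw [vertAt_zero]; exact SimpleGraph.Reachable.refl _
  | succ p ih =>
    refine (ih (by omega)).trans ?_
    have := U.oneComplex.reachable_src_tgt (⟨(d, p), hp⟩ : U.Dart)
    rwa [tgt_oneComplex, src_oneComplex] at this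

theorem connected_oneComplex : U.oneComplex.graph.Connected := by
  obtain ⟨v₀⟩ := Y.connected.nonempty
  have hinl : ∀ v : Y.V, U.oneComplex.graph.Reachable (Sum.inl v₀ : U.Vert) (Sum.inl v : U.Vert) := by
    intro v
    obtain ⟨p⟩ := Y.connected.preconnected v₀ v
    induction p with
    | nil => exact SimpleGraph.Reachable.refl _
    | cons h p ih =>
      obtain ⟨-, d, rfl, rfl⟩ := (Y.graph_adj_iff _ _).1 h
      refine SimpleGraph.Reachable.trans ?_ ih
      rw [← U.vertAt_len d]
      exact U.reachable_vertAt d _ le_rfl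
  have hall : ∀ v : U.Vert, U.oneComplex.graph.Reachable (Sum.inl v₀ : U.Vert) v := by
    rintro (v | ⟨⟨d, p⟩, h⟩)
    · exact hinl v
    · rw [← U.vertAt_of_dir h.1 h.2]
      exact (hinl _).trans (U.reachable_vertAt d p h.2.2.le)
  have : Nonempty U.oneComplex.V := ⟨(Sum.inl v₀ : U.Vert)⟩
  exact SimpleGraph.Connected.mk fun u v => (hall u).symm.trans (hall v)

/-- The subdivided planar complex. -/
noncomputable def complex : PlanarComplex where
  toOneComplex := U.oneComplex
  F := Y.F
  finite_V := by
    have := Y.finite_V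
    exact inferInstanceAs (Finite U.Vert)
  finite_D := inferInstanceAs (Finite U.Dart)
  finite_F := Y.finite_F
  rev_ne x h := Y.rev_ne x.1.1 (congrArg (fun z : U.Dart => z.1.1) h)
  next := U.nextPerm
  face x := Y.face x.1.1
  src_eq_iff := U.vertAt_eq_iff_sameCycle
  face_eq_iff := U.face_eq_iff_sameCycle
  face_surj f := by
    obtain ⟨d, hd⟩ := Y.face_surj f
    exact ⟨U.first d, hd⟩
  connected := U.connected_oneComplex
  euler := by
    have := Y.finite_V
    have h := Y.euler
    change 2 * (Nat.card (Y.V ⊕ U.Mid) + Nat.card Y.F) = Nat.card U.Dart + 2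
    rw [card_dart, Nat.card_sum]
    omega

theorem rev_complex (x : U.Dart) : U.complex.rev x = U.revDart x := rfl

theorem src_complex (x : U.Dart) : U.complex.src x = U.vertAt x.1.1 x.1.2 := rfl

theorem tgt_complex (x : U.Dart) : U.complex.tgt x = U.vertAt x.1.1 (x.1.2 + 1) :=
  U.tgt_oneComplex x

/-! ### The polygonal wedge over a subdivided side -/

/-- The side of the subdivision at position `p` (or the last one) of a side. -/
def sideAt (d : Y.Side) (p : ℕ) : U.complex.Side :=
  ⟨(⟨(d.1, min p (U.len d.1 - 1)), by have := U.len_pos d.1; simp; omega⟩ : U.Dart), d.2⟩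

/-- The union of the squares over the pieces of a subdivided side, as the image of a square. -/
noncomputable def wedge (d : Y.Side) (x r : ℝ) : U.complex.Space :=
  concatPieces (fun p r x => U.complex.facePt (U.sideAt d p) x r) (U.len d.1 - 1) r (U.len d.1 * x)

theorem sideAt_turn (d : Y.Side) (p : ℕ) (hp : p < U.len d.1 - 1) (r : ℝ) :
    U.complex.facePt (U.sideAt d p) 1 r = U.complex.facePt (U.sideAt d (p + 1)) 0 r := by
  refine U.complex.facePt_turn _ _ ?_ r
  have h1 : min p (U.len d.1 - 1) = p := by omega
  have h2 : min (p + 1) (U.len d.1 - 1) = p + 1 := by omega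
  simp only [sideAt, h1, h2]
  exact U.nextPerm_of_lt _ (by omega)

theorem continuous_wedge (d : Y.Side) : Continuous fun q : ℝ × ℝ => U.wedge d q.1 q.2 := by
  have := continuous_concatPieces (fun p r x => U.complex.facePt (U.sideAt d p) x r)
    (U.len d.1 - 1)
    (fun p _ => (U.complex.continuous_facePt (U.sideAt d p)).comp continuous_swap)
    fun p hp r => U.sideAt_turn d p hp r
  exact this.comp (f := fun q : ℝ × ℝ => (q.2, U.len d.1 * q.1)) (by fun_prop)

theorem wedge_eq (d : Y.Side) (p : ℕ) (hp : p < U.len d.1) (x r : ℝ) (h0 : p ≤ U.len d.1 * x)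
    (h1 : U.len d.1 * x ≤ p + 1) :
    U.wedge d x r = U.complex.facePt (U.sideAt d p) (U.len d.1 * x - p) r :=
  concatPieces_apply _ _ _ (fun p hp => U.sideAt_turn d p hp r) p (by omega) _ h0 h1

theorem wedge_mem (d : Y.Side) (x r : ℝ) :
    ∃ p y, U.wedge d x r = U.complex.facePt (U.sideAt d p) y r := by
  obtain ⟨p, -, y, h⟩ := concatPieces_mem
    (fun p r x => U.complex.facePt (U.sideAt d p) x r) (U.len d.1 - 1) r (U.len d.1 * x)
  exact ⟨p, y, h⟩

theorem wedge_apex (d d' : Y.Side) (h : d.cell = d'.cell) (x x' : ℝ) :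
    U.wedge d x 1 = U.wedge d' x' 1 := by
  obtain ⟨p, y, e⟩ := U.wedge_mem d x 1
  obtain ⟨p', y', e'⟩ := U.wedge_mem d' x' 1
  rw [e, e']
  exact U.complex.facePt_one _ _ h _ _

theorem wedge_start (d : Y.Side) (r : ℝ) :
    U.wedge d 0 r = U.complex.facePt (U.sideAt d 0) 0 r := by
  rw [U.wedge_eq d 0 (U.len_pos d.1) 0 r (by simp) (by simp)]
  simp

theorem wedge_turn (d d' : Y.Side) (h : Y.next d.1 = d'.1) (r : ℝ) :
    U.wedge d 1 r = U.wedge d' 0 r := by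
  have h0 := U.len_pos d.1
  have h0' : (1 : ℝ) ≤ U.len d.1 := by exact_mod_cast h0
  have hcast : ((U.len d.1 - 1 : ℕ) : ℝ) = U.len d.1 - 1 := by push_cast [Nat.cast_sub h0]; ring
  rw [wedge_start, U.wedge_eq d (U.len d.1 - 1) (by omega) 1 r (by rw [hcast]; linarith)
    (by rw [hcast]; linarith), hcast, mul_one, sub_sub_cancel]
  refine U.complex.facePt_turn _ _ ?_ r
  simp only [sideAt, min_self, Nat.zero_min, ← h]
  exact U.nextPerm_last _ (by omega)

theorem wedge_zero_zero (d : Y.Side) :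
    U.wedge d 0 0 = U.complex.vertPt (Sum.inl (Y.src d.1) : U.Vert) := by
  rw [wedge_start, PlanarComplex.facePt_zero, Set.projIcc_left]
  refine (U.complex.edgePt_zero _).trans ?_
  rw [← U.vertAt_zero d.1]
  simp [sideAt, src_complex]

theorem wedge_zero_mem_oneSkeleton (d : Y.Side) (x : ℝ) :
    U.wedge d x 0 ∈ U.complex.oneSkeleton := by
  obtain ⟨p, y, h⟩ := U.wedge_mem d x 0
  rw [h, PlanarComplex.facePt_zero]
  exact U.complex.edgePt_mem_oneSkeleton _ _

/-- The wedges on the two sides of an edge meet along this edge. All gluing of neighbouring cells,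
across rungs and across columns, goes through this identity. -/
theorem wedge_rev (d d' : Y.Side) (h : d'.1 = Y.rev d.1) {x : ℝ} (hx : x ∈ Set.Icc (0 : ℝ) 1) :
    U.wedge d' (1 - x) 0 = U.wedge d x 0 := by
  have h0 := U.len_pos d.1
  have hl : U.len d'.1 = U.len d.1 := by rw [h, U.len_rev]
  have hk : ((U.len d.1 - 1 : ℕ) : ℝ) = U.len d.1 - 1 := by push_cast [Nat.cast_sub h0]; ring
  have hx0 : 0 ≤ U.len d.1 * x := mul_nonneg (Nat.cast_nonneg _) hx.1
  have hx1 : U.len d.1 * x ≤ U.len d.1 := mul_le_of_le_one_right (Nat.cast_nonneg _) hx.2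
  -- `p` is the piece containing the point; read along the reversed edge it is piece `len - 1 - p`.
  set p := pieceIndex (U.len d.1 - 1) (U.len d.1 * x) with hp
  have hpl : p ≤ U.len d.1 - 1 := pieceIndex_le _ _
  have hp0 : (p : ℝ) ≤ U.len d.1 * x := pieceIndex_cast_le _ hx0
  have hp1 : U.len d.1 * x ≤ p + 1 := le_pieceIndex_add_one _ (by rw [hk]; linarith)
  have hc : ((U.len d.1 - 1 - p : ℕ) : ℝ) = U.len d.1 - 1 - p := by
    rw [Nat.cast_sub hpl, hk]
  rw [U.wedge_eq d p (by omega) x 0 hp0 hp1, U.wedge_eq d' (U.len d.1 - 1 - p) (by omega) (1 - x) 0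
    (by rw [hl, hc]; linarith) (by rw [hl, hc]; linarith), PlanarComplex.facePt_zero,
    PlanarComplex.facePt_zero, hl, hc, ← U.complex.edgePt_rev]
  congr 1
  · simp only [sideAt, rev_complex, revDart]
    refine Subtype.ext (Prod.ext (by simp only [h, Y.rev_rev]) ?_)
    simp only
    omega
  · have e : (U.len d.1 : ℝ) * (1 - x) - (U.len d.1 - 1 - p) = 1 - (U.len d.1 * x - p) := by ring
    have hm : U.len d.1 * x - p ∈ Set.Icc (0 : ℝ) 1 := ⟨by linarith, by linarith⟩
    have hm' : 1 - (U.len d.1 * x - p) ∈ Set.Icc (0 : ℝ) 1 := ⟨by linarith, by linarith⟩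
    rw [e, Set.projIcc_of_mem _ hm, Set.projIcc_of_mem _ hm']
    exact Subtype.ext (by simp)

/-- Needed for the top rungs, each a single letter: there the wedge parametrizes the boundary edge
itself, so the combing ends at the prescribed point. -/
theorem wedge_of_len_eq_one (d : Y.Side) (h : U.len d.1 = 1) {x : ℝ}
    (hx : x ∈ Set.Icc (0 : ℝ) 1) :
    U.wedge d x 0 = U.complex.edgePt (U.first d.1) ⟨x, hx⟩ := by
  rw [U.wedge_eq d 0 (U.len_pos d.1) x 0 (by simpa [h] using hx.1) (by simpa [h] using hx.2),
    PlanarComplex.facePt_zero, h, Nat.cast_one, one_mul, Nat.cast_zero, sub_zero,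
    Set.projIcc_of_mem _ hx]
  simp [sideAt, first]

end EdgeSubdivision

end TameFilling

namespace TameFilling

/-! ### A disc of fans: columns joined by rungs, the outer columns and the bottom row collapsed -/

namespace Grid

variable {m L : ℕ}

/-- Directed edges: column edges between neighbouring levels (`inl`), and rungs between neighbouring
columns (`inr`), in both directions. -/
abbrev Dart (m L : ℕ) : Type := ((Fin m × Fin L) ⊕ (Fin (m + 1) × Fin L)) × Bool

/-- Vertices: the basepoint `none`, and a vertex for every inner column and positive level. -/
abbrev Vert (m L : ℕ) : Type := Option (Fin m × Fin L)

/-- Faces: a cell for every strip between neighbouring columns and every level. -/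
abbrev Face (m L : ℕ) : Type := Fin (m + 1) × Fin L

/-- The edge of column `i + 1` from level `j` to level `j + 1`. -/
def up (i j : ℕ) (hi : i < m) (hj : j < L) : Dart m L := (.inl (⟨i, hi⟩, ⟨j, hj⟩), true)

/-- The edge of column `i + 1` from level `j + 1` to level `j`. -/
def down (i j : ℕ) (hi : i < m) (hj : j < L) : Dart m L := (.inl (⟨i, hi⟩, ⟨j, hj⟩), false)

/-- The rung at level `j + 1` from column `i` to column `i + 1`. -/
def right (i j : ℕ) (hi : i < m + 1) (hj : j < L) : Dart m L := (.inr (⟨i, hi⟩, ⟨j, hj⟩), true)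

/-- The rung at level `j + 1` from column `i + 1` to column `i`. -/
def left (i j : ℕ) (hi : i < m + 1) (hj : j < L) : Dart m L := (.inr (⟨i, hi⟩, ⟨j, hj⟩), false)

/-- The vertex of column `i` at level `j`. -/
def vtx (m L : ℕ) : ℕ → ℕ → Vert m L
  | i + 1, j + 1 => if h : i < m ∧ j < L then some (⟨i, h.1⟩, ⟨j, h.2⟩) else none
  | _, _ => none

@[simp] theorem vtx_zero_left (j : ℕ) : vtx m L 0 j = none := by simp [vtx]

@[simp] theorem vtx_zero_right (i : ℕ) : vtx m L i 0 = none := by cases i <;> simp [vtx]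

@[simp] theorem vtx_last (j : ℕ) : vtx m L (m + 1) j = none := by cases j <;> simp [vtx]

theorem vtx_succ_succ {i j : ℕ} (hi : i < m) (hj : j < L) :
    vtx m L (i + 1) (j + 1) = some (⟨i, hi⟩, ⟨j, hj⟩) := by simp [vtx, hi, hj]

/-- Reversal of directed edges. -/
def rev (d : Dart m L) : Dart m L := (d.1, !d.2)

/-- The initial vertex of a directed edge. -/
def src : Dart m L → Vert m L
  | (.inl (i, j), true) => vtx m L (i + 1) j
  | (.inl (i, j), false) => vtx m L (i + 1) (j + 1)
  | (.inr (i, j), true) => vtx m L i (j + 1)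
  | (.inr (i, j), false) => vtx m L (i + 1) (j + 1)

/-- The face on the left of a directed edge; `none` is the outer face. -/
def face : Dart m L → Option (Face m L)
  -- Strip i + 1 is to the left of column i + 1: drawn with levels going up, columns are numbered
  -- from right to left, which makes the path along the top rungs counterclockwise.
  | (.inl (i, j), true) => some (i.succ, j)
  | (.inl (i, j), false) => some (i.castSucc, j)
  | (.inr (i, j), true) => some (i, j)
  | (.inr (i, ⟨j, _⟩), false) => if h : j + 1 < L then some (i, ⟨j + 1, h⟩) else none

/-- The edge of a cell after its bottom corner on the left column. -/
def afterBottom : (i j : ℕ) → i < m + 1 → j < L → Dart m L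
  -- In strip 0 the left column is collapsed, so the upper rung comes next at once. The other
  -- special cases arise in the same way from column m + 1 and from the ground level.
  | 0, j, hi, hj => right 0 j hi hj
  | i + 1, j, hi, hj => up i j (Nat.lt_of_succ_lt_succ hi) hj

/-- The edge of a cell after its bottom corner on the right column. -/
def afterRight : (i j : ℕ) → i < m + 1 → j < L → Dart m L
  | i, 0, hi, hj => afterBottom i 0 hi hj
  | i, j + 1, hi, hj => left i j hi (Nat.lt_of_succ_lt hj)

/-- The edge of a cell before its bottom corner on the right column. -/
def beforeBottom (i j : ℕ) (hi : i < m + 1) (hj : j < L) : Dart m L :=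
  if h : i < m then down i j h hj else right i j hi hj

/-- The edge of a cell before its bottom corner on the left column. -/
def beforeLeft : (i j : ℕ) → i < m + 1 → j < L → Dart m L
  | i, 0, hi, hj => beforeBottom i 0 hi hj
  | i, j + 1, hi, hj => left i j hi (Nat.lt_of_succ_lt hj)

/-- The successor of a directed edge on the boundary of the face on its left. -/
def next : Dart m L → Dart m L
  | (.inl (⟨i, hi⟩, ⟨j, hj⟩), true) => right (i + 1) j (Nat.succ_lt_succ hi) hj
  | (.inl (⟨i, hi⟩, ⟨j, hj⟩), false) => afterRight i j (Nat.lt_succ_of_lt hi) hj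
  | (.inr (⟨i, hi⟩, ⟨j, hj⟩), true) => if h : i < m then down i j h hj else afterRight i j hi hj
  | (.inr (⟨0, hi⟩, ⟨j, hj⟩), false) =>
      -- On the top row the face on the left is the outer one: it runs through the rungs with
      -- decreasing index and wraps around from 0 to m at the basepoint.
      if h : j + 1 < L then afterBottom 0 (j + 1) hi h else left m j (Nat.lt_succ_self m) hj
  | (.inr (⟨i + 1, hi⟩, ⟨j, hj⟩), false) =>
      if h : j + 1 < L then afterBottom (i + 1) (j + 1) hi h else left i j (Nat.lt_of_succ_lt hi) hj

/-- The predecessor of a directed edge on the boundary of the face on its left. -/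
def prev : Dart m L → Dart m L
  | (.inl (⟨i, hi⟩, ⟨j, hj⟩), true) => beforeLeft (i + 1) j (Nat.succ_lt_succ hi) hj
  | (.inl (⟨i, hi⟩, ⟨j, hj⟩), false) => right i j (Nat.lt_succ_of_lt hi) hj
  | (.inr (⟨0, hi⟩, ⟨j, hj⟩), true) => beforeLeft 0 j hi hj
  | (.inr (⟨i + 1, hi⟩, ⟨j, hj⟩), true) => up i j (Nat.lt_of_succ_lt_succ hi) hj
  | (.inr (⟨i, hi⟩, ⟨j, hj⟩), false) =>
      if h : j + 1 < L then beforeBottom i (j + 1) hi h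
      else if h : i < m then left (i + 1) j (Nat.succ_lt_succ h) hj else left 0 j (Nat.succ_pos m) hj

theorem prev_afterBottom (i j : ℕ) (hi : i < m + 1) (hj : j < L) :
    prev (afterBottom i j hi hj) = beforeLeft i j hi hj := by
  cases i <;> rfl

theorem prev_afterRight (i j : ℕ) (hi : i < m + 1) (hj : j < L) :
    prev (afterRight i j hi hj) = beforeBottom i j hi hj := by
  cases j with
  | zero => exact prev_afterBottom i 0 hi hj
  | succ j => simp [afterRight, left, prev, hj]

theorem next_beforeBottom (i j : ℕ) (hi : i < m + 1) (hj : j < L) :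
    next (beforeBottom i j hi hj) = afterRight i j hi hj := by
  unfold beforeBottom
  split_ifs with h
  · rfl
  · simp [right, next, h]

theorem next_beforeLeft (i j : ℕ) (hi : i < m + 1) (hj : j < L) :
    next (beforeLeft i j hi hj) = afterBottom i j hi hj := by
  cases j with
  | zero => exact next_beforeBottom i 0 hi hj
  | succ j => cases i <;> exact dif_pos hj

/-- The boundary permutation. -/
def nextPerm (m L : ℕ) : Equiv.Perm (Dart m L) where
  toFun := next
  invFun := prev
  left_inv := by
    rintro ⟨⟨⟨i, hi⟩, ⟨j, hj⟩⟩ | ⟨⟨i, hi⟩, ⟨j, hj⟩⟩, _ | _⟩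
    · change prev (afterRight i j _ hj) = _
      rw [prev_afterRight, beforeBottom, dif_pos hi]
      rfl
    · rfl
    · cases i with
      | zero =>
        by_cases h : j + 1 < L
        · simp [next, h, prev_afterBottom, beforeLeft, left]
        · simp [next, h, left, prev]
      | succ i =>
        by_cases h : j + 1 < L
        · simp [next, h, prev_afterBottom, beforeLeft, left]
        · simp [next, h, left, prev, Nat.lt_of_succ_lt_succ hi]
    · by_cases h : i < m
      · simp [next, h, down, prev, right]
      · simp [next, h, prev_afterRight, beforeBottom, right]
  right_inv := by
    rintro ⟨⟨⟨i, hi⟩, ⟨j, hj⟩⟩ | ⟨⟨i, hi⟩, ⟨j, hj⟩⟩, _ | _⟩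
    · change next (right i j _ hj) = _
      simp [right, next, hi, down]
    · change next (beforeLeft (i + 1) j _ hj) = _
      rw [next_beforeLeft]
      rfl
    · by_cases h : j + 1 < L
      · simp [prev, h, next_beforeBottom, afterRight, left]
      · by_cases h' : i < m
        · simp [prev, h, h', left, next]
        · obtain rfl : i = m := by omega
          simp only [prev, h, h', dite_false]
          exact dif_neg h
    · cases i with
      | zero =>
        change next (beforeLeft 0 j _ hj) = _
        rw [next_beforeLeft]
        rfl
      | succ i => rfl

theorem nextPerm_up (i j : ℕ) (hi : i < m) (hj : j < L) :
    nextPerm m L (up i j hi hj) = right (i + 1) j (Nat.succ_lt_succ hi) hj := rfl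

theorem nextPerm_down (i j : ℕ) (hi : i < m) (hj : j < L) :
    nextPerm m L (down i j hi hj) = afterRight i j (Nat.lt_succ_of_lt hi) hj := rfl

theorem nextPerm_right (i j : ℕ) (hi : i < m) (hj : j < L) :
    nextPerm m L (right i j (Nat.lt_succ_of_lt hi) hj) = down i j hi hj := by
  simp [nextPerm, right, next, hi]

theorem nextPerm_right_last (j : ℕ) (hj : j < L) :
    nextPerm m L (right m j (Nat.lt_succ_self m) hj) = afterRight m j (Nat.lt_succ_self m) hj := by
  simp [nextPerm, right, next]

theorem nextPerm_left (i j : ℕ) (hi : i < m + 1) (hj : j + 1 < L) :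
    nextPerm m L (left i j hi (Nat.lt_of_succ_lt hj)) = afterBottom i (j + 1) hi hj := by
  cases i <;> exact dif_pos hj

theorem nextPerm_left_top (i j : ℕ) (hi : i < m) (hj : j < L) (h : ¬ j + 1 < L) :
    nextPerm m L (left (i + 1) j (Nat.succ_lt_succ hi) hj) =
      left i j (Nat.lt_succ_of_lt hi) hj :=
  dif_neg h

theorem nextPerm_left_top_zero (j : ℕ) (hj : j < L) (h : ¬ j + 1 < L) :
    nextPerm m L (left 0 j (Nat.succ_pos m) hj) = left m j (Nat.lt_succ_self m) hj :=
  dif_neg h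

theorem src_afterBottom (i j : ℕ) (hi : i < m + 1) (hj : j < L) :
    src (afterBottom i j hi hj) = vtx m L i j := by
  cases i <;> simp [afterBottom, right, up, src]

theorem src_afterRight (i j : ℕ) (hi : i < m + 1) (hj : j < L) :
    src (afterRight i j hi hj) = vtx m L (i + 1) j := by
  cases j with
  | zero => simp [afterRight, src_afterBottom]
  | succ j => rfl

theorem src_nextPerm (d : Dart m L) : src (nextPerm m L d) = src (rev d) := by
  obtain ⟨⟨⟨i, hi⟩, ⟨j, hj⟩⟩ | ⟨⟨i, hi⟩, ⟨j, hj⟩⟩, _ | _⟩ := d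
  · exact src_afterRight i j _ hj
  · rfl
  · by_cases h : j + 1 < L
    · exact (congrArg src (nextPerm_left i j hi h)).trans (src_afterBottom _ _ _ _)
    · cases i with
      | zero =>
        refine (congrArg src (nextPerm_left_top_zero j hj h)).trans ?_
        simp [left, src, rev]
      | succ i => exact (congrArg src (nextPerm_left_top i j (Nat.lt_of_succ_lt_succ hi) hj h)).trans rfl
  · by_cases h : i < m
    · exact (congrArg src (nextPerm_right i j h hj)).trans rfl
    · obtain rfl : i = m := by omega
      refine (congrArg src (nextPerm_right_last j hj)).trans
        ((src_afterRight i j _ hj).trans ?_)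
      change vtx i L (i + 1) j = vtx i L (i + 1) (j + 1)
      rw [vtx_last, vtx_last]

theorem face_afterBottom (i j : ℕ) (hi : i < m + 1) (hj : j < L) :
    face (afterBottom i j hi hj) = some (⟨i, hi⟩, ⟨j, hj⟩) := by
  cases i <;> simp [afterBottom, right, up, face]

theorem face_afterRight (i j : ℕ) (hi : i < m + 1) (hj : j < L) :
    face (afterRight i j hi hj) = some (⟨i, hi⟩, ⟨j, hj⟩) := by
  cases j with
  | zero => simp [afterRight, face_afterBottom]
  | succ j => simp [afterRight, left, face, hj]

theorem face_left (i j : ℕ) (hi : i < m + 1) (hj : j + 1 < L) :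
    face (left i j hi (Nat.lt_of_succ_lt hj)) = some (⟨i, hi⟩, ⟨j + 1, hj⟩) := by
  simp [left, face, hj]

theorem face_left_top (i j : ℕ) (hi : i < m + 1) (hj : j < L) (h : ¬ j + 1 < L) :
    face (left i j hi hj) = none := by
  simp [left, face, h]

theorem face_nextPerm (d : Dart m L) : face (nextPerm m L d) = face d := by
  obtain ⟨⟨⟨i, hi⟩, ⟨j, hj⟩⟩ | ⟨⟨i, hi⟩, ⟨j, hj⟩⟩, _ | _⟩ := d
  · exact face_afterRight i j _ hj
  · rfl
  · by_cases h : j + 1 < L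
    · refine (congrArg face (nextPerm_left i j hi h)).trans ?_
      rw [face_afterBottom]
      exact (face_left i j hi h).symm
    · refine Eq.trans ?_ (face_left_top i j hi hj h).symm
      cases i with
      | zero => exact (congrArg face (nextPerm_left_top_zero j hj h)).trans (face_left_top _ _ _ _ h)
      | succ i =>
        exact (congrArg face (nextPerm_left_top i j (Nat.lt_of_succ_lt_succ hi) hj h)).trans
          (face_left_top _ _ _ _ h)
  · by_cases h : i < m
    · exact (congrArg face (nextPerm_right i j h hj)).trans rfl
    · obtain rfl : i = m := by omega
      exact (congrArg face (nextPerm_right_last j hj)).trans (face_afterRight _ _ _ _)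

theorem sameCycle_afterBottom (i j : ℕ) (hi : i < m + 1) (hj : j < L) :
    (nextPerm m L).SameCycle (afterBottom i j hi hj) (right i j hi hj) := by
  cases i with
  | zero => exact .refl _ _
  | succ i => exact sameCycle_apply (nextPerm m L) (up i j (Nat.lt_of_succ_lt_succ hi) hj)

theorem sameCycle_left (i j : ℕ) (hi : i < m + 1) (hj : j + 1 < L) :
    (nextPerm m L).SameCycle (left i j hi (Nat.lt_of_succ_lt hj)) (right i (j + 1) hi hj) := by
  have := sameCycle_apply (nextPerm m L) (left i j hi (Nat.lt_of_succ_lt hj))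
  rw [nextPerm_left _ _ _ hj] at this
  exact this.trans (sameCycle_afterBottom _ _ _ _)

theorem sameCycle_afterRight (i j : ℕ) (hi : i < m + 1) (hj : j < L) :
    (nextPerm m L).SameCycle (afterRight i j hi hj) (right i j hi hj) := by
  cases j with
  | zero => exact sameCycle_afterBottom i 0 hi hj
  | succ j => exact sameCycle_left i j hi hj

/-- The upper rung is the only side that no cell loses when columns and ground are collapsed, so it
serves as the reference edge of every cell. -/
theorem sameCycle_right_of_face (d : Dart m L) (i j : ℕ) (hi : i < m + 1) (hj : j < L)
    (h : face d = some (⟨i, hi⟩, ⟨j, hj⟩)) :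
    (nextPerm m L).SameCycle d (right i j hi hj) := by
  obtain ⟨⟨⟨i', hi'⟩, ⟨j', hj'⟩⟩ | ⟨⟨i', hi'⟩, ⟨j', hj'⟩⟩, _ | _⟩ := d
  · simp only [face, Option.some.injEq, Prod.mk.injEq, Fin.castSucc_mk, Fin.mk.injEq] at h
    obtain ⟨rfl, rfl⟩ := h
    exact (sameCycle_apply (nextPerm m L) (down i' j' hi' hj')).trans (sameCycle_afterRight _ _ _ _)
  · simp only [face, Option.some.injEq, Prod.mk.injEq, Fin.succ_mk, Fin.mk.injEq] at h
    obtain ⟨rfl, rfl⟩ := h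
    exact sameCycle_apply (nextPerm m L) (up i' j' hi' hj')
  · simp only [face] at h
    split_ifs at h with h1
    simp only [Option.some.injEq, Prod.mk.injEq, Fin.mk.injEq] at h
    obtain ⟨rfl, rfl⟩ := h
    exact sameCycle_left i' j' hi' h1
  · simp only [face, Option.some.injEq, Prod.mk.injEq, Fin.mk.injEq] at h
    obtain ⟨rfl, rfl⟩ := h
    exact .refl _ _

theorem sameCycle_left_top (i j : ℕ) (hi : i < m + 1) (hj : j < L) (h : ¬ j + 1 < L) :
    (nextPerm m L).SameCycle (left i j hi hj) (left 0 j (Nat.succ_pos m) hj) := by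
  induction i with
  | zero => exact .refl _ _
  | succ i ih =>
    have := sameCycle_apply (nextPerm m L) (left (i + 1) j hi hj)
    rw [nextPerm_left_top i j (Nat.lt_of_succ_lt_succ hi) hj h] at this
    exact this.trans (ih _)

theorem eq_left_of_face_eq_none (d : Dart m L) (h : face d = none) :
    ∃ i j hi hj, d = left i j hi hj ∧ ¬ j + 1 < L := by
  obtain ⟨⟨⟨i, hi⟩, ⟨j, hj⟩⟩ | ⟨⟨i, hi⟩, ⟨j, hj⟩⟩, _ | _⟩ := d
  · simp [face] at h
  · simp [face] at h
  · exact ⟨i, j, hi, hj, rfl, by simpa [face] using h⟩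
  · simp [face] at h

theorem face_eq_iff (d d' : Dart m L) : face d = face d' ↔ (nextPerm m L).SameCycle d d' := by
  constructor
  · intro h
    rcases hd : face d with _ | ⟨⟨i, hi⟩, ⟨j, hj⟩⟩
    · obtain ⟨i, j, hi, hj, rfl, ht⟩ := eq_left_of_face_eq_none d hd
      obtain ⟨i', j', hi', hj', rfl, ht'⟩ := eq_left_of_face_eq_none d' (h ▸ hd)
      obtain rfl : j = j' := by omega
      exact (sameCycle_left_top i j hi hj ht).trans (sameCycle_left_top i' j hi' hj' ht).symm
    · exact (sameCycle_right_of_face d i j hi hj hd).trans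
        (sameCycle_right_of_face d' i j hi hj (h ▸ hd)).symm
  · exact rel_of_sameCycle (r := fun d d' => face d = face d')
      ⟨fun _ => rfl, fun h => h.symm, fun h h' => h.trans h'⟩ fun d => (face_nextPerm d).symm

theorem rev_rev (d : Dart m L) : rev (rev d) = d := by simp [rev]

/-- The rotation around the vertices. -/
def rotPerm (m L : ℕ) : Equiv.Perm (Dart m L) :=
  nextPerm m L * Function.Involutive.toPerm rev rev_rev

theorem sameCycle_rot (d : Dart m L) : (rotPerm m L).SameCycle d (nextPerm m L (rev d)) :=
  sameCycle_apply (rotPerm m L) d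

theorem rot_left (i j : ℕ) (hi : i < m) (hj : j < L) :
    (rotPerm m L).SameCycle (left i j (Nat.lt_succ_of_lt hi) hj) (down i j hi hj) := by
  rw [← nextPerm_right i j hi hj]
  exact sameCycle_rot (left i j (Nat.lt_succ_of_lt hi) hj)

theorem rot_down (i j : ℕ) (hi : i < m) (hj : j < L) :
    (rotPerm m L).SameCycle (down i j hi hj) (right (i + 1) j (Nat.succ_lt_succ hi) hj) :=
  sameCycle_rot (down i j hi hj)

theorem rot_up (i j : ℕ) (hi : i < m) (hj : j < L) :
    (rotPerm m L).SameCycle (up i j hi hj) (afterRight i j (Nat.lt_succ_of_lt hi) hj) :=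
  sameCycle_rot (up i j hi hj)

/-- The collapsed basepoint must be a single rotation cycle. Its directed edges are connected to the
lowest rung of strip 0 down column 0 (here), along the ground (`rot_afterBottom_zero`), and down
column m + 1 to the ground (`rot_left_last`). -/
theorem rot_right_zero (j : ℕ) (hj : j < L) :
    (rotPerm m L).SameCycle (right 0 j (Nat.succ_pos m) hj)
      (right 0 0 (Nat.succ_pos m) (Nat.zero_lt_of_lt hj)) := by
  induction j with
  | zero => exact .refl _ _
  | succ j ih =>
    have := sameCycle_rot (right 0 j (Nat.succ_pos m) (Nat.lt_of_succ_lt hj))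
    change (rotPerm m L).SameCycle _ (nextPerm m L (left 0 j _ _)) at this
    rw [nextPerm_left 0 j _ hj] at this
    exact this.symm.trans (ih _)

theorem rot_afterBottom_zero (i : ℕ) (hi : i < m + 1) (hj : 0 < L) :
    (rotPerm m L).SameCycle (afterBottom i 0 hi hj) (right 0 0 (Nat.succ_pos m) hj) := by
  induction i with
  | zero => exact .refl _ _
  | succ i ih => exact (rot_up i 0 (Nat.lt_of_succ_lt_succ hi) hj).trans (ih _)

theorem rot_left_last (j : ℕ) (hj : j < L) :
    (rotPerm m L).SameCycle (left m j (Nat.lt_succ_self m) hj)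
      (right 0 0 (Nat.succ_pos m) (Nat.zero_lt_of_lt hj)) := by
  induction j with
  | zero =>
    have := sameCycle_rot (left m 0 (Nat.lt_succ_self m) hj)
    change (rotPerm m L).SameCycle _ (nextPerm m L (right m 0 _ _)) at this
    rw [nextPerm_right_last] at this
    exact this.trans (rot_afterBottom_zero m _ hj)
  | succ j ih =>
    have := sameCycle_rot (left m (j + 1) (Nat.lt_succ_self m) hj)
    change (rotPerm m L).SameCycle _ (nextPerm m L (right m (j + 1) _ _)) at this
    rw [nextPerm_right_last] at this
    exact this.trans (ih _)

theorem rot_of_src_eq_none (d : Dart m L) (h : src d = none) :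
    ∃ hL : 0 < L, (rotPerm m L).SameCycle d (right 0 0 (Nat.succ_pos m) hL) := by
  obtain ⟨⟨⟨i, hi⟩, ⟨j, hj⟩⟩ | ⟨⟨i, hi⟩, ⟨j, hj⟩⟩, _ | _⟩ := d <;>
    refine ⟨Nat.zero_lt_of_lt hj, ?_⟩
  · simp [src, vtx_succ_succ hi hj] at h
  · cases j with
    | zero => exact rot_afterBottom_zero (i + 1) (Nat.succ_lt_succ hi) hj
    | succ j => simp [src, vtx_succ_succ hi (Nat.lt_of_succ_lt hj)] at h
  · by_cases h' : i < m
    · simp [src, vtx_succ_succ h' hj] at h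
    · obtain rfl : i = m := by omega
      exact rot_left_last j hj
  · cases i with
    | zero => exact rot_right_zero j hj
    | succ i => simp [src, vtx_succ_succ (Nat.lt_of_succ_lt_succ hi) hj] at h

/-- Around an inner vertex the rotation visits up, left, down, right, with up absent in the top row;
the leftward rung serves as the reference. -/
theorem rot_of_src_eq_some (d : Dart m L) (i j : ℕ) (hi : i < m) (hj : j < L)
    (h : src d = some (⟨i, hi⟩, ⟨j, hj⟩)) :
    (rotPerm m L).SameCycle (left i j (Nat.lt_succ_of_lt hi) hj) d := by
  obtain ⟨⟨⟨i', hi'⟩, ⟨j', hj'⟩⟩ | ⟨⟨i', hi'⟩, ⟨j', hj'⟩⟩, _ | _⟩ := d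
  · simp only [src, vtx_succ_succ hi' hj', Option.some.injEq, Prod.mk.injEq, Fin.mk.injEq] at h
    obtain ⟨rfl, rfl⟩ := h
    exact rot_left _ _ _ _
  · cases j' with
    | zero => simp [src] at h
    | succ j' =>
      simp only [src, vtx_succ_succ hi' (Nat.lt_of_succ_lt hj'), Option.some.injEq, Prod.mk.injEq,
        Fin.mk.injEq] at h
      obtain ⟨rfl, rfl⟩ := h
      exact (rot_up i' (j' + 1) hi' hj').symm
  · by_cases h' : i' < m
    · simp only [src, vtx_succ_succ h' hj', Option.some.injEq, Prod.mk.injEq, Fin.mk.injEq] at h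
      obtain ⟨rfl, rfl⟩ := h
      exact .refl _ _
    · obtain rfl : i' = m := by omega
      simp [src] at h
  · cases i' with
    | zero => simp [src] at h
    | succ i' =>
      simp only [src, vtx_succ_succ (Nat.lt_of_succ_lt_succ hi') hj', Option.some.injEq,
        Prod.mk.injEq, Fin.mk.injEq] at h
      obtain ⟨rfl, rfl⟩ := h
      exact (rot_left _ _ _ _).trans (rot_down _ _ hi hj)

theorem src_eq_iff (d d' : Dart m L) : src d = src d' ↔ (rotPerm m L).SameCycle d d' := by
  constructor
  · intro h
    rcases hd : src d with _ | ⟨⟨i, hi⟩, ⟨j, hj⟩⟩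
    · obtain ⟨_, h1⟩ := rot_of_src_eq_none d hd
      obtain ⟨_, h2⟩ := rot_of_src_eq_none d' (h ▸ hd)
      exact h1.trans h2.symm
    · exact (rot_of_src_eq_some d i j hi hj hd).symm.trans
        (rot_of_src_eq_some d' i j hi hj (h ▸ hd))
  · refine rel_of_sameCycle (r := fun d d' => src d = src d')
      ⟨fun _ => rfl, fun h => h.symm, fun h h' => h.trans h'⟩ fun d => ?_
    change src d = src (nextPerm m L (rev d))
    rw [src_nextPerm, rev_rev]

/-- The graph of the grid. -/
def oneComplex (m L : ℕ) : OneComplex.{0, 0} where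
  V := Vert m L
  D := Dart m L
  src := src
  rev := rev
  rev_rev := rev_rev

theorem reachable_vtx (i j : ℕ) (hi : i < m) (hj : j ≤ L) :
    (oneComplex m L).graph.Reachable (none : Vert m L) (vtx m L (i + 1) j) := by
  induction j with
  | zero => rw [vtx_zero_right]; exact SimpleGraph.Reachable.refl _
  | succ j ih => exact (ih (by omega)).trans ((oneComplex m L).reachable_src_tgt (up i j hi hj))

theorem connected (m L : ℕ) : (oneComplex m L).graph.Connected := by
  have hall : ∀ v : Vert m L, (oneComplex m L).graph.Reachable (none : Vert m L) v := by
    rintro (_ | ⟨⟨i, hi⟩, ⟨j, hj⟩⟩)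
    · exact SimpleGraph.Reachable.refl _
    · rw [← vtx_succ_succ hi hj]
      exact reachable_vtx i (j + 1) hi hj
  have : Nonempty (oneComplex m L).V := ⟨(none : Vert m L)⟩
  exact SimpleGraph.Connected.mk fun u v => (hall u).symm.trans (hall v)

/-- The grid as a planar complex. -/
def complex (m L : ℕ) : PlanarComplex where
  toOneComplex := oneComplex m L
  F := Face m L
  finite_V := inferInstanceAs (Finite (Vert m L))
  finite_D := inferInstanceAs (Finite (Dart m L))
  finite_F := inferInstanceAs (Finite (Face m L))
  rev_ne d h := by
    have : (!d.2) = d.2 := congrArg Prod.snd h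
    simp at this
  next := nextPerm m L
  face := face
  src_eq_iff := src_eq_iff
  face_eq_iff := face_eq_iff
  face_surj f := ⟨right f.1 f.2 f.1.2 f.2.2, rfl⟩
  connected := connected m L
  euler := by
    change 2 * (Nat.card (Vert m L) + Nat.card (Face m L)) = Nat.card (Dart m L) + 2
    simp only [Nat.card_eq_fintype_card, Fintype.card_option, Fintype.card_prod, Fintype.card_sum,
      Fintype.card_fin, Fintype.card_bool]
    ring

/-- The position of a directed edge among the four sides of its face. -/
def side : Dart m L → Fin 4
  | (.inl _, true) => 0
  | (.inl _, false) => 1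
  | (.inr _, true) => 2
  | (.inr _, false) => 3

/-- A cell has at most one side of each of the four kinds. This is the source of the factor 4 in the
bound on relator lengths. -/
theorem eq_of_side_eq (d d' : Dart m L) (hf : face d = face d') (h : (face d).isSome)
    (hs : side d = side d') : d = d' := by
  obtain ⟨⟨⟨i, hi⟩, ⟨j, hj⟩⟩ | ⟨⟨i, hi⟩, ⟨j, hj⟩⟩, _ | _⟩ := d <;>
    obtain ⟨⟨⟨i', hi'⟩, ⟨j', hj'⟩⟩ | ⟨⟨i', hi'⟩, ⟨j', hj'⟩⟩, _ | _⟩ := d' <;>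
    simp [side] at hs <;> simp only [face] at hf h
  · simpa using hf
  · simpa using hf
  · split_ifs at hf h
    · simpa using hf
    · exact absurd h (by simp)
  · simpa using hf

end Grid

end TameFilling

/-! ### Maps of squares onto the cells of the grid, and the combing of a strip -/

namespace TameFilling

open unitInterval

namespace Grid

variable {m L : ℕ}

/-- A directed edge with a cell on its left, as a side of this cell. -/
def cellSide (d : Dart m L) (c : Face m L) (h : face d = some c) : (complex m L).Side :=
  ⟨d, Option.isSome_iff_exists.2 ⟨c, h⟩⟩

theorem cell_cellSide (d : Dart m L) (c : Face m L) (h : face d = some c) :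
    (cellSide d c h).cell = c :=
  Option.get_of_eq_some _ h

variable (U : EdgeSubdivision (complex m L))

theorem wedge_cellSide_turn (d d' : Dart m L) (c c' : Face m L) (h : face d = some c)
    (h' : face d' = some c') (e : nextPerm m L d = d') (r : ℝ) :
    U.wedge (cellSide d c h) 1 r = U.wedge (cellSide d' c' h') 0 r :=
  U.wedge_turn (cellSide d c h) (cellSide d' c' h') e r

/-- The wedge of a cell over its upper rung. -/
noncomputable def wTop (i j : ℕ) (hi : i < m + 1) (hj : j < L) : ℝ → ℝ → U.complex.Space :=
  U.wedge (cellSide (right i j hi hj) (⟨i, hi⟩, ⟨j, hj⟩) rfl)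

/-- The wedge of a cell over its right column edge, or a degenerate wedge. -/
noncomputable def wRight (i j : ℕ) (hi : i < m + 1) (hj : j < L) : ℝ → ℝ → U.complex.Space :=
  if h : i < m then U.wedge (cellSide (down i j h hj) (⟨i, hi⟩, ⟨j, hj⟩) rfl)
  -- A collapsed side is replaced by the corner ray at the end of the preceding side, independent of
  -- the position, so that one four-sided filling serves for all cells.
  else fun _ r => wTop U i j hi hj 1 r

/-- The wedge of a cell over its lower rung, or a degenerate wedge. -/
noncomputable def wBottom : (i j : ℕ) → i < m + 1 → j < L → ℝ → ℝ → U.complex.Space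
  | i, 0, hi, hj => fun _ r => wRight U i 0 hi hj 1 r
  | i, j + 1, hi, hj =>
    U.wedge (cellSide (left i j hi (Nat.lt_of_succ_lt hj)) (⟨i, hi⟩, ⟨j + 1, hj⟩)
      (face_left i j hi hj))

/-- The wedge of a cell over its left column edge, or a degenerate wedge. -/
noncomputable def wLeft : (i j : ℕ) → i < m + 1 → j < L → ℝ → ℝ → U.complex.Space
  | 0, j, hi, hj => fun _ r => wBottom U 0 j hi hj 1 r
  | i + 1, j, hi, hj =>
    U.wedge (cellSide (up i j (Nat.lt_of_succ_lt_succ hi) hj) (⟨i + 1, hi⟩, ⟨j, hj⟩) rfl)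

section Wedges

variable (i j : ℕ) (hi : i < m + 1) (hj : j < L)

theorem wTop_mem (x r : ℝ) : ∃ (d : (complex m L).Side) (x' : ℝ), d.cell = (⟨i, hi⟩, ⟨j, hj⟩) ∧
    wTop U i j hi hj x r = U.wedge d x' r :=
  ⟨_, x, cell_cellSide _ _ _, rfl⟩

theorem wRight_mem (x r : ℝ) : ∃ (d : (complex m L).Side) (x' : ℝ), d.cell = (⟨i, hi⟩, ⟨j, hj⟩) ∧
    wRight U i j hi hj x r = U.wedge d x' r := by
  unfold wRight
  split_ifs
  · exact ⟨_, x, cell_cellSide _ _ _, rfl⟩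
  · exact wTop_mem U i j hi hj 1 r

theorem wBottom_mem (x r : ℝ) : ∃ (d : (complex m L).Side) (x' : ℝ), d.cell = (⟨i, hi⟩, ⟨j, hj⟩) ∧
    wBottom U i j hi hj x r = U.wedge d x' r := by
  cases j with
  | zero => exact wRight_mem U i 0 hi hj 1 r
  | succ j => exact ⟨_, x, cell_cellSide _ _ _, rfl⟩

theorem wLeft_mem (x r : ℝ) : ∃ (d : (complex m L).Side) (x' : ℝ), d.cell = (⟨i, hi⟩, ⟨j, hj⟩) ∧
    wLeft U i j hi hj x r = U.wedge d x' r := by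
  cases i with
  | zero => exact wBottom_mem U 0 j hi hj 1 r
  | succ i => exact ⟨_, x, cell_cellSide _ _ _, rfl⟩

theorem continuous_wTop : Continuous fun q : ℝ × ℝ => wTop U i j hi hj q.1 q.2 :=
  U.continuous_wedge _

theorem continuous_wRight : Continuous fun q : ℝ × ℝ => wRight U i j hi hj q.1 q.2 := by
  unfold wRight
  split_ifs
  · exact U.continuous_wedge _
  · exact (continuous_wTop U i j hi hj).comp (f := fun q : ℝ × ℝ => (1, q.2)) (by fun_prop)

theorem continuous_wBottom : Continuous fun q : ℝ × ℝ => wBottom U i j hi hj q.1 q.2 := by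
  cases j with
  | zero => exact (continuous_wRight U i 0 hi hj).comp (f := fun q : ℝ × ℝ => (1, q.2)) (by fun_prop)
  | succ j => exact U.continuous_wedge _

theorem continuous_wLeft : Continuous fun q : ℝ × ℝ => wLeft U i j hi hj q.1 q.2 := by
  cases i with
  | zero => exact (continuous_wBottom U 0 j hi hj).comp (f := fun q : ℝ × ℝ => (1, q.2)) (by fun_prop)
  | succ i => exact U.continuous_wedge _

theorem wTop_one (r : ℝ) : wTop U i j hi hj 1 r = wRight U i j hi hj 0 r := by
  unfold wRight
  split_ifs with h
  · exact wedge_cellSide_turn U _ _ _ _ _ _ (nextPerm_right i j h hj) r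
  · rfl

theorem wRight_one (r : ℝ) : wRight U i j hi hj 1 r =
    U.wedge (cellSide (afterRight i j hi hj) _ (face_afterRight i j hi hj)) 0 r := by
  unfold wRight
  split_ifs with h
  · exact wedge_cellSide_turn U _ _ _ _ _ _ (nextPerm_down i j h hj) r
  · obtain rfl : i = m := by omega
    exact wedge_cellSide_turn U _ _ _ _ _ _ (nextPerm_right_last j hj) r

theorem wRight_one_eq (r : ℝ) : wRight U i j hi hj 1 r = wBottom U i j hi hj 0 r := by
  cases j with
  | zero => rfl
  | succ j => exact wRight_one U i (j + 1) hi hj r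

theorem wBottom_one (r : ℝ) : wBottom U i j hi hj 1 r =
    U.wedge (cellSide (afterBottom i j hi hj) _ (face_afterBottom i j hi hj)) 0 r := by
  cases j with
  | zero => exact wRight_one U i 0 hi hj r
  | succ j => exact wedge_cellSide_turn U _ _ _ _ _ _ (nextPerm_left i j hi hj) r

theorem wBottom_one_eq (r : ℝ) : wBottom U i j hi hj 1 r = wLeft U i j hi hj 0 r := by
  cases i with
  | zero => rfl
  | succ i => exact wBottom_one U (i + 1) j hi hj r

theorem wLeft_one (r : ℝ) : wLeft U i j hi hj 1 r = wTop U i j hi hj 0 r := by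
  cases i with
  | zero => exact wBottom_one U 0 j hi hj r
  | succ i => exact wedge_cellSide_turn U _ _ _ _ _ _ (nextPerm_up i j (Nat.lt_of_succ_lt_succ hi) hj) r

/-- The map of a square to a cell. -/
noncomputable def cellMap (s t : ℝ) : U.complex.Space :=
  squareFill (wTop U i j hi hj) (wRight U i j hi hj) (wBottom U i j hi hj) (wLeft U i j hi hj) s t

theorem continuous_cellMap : Continuous fun q : ℝ × ℝ => cellMap U i j hi hj q.1 q.2 := by
  have hap : ∀ (d : (complex m L).Side) (x : ℝ), d.cell = (⟨i, hi⟩, ⟨j, hj⟩) →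
      U.wedge d x 1 = wTop U i j hi hj 0 1 := fun d x h =>
    U.wedge_apex _ _ (h.trans (cell_cellSide _ _ _).symm) _ _
  refine continuous_squareFill (continuous_wTop U i j hi hj) (continuous_wRight U i j hi hj)
    (continuous_wBottom U i j hi hj) (continuous_wLeft U i j hi hj) (wTop U i j hi hj 0 1)
    ?_ ?_ ?_ ?_ (wTop_one U i j hi hj) (wRight_one_eq U i j hi hj) (wBottom_one_eq U i j hi hj)
    (wLeft_one U i j hi hj)
  · intro x
    obtain ⟨d, x', h, e⟩ := wTop_mem U i j hi hj x 1
    rw [e, hap d x' h]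
  · intro x
    obtain ⟨d, x', h, e⟩ := wRight_mem U i j hi hj x 1
    rw [e, hap d x' h]
  · intro x
    obtain ⟨d, x', h, e⟩ := wBottom_mem U i j hi hj x 1
    rw [e, hap d x' h]
  · intro x
    obtain ⟨d, x', h, e⟩ := wLeft_mem U i j hi hj x 1
    rw [e, hap d x' h]

theorem cellMap_mem (s t : ℝ) : ∃ (d : (complex m L).Side) (x r : ℝ), d.cell = (⟨i, hi⟩, ⟨j, hj⟩) ∧
    cellMap U i j hi hj s t = U.wedge d x r := by
  refine squareFill_mem (P := fun q => ∃ (d : (complex m L).Side) (x r : ℝ), d.cell = (⟨i, hi⟩, ⟨j, hj⟩) ∧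
    q = U.wedge d x r) ?_ ?_ ?_ ?_ s t <;> intro x r
  · obtain ⟨d, x', h⟩ := wTop_mem U i j hi hj x r
    exact ⟨d, x', r, h⟩
  · obtain ⟨d, x', h⟩ := wRight_mem U i j hi hj x r
    exact ⟨d, x', r, h⟩
  · obtain ⟨d, x', h⟩ := wBottom_mem U i j hi hj x r
    exact ⟨d, x', r, h⟩
  · obtain ⟨d, x', h⟩ := wLeft_mem U i j hi hj x r
    exact ⟨d, x', r, h⟩

theorem cellMap_top (s : ℝ) : cellMap U i j hi hj s 1 = wTop U i j hi hj (clamp (3 * s - 1)) 0 :=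
  squareFill_top (wTop_one U i j hi hj) (wLeft_one U i j hi hj) rfl

theorem cellMap_bottom (s : ℝ) :
    cellMap U i j hi hj s 0 = wBottom U i j hi hj (1 - clamp (3 * s - 1)) 0 :=
  squareFill_bottom (wRight_one_eq U i j hi hj) (wBottom_one_eq U i j hi hj) rfl

theorem cellMap_left {t : ℝ} (ht : t ∈ Set.Icc (0 : ℝ) 1) :
    cellMap U i j hi hj 0 t = wLeft U i j hi hj (clamp (3 * t - 1)) 0 :=
  squareFill_left rfl ht

theorem cellMap_right {t : ℝ} (ht : t ∈ Set.Icc (0 : ℝ) 1) :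
    cellMap U i j hi hj 1 t = wRight U i j hi hj (1 - clamp (3 * t - 1)) 0 :=
  squareFill_right rfl ht

end Wedges

/-- A vertex of the grid, as a point of the subdivided grid. -/
noncomputable def gridPt (v : Vert m L) : U.complex.Space :=
  U.complex.vertPt (Sum.inl v : U.Vert)

theorem wTop_zero (i j : ℕ) (hi : i < m + 1) (hj : j < L) :
    wTop U i j hi hj 0 0 = gridPt U (vtx m L i (j + 1)) :=
  U.wedge_zero_zero _

theorem wTop_one_zero (i j : ℕ) (hi : i < m + 1) (hj : j < L) :
    wTop U i j hi hj 1 0 = gridPt U (vtx m L (i + 1) (j + 1)) := by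
  rw [wTop_one]
  by_cases h : i < m
  · rw [wRight, dif_pos h]
    exact U.wedge_zero_zero _
  · obtain rfl : i = m := by omega
    have h1 : wRight U i j hi hj 0 0 = wRight U i j hi hj 1 0 := by
      rw [wRight, dif_neg h]
    rw [h1, wRight_one, U.wedge_zero_zero]
    change gridPt U (src (afterRight i j _ hj)) = _
    rw [src_afterRight, vtx_last, vtx_last]

theorem wBottom_ground (i : ℕ) (hi : i < m + 1) (hj : 0 < L) (x : ℝ) :
    wBottom U i 0 hi hj x 0 = gridPt U none := by
  change wRight U i 0 hi hj 1 0 = _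
  rw [wRight_one, U.wedge_zero_zero]
  change gridPt U (src (afterRight i 0 _ hj)) = _
  rw [src_afterRight, vtx_zero_right]

section Comb

variable (hL : 0 < L)

/-- The pieces of the combing in a strip: one for every cell, and a final slide along the upper
rung. -/
noncomputable def combPiece (i : ℕ) (hi : i < m + 1) (p : ℕ) (s : I) (t : ℝ) : U.complex.Space :=
  if hp : p < L then cellMap U i p hi hp s t
  -- The topmost cell ends at the reparametrized position `clamp (3 * s - 1)`; a linear slide along
  -- the rung moves it to `s`.
  else wTop U i (L - 1) hi (Nat.sub_lt hL one_pos) ((1 - t) * clamp (3 * s - 1) + t * s) 0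

/-- The combing of a strip, in `L + 1` units of time. -/
noncomputable def comb (i : ℕ) (hi : i < m + 1) (s : I) (x : ℝ) : U.complex.Space :=
  concatPieces (combPiece U hL i hi) L s x

/-- The top of one cell and the bottom of the next lie over the same rung in opposite directions;
the last match is the start of the slide. -/
theorem combPiece_match (i : ℕ) (hi : i < m + 1) (p : ℕ) (hp : p < L) (s : I) :
    combPiece U hL i hi p s 1 = combPiece U hL i hi (p + 1) s 0 := by
  unfold combPiece
  rw [dif_pos hp, cellMap_top]
  split_ifs with h
  · rw [cellMap_bottom]
    exact (U.wedge_rev _ _ rfl (clamp_mem _)).symm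
  · obtain rfl : L = p + 1 := by omega
    rw [sub_zero, one_mul, zero_mul, add_zero]
    rfl

theorem continuous_comb (i : ℕ) (hi : i < m + 1) :
    Continuous fun q : I × ℝ => comb U hL i hi q.1 q.2 := by
  refine continuous_concatPieces _ _ ?_ fun p hp s => combPiece_match U hL i hi p hp s
  intro p _
  unfold combPiece
  split_ifs with h
  · exact (continuous_cellMap U i p hi h).comp (f := fun q : I × ℝ => ((q.1 : ℝ), q.2)) (by fun_prop)
  · have := continuous_clamp
    exact (continuous_wTop U i (L - 1) hi _).comp
      (f := fun q : I × ℝ => ((1 - q.2) * clamp (3 * q.1 - 1) + q.2 * q.1, (0 : ℝ))) (by fun_prop)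

theorem comb_eq (i : ℕ) (hi : i < m + 1) (s : I) {x : ℝ} (hx : x ∈ Set.Icc (0 : ℝ) (L + 1)) :
    comb U hL i hi s x = combPiece U hL i hi (pieceIndex L x) s (x - pieceIndex L x) ∧
      x - pieceIndex L x ∈ Set.Icc (0 : ℝ) 1 := by
  have h0 := pieceIndex_cast_le L hx.1
  have h1 := le_pieceIndex_add_one L hx.2
  exact ⟨concatPieces_apply _ _ _ (fun p hp => combPiece_match U hL i hi p hp s) _
    (pieceIndex_le L x) x h0 h1, by linarith, by linarith⟩

theorem comb_zero (i : ℕ) (hi : i < m + 1) (s : I) : comb U hL i hi s 0 = gridPt U none := by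
  have h := (comb_eq U hL i hi s (x := 0) ⟨le_rfl, by positivity⟩).1
  have h0 : pieceIndex L 0 = 0 := by simp [pieceIndex]
  rw [h, h0, combPiece, dif_pos hL, Nat.cast_zero, sub_zero, cellMap_bottom, wBottom_ground]

theorem comb_last (i : ℕ) (hi : i < m + 1) (s : I) :
    comb U hL i hi s (L + 1) = wTop U i (L - 1) hi (Nat.sub_lt hL one_pos) s 0 := by
  have h := concatPieces_apply (combPiece U hL i hi) L s
    (fun p hp => combPiece_match U hL i hi p hp s) L le_rfl (L + 1) (by linarith) le_rfl
  rw [comb, h, combPiece, dif_neg (lt_irrefl L)]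
  norm_num

theorem combPiece_zero (i : ℕ) (hi : i < m + 1) (p : ℕ) {t : ℝ} (ht : t ∈ Set.Icc (0 : ℝ) 1) :
    combPiece U hL i hi p 0 t = if hp : p < L then wLeft U i p hi hp (clamp (3 * t - 1)) 0
      else gridPt U (vtx m L i L) := by
  unfold combPiece
  split_ifs with hp
  · exact cellMap_left U i p hi hp ht
  · rw [Set.Icc.coe_zero, mul_zero, clamp_of_le (by norm_num), mul_zero, mul_zero, add_zero,
      wTop_zero, Nat.sub_add_cancel (show 1 ≤ L from hL)]

theorem combPiece_one (i : ℕ) (hi : i < m + 1) (p : ℕ) {t : ℝ} (ht : t ∈ Set.Icc (0 : ℝ) 1) :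
    combPiece U hL i hi p 1 t = if hp : p < L then wRight U i p hi hp (1 - clamp (3 * t - 1)) 0
      else gridPt U (vtx m L (i + 1) L) := by
  unfold combPiece
  split_ifs with hp
  · exact cellMap_right U i p hi hp ht
  · rw [Set.Icc.coe_one, mul_one, clamp_of_ge (by norm_num), mul_one, mul_one, sub_add_cancel,
      wTop_one_zero, Nat.sub_add_cancel (show 1 ≤ L from hL)]

/-- The two strips see their common column from its two sides with the same speed, by `wedge_rev`.
-/
theorem comb_one_eq (i : ℕ) (hi : i < m) {x : ℝ} (hx : x ∈ Set.Icc (0 : ℝ) (L + 1)) :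
    comb U hL i (Nat.lt_succ_of_lt hi) 1 x = comb U hL (i + 1) (Nat.succ_lt_succ hi) 0 x := by
  obtain ⟨h1, ht⟩ := comb_eq U hL i (Nat.lt_succ_of_lt hi) 1 hx
  rw [h1, (comb_eq U hL (i + 1) (Nat.succ_lt_succ hi) 0 hx).1, combPiece_one U hL _ _ _ ht,
    combPiece_zero U hL _ _ _ ht]
  split_ifs with hp
  · rw [wRight, dif_pos hi]
    exact U.wedge_rev _ _ rfl (clamp_mem _)
  · rfl

/-- All of column 0 is the basepoint. Together with `comb_last_one` this closes up the family of
paths and keeps the basepoint fixed. -/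
theorem comb_first_zero {x : ℝ} (hx : x ∈ Set.Icc (0 : ℝ) (L + 1)) :
    comb U hL 0 (Nat.succ_pos m) 0 x = gridPt U none := by
  obtain ⟨h1, ht⟩ := comb_eq U hL 0 (Nat.succ_pos m) 0 hx
  rw [h1, combPiece_zero U hL _ _ _ ht]
  split_ifs with hp
  · change wBottom U 0 _ _ _ 1 0 = _
    rw [wBottom_one, U.wedge_zero_zero]
    change gridPt U (src (afterBottom 0 _ (Nat.succ_pos m) hp)) = _
    rw [src_afterBottom, vtx_zero_left]
  · rw [vtx_zero_left]

theorem comb_last_one {x : ℝ} (hx : x ∈ Set.Icc (0 : ℝ) (L + 1)) :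
    comb U hL m (Nat.lt_succ_self m) 1 x = gridPt U none := by
  obtain ⟨h1, ht⟩ := comb_eq U hL m (Nat.lt_succ_self m) 1 hx
  rw [h1, combPiece_one U hL _ _ _ ht]
  split_ifs with hp
  · rw [wRight, dif_neg (lt_irrefl m)]
    exact (wTop_one_zero U m _ _ hp).trans (by rw [vtx_last])
  · rw [vtx_last]

theorem comb_mem_oneSkeleton (i : ℕ) (hi : i < m + 1) (s : I) (hs : s = 0 ∨ s = 1) {x : ℝ}
    (hx : x ∈ Set.Icc (0 : ℝ) (L + 1)) : comb U hL i hi s x ∈ U.complex.oneSkeleton := by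
  obtain ⟨h1, ht⟩ := comb_eq U hL i hi s hx
  rw [h1]
  rcases hs with rfl | rfl
  · rw [combPiece_zero U hL _ _ _ ht]
    split_ifs with hp
    · obtain ⟨d, x', -, e⟩ := wLeft_mem U i _ hi hp (clamp (3 * (x - pieceIndex L x) - 1)) 0
      rw [e]
      exact U.wedge_zero_mem_oneSkeleton d x'
    · exact Or.inl ⟨_, rfl⟩
  · rw [combPiece_one U hL _ _ _ ht]
    split_ifs with hp
    · obtain ⟨d, x', -, e⟩ := wRight_mem U i _ hi hp (1 - clamp (3 * (x - pieceIndex L x) - 1)) 0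
      rw [e]
      exact U.wedge_zero_mem_oneSkeleton d x'
    · exact Or.inl ⟨_, rfl⟩

/-- The level of the cell in which the combing of a strip is at time `x`. -/
noncomputable def combLevel (L : ℕ) (x : ℝ) : ℕ := min (pieceIndex L x) (L - 1)

theorem combLevel_mono (L : ℕ) : Monotone (combLevel L) := fun _ _ h =>
  min_le_min_right _ (pieceIndex_mono L h)

theorem combLevel_lt (hL : 0 < L) (x : ℝ) : combLevel L x < L :=
  (min_le_right _ _).trans_lt (Nat.sub_lt hL one_pos)

/-- The path moves through closed cells of nondecreasing level and the final slide stays in the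
topmost one. Tameness uses nothing else about the path. -/
theorem comb_mem (i : ℕ) (hi : i < m + 1) (s : I) {x : ℝ} (hx : x ∈ Set.Icc (0 : ℝ) (L + 1)) :
    ∃ (δ : U.complex.Side) (y r : ℝ), δ.cell = (⟨i, hi⟩, ⟨combLevel L x, combLevel_lt hL x⟩) ∧
      comb U hL i hi s x = U.complex.facePt δ y r := by
  have key : ∃ (d : (complex m L).Side) (x' r : ℝ), d.cell = (⟨i, hi⟩, ⟨combLevel L x, combLevel_lt hL x⟩) ∧
      comb U hL i hi s x = U.wedge d x' r := by
    rw [(comb_eq U hL i hi s hx).1]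
    unfold combPiece
    split_ifs with hp
    · have he : combLevel L x = pieceIndex L x := min_eq_left (by omega)
      simp only [he]
      exact cellMap_mem U i _ hi hp _ _
    · have he : combLevel L x = L - 1 := min_eq_right (by omega)
      simp only [he]
      obtain ⟨d, x', h, e⟩ := wTop_mem U i (L - 1) hi (Nat.sub_lt hL one_pos)
        ((1 - (x - pieceIndex L x)) * clamp (3 * s - 1) + (x - pieceIndex L x) * s) 0
      exact ⟨d, x', 0, h, e⟩
  obtain ⟨d, x', r, h, e⟩ := key
  obtain ⟨p, y, e'⟩ := U.wedge_mem d x' r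
  exact ⟨U.sideAt d p, y, r, h, e.trans e'⟩

end Comb

end Grid

end TameFilling

namespace TameFilling

open unitInterval

/-! ### Coarse distances on closed cells -/

namespace PlanarComplex

variable (Y : PlanarComplex)

theorem face_next (d : Y.D) : Y.face (Y.next d) = Y.face d :=
  ((Y.face_eq_iff _ _).2 (sameCycle_apply _ _)).symm

theorem face_iterate_next (d : Y.D) (n : ℕ) : Y.face (Y.next^[n] d) = Y.face d := by
  induction n with
  | zero => rfl
  | succ n ih => rw [Function.iterate_succ_apply', face_next, ih]

theorem minimalPeriod_next_pos (d : Y.D) : 0 < Function.minimalPeriod Y.next d := by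
  have := Y.finite_D
  exact Function.minimalPeriod_pos_of_mem_periodicPts
    (Y.next.injective.mem_periodicPts d)

theorem exists_iterate_next_eq {d d' : Y.D} (h : Y.face d = Y.face d') :
    ∃ n < Function.minimalPeriod Y.next d, Y.next^[n] d = d' := by
  have := Y.finite_D
  obtain ⟨n, hn⟩ := ((Y.face_eq_iff d d').1 h).exists_nat_pow_eq
  refine ⟨n % Function.minimalPeriod Y.next d, Nat.mod_lt _ (Y.minimalPeriod_next_pos d), ?_⟩
  rw [Function.iterate_mod_minimalPeriod_eq, ← hn, Equiv.Perm.iterate_eq_pow]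

/-- Functions that vary by at most one along edges vary little around a face. -/
theorem abs_sub_le_of_face_eq (h : Y.V → ℝ) (hh : ∀ d, |h (Y.tgt d) - h (Y.src d)| ≤ 1)
    {d d' : Y.D} (hf : Y.face d = Y.face d') {M : ℕ}
    (hM : Function.minimalPeriod Y.next d ≤ M) : |h (Y.src d') - h (Y.src d)| ≤ M := by
  obtain ⟨n, hn, rfl⟩ := Y.exists_iterate_next_eq hf
  have key : ∀ n : ℕ, |h (Y.src (Y.next^[n] d)) - h (Y.src d)| ≤ n := by
    intro n
    induction n with
    | zero => simp
    | succ n ih =>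
      rw [Function.iterate_succ_apply', Y.src_next]
      have := abs_add_le (h (Y.tgt (Y.next^[n] d)) - h (Y.src (Y.next^[n] d)))
        (h (Y.src (Y.next^[n] d)) - h (Y.src d))
      rw [sub_add_sub_cancel] at this
      push_cast
      linarith [hh (Y.next^[n] d)]
  exact (key n).trans (by exact_mod_cast (hn.le.trans hM))

/-- Vertices of the cell have values within M of k, edges add 1/2, and the 2-cell has a supremum of
edge values minus 1/4. Abstract `c` and `h` cover both coarse distances; `X` need only be a part of
the edge values, which suits the image of the cell in the Cayley complex. -/
theorem abs_onPoints_facePt_sub_le (c : Y.toTwoComplex.Cell → ℝ)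
    (hc : ∀ d, c (.edge (Y.rev d)) = c (.edge d)) (h : Y.V → ℝ) (hv : ∀ v : Y.V, c (.vert v) = h v)
    (he : ∀ d : Y.D, c (.edge d) = min (h (Y.src d)) (h (Y.tgt d)) + 1 / 2)
    (hf : ∀ f, ∃ X : Set ℝ, X.Nonempty ∧ X ⊆ (fun d => c (.edge d)) '' {d | Y.face d = some f} ∧
      c (.face f) = sSup X - 1 / 4)
    (δ : Y.Side) {k M : ℝ} (hM : ∀ d, Y.face d = some δ.cell → |h (Y.src d) - k| ≤ M) (y r : ℝ) :
    |Y.onPoints c hc (Y.facePt δ y r) - k| ≤ M + 1 := by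
  have hδ : Y.face δ.1 = some δ.cell := (Option.some_get δ.2).symm
  have htgt : ∀ d, Y.face d = some δ.cell → |h (Y.tgt d) - k| ≤ M := fun d hd => by
    rw [← Y.src_next]
    exact hM _ ((Y.face_next d).trans hd)
  have hedge : ∀ d, Y.face d = some δ.cell →
      c (.edge d) ∈ Set.Icc (k - M + 1 / 2) (k + M + 1 / 2) := by
    intro d hd
    refine (he d).symm ▸ ?_
    have h1 := abs_le.1 (hM d hd)
    have h2 := abs_le.1 (htgt d hd)
    constructor
    · have : k - M ≤ min (h (Y.src d)) (h (Y.tgt d)) := le_min (by linarith) (by linarith)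
      linarith
    · have := min_le_left (h (Y.src d)) (h (Y.tgt d))
      linarith
  change |c (Y.rawCell (Y.rawFace δ (Set.projIcc 0 1 zero_le_one y)
    (Set.projIcc 0 1 zero_le_one r))) - k| ≤ M + 1
  simp only [rawCell, rawFace, edgeCell]
  split_ifs
  · refine (congrArg (fun z => |z - k|) (hv (Y.src δ.1))).trans_le ?_
    linarith [hM _ hδ]
  · refine (congrArg (fun z => |z - k|) (hv (Y.tgt δ.1))).trans_le ?_
    linarith [htgt _ hδ]
  · have := hedge _ hδ
    rw [abs_le]
    constructor <;> linarith [this.1, this.2]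
  · obtain ⟨X, ⟨x, hx⟩, hX, e⟩ := hf δ.cell
    have hX' : ∀ x ∈ X, x ∈ Set.Icc (k - M + 1 / 2) (k + M + 1 / 2) := by
      intro x hx
      obtain ⟨d, hd, rfl⟩ := hX hx
      exact hedge d hd
    have h1 : sSup X ≤ k + M + 1 / 2 := csSup_le ⟨x, hx⟩ fun x hx => (hX' x hx).2
    have h2 : x ≤ sSup X := le_csSup ⟨_, fun x hx => (hX' x hx).2⟩ hx
    have h3 := (hX' x hx).1
    rw [e, abs_le]
    constructor <;> linarith

end PlanarComplex

/-! ### Subdivision along words -/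

section Labelling

variable {G : Type*} [Group G] {A : Type*} [InvolutiveInv A]

/-- A labelling of the edges of a planar complex by nonempty words, with a compatible map of the
vertices to the group. -/
structure WordLabelling (S : SymmGen G A) (Y : PlanarComplex) where
  word : Y.D → List A
  word_ne : ∀ d, word d ≠ []
  word_rev : ∀ d, word (Y.rev d) = wordInv (word d)
  elt : Y.V → G
  elt_tgt : ∀ d, elt (Y.tgt d) = elt (Y.src d) * S.ev (word d)
  dir : Y.D → Prop
  dir_rev : ∀ d, dir (Y.rev d) ↔ ¬ dir d

namespace WordLabelling

variable {S : SymmGen G A} {Y : PlanarComplex} (W : WordLabelling S Y)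

/-- The subdivision of the edges into letters. -/
def subdiv : EdgeSubdivision Y where
  len d := (W.word d).length
  len_pos d := List.length_pos_iff.2 (W.word_ne d)
  len_rev d := by rw [W.word_rev, length_wordInv]
  dir := W.dir
  dir_rev := W.dir_rev

/-- The label of a directed edge of the subdivision. -/
def label (x : W.subdiv.Dart) : A := (W.word x.1.1)[x.1.2]'x.2

theorem label_revDart (x : W.subdiv.Dart) : W.label (W.subdiv.revDart x) = (W.label x)⁻¹ := by
  obtain ⟨⟨d, p⟩, hp⟩ := x
  have hp' : p < (W.word d).length := hp
  have h1 : W.label (W.subdiv.revDart ⟨(d, p), hp⟩) =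
      (wordInv (W.word d))[(W.word d).length - 1 - p]'(by rw [length_wordInv]; omega) := by
    simp only [label, EdgeSubdivision.revDart, subdiv, W.word_rev]
  rw [h1]
  simp only [wordInv, List.getElem_reverse, List.getElem_map, List.length_map, label]
  congr 2
  omega

/-- The group element at a vertex of the subdivision. -/
def pos : W.subdiv.Vert → G
  | .inl v => W.elt v
  | .inr x => W.elt (Y.src x.1.1) * S.ev ((W.word x.1.1).take x.1.2)

theorem wordInv_take (u : List A) (p : ℕ) (hp : p ≤ u.length) :
    (wordInv u).take (u.length - p) = wordInv (u.drop p) := by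
  rw [wordInv, wordInv, List.map_drop, List.take_reverse, List.length_map, Nat.sub_sub_self hp]

theorem pos_vertAt (d : Y.D) (p : ℕ) (hp : p ≤ (W.word d).length) :
    W.pos (W.subdiv.vertAt d p) = W.elt (Y.src d) * S.ev ((W.word d).take p) := by
  rcases Nat.eq_zero_or_pos p with rfl | h0
  · rw [EdgeSubdivision.vertAt_zero, List.take_zero, S.ev_nil, mul_one]
    rfl
  rcases hp.eq_or_lt with rfl | h1
  · rw [List.take_length, ← W.elt_tgt, show (W.word d).length = W.subdiv.len d from rfl,
      EdgeSubdivision.vertAt_len]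
    rfl
  have h1' : p < W.subdiv.len d := h1
  by_cases hd : W.subdiv.dir d
  · rw [W.subdiv.vertAt_of_dir hd ⟨h0, h1'⟩]
    rfl
  -- Against the chosen direction the vertex is reached from the far end by the inverse of the
  -- remaining letters, which cancel in the group.
  · rw [← W.subdiv.vertAt_rev d p hp, W.subdiv.vertAt_of_dir ((W.subdiv.dir_rev d).2 hd)
      ⟨Nat.sub_pos_of_lt h1', by rw [W.subdiv.len_rev]; omega⟩]
    change W.elt (Y.tgt d) * S.ev ((W.word (Y.rev d)).take ((W.word d).length - p)) = _
    rw [W.word_rev, wordInv_take _ _ hp, S.ev_wordInv, W.elt_tgt, mul_assoc]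
    congr 1
    nth_rw 1 [← List.take_append_drop p (W.word d)]
    rw [S.ev_append, mul_inv_cancel_right]

theorem pos_tgt (x : W.subdiv.Dart) : W.pos (W.subdiv.complex.tgt x) =
    W.pos (W.subdiv.complex.src x) * S.rep (W.label x) := by
  have hx : x.1.2 < (W.word x.1.1).length := x.2
  rw [W.subdiv.tgt_complex, W.subdiv.src_complex, W.pos_vertAt _ _ hx, W.pos_vertAt _ _ hx.le,
    S.ev_take_succ _ _ hx, mul_assoc]
  rfl

end WordLabelling

/-- Words around faces evaluate along paths. -/
theorem ev_take_faceWord {S : SymmGen G A} (Y : PlanarComplex) (label : Y.D → A) (pos : Y.V → G)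
    (hpos : ∀ d, pos (Y.tgt d) = pos (Y.src d) * S.rep (label d)) (d : Y.D) (n : ℕ)
    (hn : n ≤ (Y.faceWord label d).length) :
    pos (Y.src (Y.next^[n] d)) = pos (Y.src d) * S.ev ((Y.faceWord label d).take n) := by
  induction n with
  | zero => rw [List.take_zero, S.ev_nil, mul_one]; rfl
  | succ n ih =>
    rw [S.ev_take_succ _ _ hn, ← mul_assoc, ← ih (by omega), Function.iterate_succ_apply',
      Y.src_next, hpos]
    simp [PlanarComplex.faceWord, Equiv.Perm.iterate_eq_pow]

theorem length_faceWord {B : Type*} (Y : PlanarComplex) (label : Y.D → B) (d : Y.D) :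
    (Y.faceWord label d).length = Function.minimalPeriod Y.next d := by
  simp [PlanarComplex.faceWord]

/-- The boundary circuit of a face returns to its initial edge, so its word fixes the element at the
starting vertex. -/
theorem ev_faceWord {S : SymmGen G A} (Y : PlanarComplex) (label : Y.D → A) (pos : Y.V → G)
    (hpos : ∀ d, pos (Y.tgt d) = pos (Y.src d) * S.rep (label d)) (d : Y.D) :
    S.ev (Y.faceWord label d) = 1 := by
  have h := ev_take_faceWord Y label pos hpos d _ le_rfl
  rwa [List.take_length, length_faceWord, Function.iterate_minimalPeriod, left_eq_mul] at h

/-- The number of sides of a face of a subdivision. -/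
theorem EdgeSubdivision.minimalPeriod_next_le {Y : PlanarComplex} (U : EdgeSubdivision Y)
    {k B : ℕ} (hB : ∀ d, U.len d ≤ B) (side : Y.D → Fin k)
    (hside : ∀ d d', Y.face d = Y.face d' → (Y.face d).isSome → side d = side d' → d = d')
    (x : U.complex.D) (hx : (U.complex.face x).isSome) :
    Function.minimalPeriod U.complex.next x ≤ k * B := by
  -- An edge on the circuit is determined by the old side it belongs to and its position there: k
  -- times B possibilities.
  have hcard := Fintype.card_le_of_injective
    (fun n : Fin (Function.minimalPeriod U.complex.next x) =>
      let y : U.Dart := U.complex.next^[n] x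
      (side y.1.1, (⟨y.1.2, y.2.trans_le (hB _)⟩ : Fin B))) ?_
  · simpa using hcard
  intro n n' h
  simp only [Prod.mk.injEq, Fin.mk.injEq] at h
  have hn := U.complex.face_iterate_next x n
  have hn' := U.complex.face_iterate_next x n'
  have h1 := hside _ _ (hn.trans hn'.symm) ((congrArg Option.isSome hn).trans hx) h.1
  have h2 : U.complex.next^[n] x = U.complex.next^[n'] x := Subtype.ext (Prod.ext h1 h.2)
  exact Fin.ext (Function.iterate_injOn_Iio_minimalPeriod n.2 n'.2 h2)

/-- A subdivision maps to any function on the old vertices that varies slowly along old edges. -/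
theorem EdgeSubdivision.le_add_dist {Y : PlanarComplex} (U : EdgeSubdivision Y) (g : Y.V → ℕ)
    (hg : ∀ d, g (Y.tgt d) ≤ g (Y.src d) + 1) (u v : Y.V) :
    g v ≤ g u + U.complex.graph.dist (Sum.inl u : U.Vert) (Sum.inl v : U.Vert) := by
  classical
  -- New vertices inherit the value of the old vertex from which the chosen direction starts, so the
  -- whole change along an old edge occurs on one piece.
  let g' : U.Vert → ℕ := Sum.elim g fun x => g (Y.src x.1.1)
  have hg' : ∀ d, g (Y.src d) ≤ g (Y.tgt d) + 1 := by
    intro d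
    have := hg (Y.rev d)
    rwa [Y.tgt_rev] at this
  have hin : ∀ d p, 0 < p → p < U.len d →
      g' (U.vertAt d p) = if U.dir d then g (Y.src d) else g (Y.tgt d) := by
    intro d p h0 h1
    split_ifs with hd
    · rw [U.vertAt_of_dir hd ⟨h0, h1⟩]; rfl
    · rw [← U.vertAt_rev d p h1.le, U.vertAt_of_dir ((U.dir_rev d).2 hd)
        ⟨Nat.sub_pos_of_lt h1, by rw [U.len_rev]; omega⟩]
      rfl
  refine U.complex.le_add_dist_of_forall_tgt_le U.complex.connected g' ?_ (Sum.inl u) (Sum.inl v)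
  rintro ⟨⟨d, p⟩, hp⟩
  simp only at hp
  rw [U.tgt_complex, U.src_complex]
  have h1 := hg d
  have h2 := hg' d
  have e0 : g' (U.vertAt d 0) = g (Y.src d) := by rw [U.vertAt_zero]; rfl
  have e1 : g' (U.vertAt d (U.len d)) = g (Y.tgt d) := by rw [U.vertAt_len]; rfl
  simp only
  rcases Nat.eq_zero_or_pos p with rfl | h0 <;> rcases (Nat.succ_le_of_lt hp).eq_or_lt with h | h
  · rw [Nat.succ_eq_add_one] at h
    rw [h, e0, e1]; exact h1
  · rw [e0, hin d _ (by omega) h]; split_ifs <;> omega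
  · rw [Nat.succ_eq_add_one] at h
    rw [h, e1, hin d p h0 hp]; split_ifs <;> omega
  · rw [hin d p h0 hp, hin d _ (by omega) h]; omega

theorem EdgeSubdivision.dist_vertAt_le {Y : PlanarComplex} (U : EdgeSubdivision Y)
    (u : U.complex.V) (d : Y.D) (p : ℕ) (hp : p ≤ U.len d) :
    U.complex.graph.dist u (U.vertAt d p) ≤
      U.complex.graph.dist u (Sum.inl (Y.src d) : U.Vert) + p := by
  induction p with
  | zero => rw [vertAt_zero]; rfl
  | succ p ih =>
    have := U.complex.dist_tgt_le U.complex.connected u (⟨(d, p), hp⟩ : U.Dart)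
    rw [U.tgt_complex, U.src_complex] at this
    have := ih (by omega)
    simp only at *
    omega

theorem EdgeSubdivision.dist_tgt_le {Y : PlanarComplex} (U : EdgeSubdivision Y)
    (u : U.complex.V) (d : Y.D) :
    U.complex.graph.dist u (Sum.inl (Y.tgt d) : U.Vert) ≤
      U.complex.graph.dist u (Sum.inl (Y.src d) : U.Vert) + U.len d := by
  have := U.dist_vertAt_le u d _ le_rfl
  rwa [U.vertAt_len] at this

end Labelling

end TameFilling

/-! ### The van Kampen diagram of a labelled grid and its 1-combing -/

namespace TameFilling

open unitInterval

section Diagram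

variable {G : Type*} [Group G] {A : Type*} [InvolutiveInv A] {S : SymmGen G A}

theorem finRotate_val {n : ℕ} (i : Fin n) :
    (finRotate n i).val = if i.val + 1 < n then i.val + 1 else 0 := by
  cases n with
  | zero => exact i.elim0
  | succ n =>
    rw [coe_finRotate]
    have := i.2
    have h : i = Fin.last n ↔ ¬ (i.val + 1 < n + 1) := by
      rw [Fin.ext_iff, Fin.val_last]; omega
    by_cases h' : i.val + 1 < n + 1
    · rw [if_neg (fun e => h.1 e h'), if_pos h']
    · rw [if_pos (h.2 h'), if_neg h']

/-- A labelling of the grid by short words, with the letters of a given word on the top rungs. -/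
structure GridLabelling (S : SymmGen G A) (w : List A) (m L B : ℕ) extends
    WordLabelling S (Grid.complex m L) where
  length_eq : w.length = m + 1
  pos_L : 0 < L
  length_word_le : ∀ d, (word d).length ≤ B
  word_top : ∀ i (hi : i < m + 1),
    word (Grid.right i (L - 1) hi (Nat.sub_lt pos_L one_pos)) = [w[i]]
  elt_base : elt none = 1

namespace GridLabelling

variable {w : List A} {m L B : ℕ} (W : GridLabelling S w m L B)

theorem lt_of_fin {w : List A} {m L B : ℕ} (W : GridLabelling S w m L B) (i : Fin w.length) :
    i.val < m + 1 := W.length_eq ▸ i.2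

/-- The top rung over a letter of the word. -/
def top (i : Fin w.length) : (Grid.complex m L).D :=
  Grid.right i (L - 1) (W.lt_of_fin i) (Nat.sub_lt W.pos_L one_pos)

/-- The top rung over a letter of the word, in the outer direction. -/
def topRev (i : Fin w.length) : (Grid.complex m L).D :=
  Grid.left i (L - 1) (W.lt_of_fin i) (Nat.sub_lt W.pos_L one_pos)

theorem top_injective : Function.Injective W.top := by
  intro i i' h
  have h1 : Grid.right (m := m) (i : ℕ) (L - 1) (W.lt_of_fin i) (Nat.sub_lt W.pos_L one_pos) =
    Grid.right (i' : ℕ) (L - 1) (W.lt_of_fin i') (Nat.sub_lt W.pos_L one_pos) := h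
  simp only [Grid.right, Prod.mk.injEq, Sum.inr.injEq, Fin.mk.injEq, and_true] at h1
  exact Fin.ext h1

theorem top_ne_topRev (i i' : Fin w.length) : W.top i ≠ W.topRev i' := by
  intro h
  have h1 : true = false := congrArg (fun d : Grid.Dart m L => d.2) h
  exact absurd h1 (by decide)

theorem len_top (i : Fin w.length) : W.subdiv.len (W.top i) = 1 :=
  congrArg List.length (W.word_top i (W.lt_of_fin i))

theorem len_topRev (i : Fin w.length) : W.subdiv.len (W.topRev i) = 1 :=
  (W.subdiv.len_rev (W.top i)).trans (W.len_top i)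

theorem revDart_first_top (i : Fin w.length) :
    W.subdiv.revDart (W.subdiv.first (W.top i)) = W.subdiv.first (W.topRev i) := by
  refine Subtype.ext (Prod.ext rfl ?_)
  change W.subdiv.len (W.top i) - 1 - 0 = 0
  rw [W.len_top]

theorem face_topRev (i : Fin w.length) : Grid.face (W.topRev i) = none :=
  Grid.face_left_top _ _ _ _ (by have := W.pos_L; omega)

/-- The outer face meets the letters of the word backwards, and the cyclic step from the last letter
to the first is the wrap at the basepoint. -/
theorem next_topRev (i : Fin w.length) :
    Grid.nextPerm m L (W.topRev (finRotate w.length i)) = W.topRev i := by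
  have ht : ¬ L - 1 + 1 < L := by have := W.pos_L; omega
  have hv := finRotate_val i
  have hi := W.lt_of_fin i
  have hl := W.length_eq
  unfold topRev
  split_ifs at hv with h
  · simp only [hv]
    exact Grid.nextPerm_left_top i (L - 1) (by omega) _ ht
  · have him : i.val = m := by omega
    simp only [hv, him]
    exact Grid.nextPerm_left_top_zero (L - 1) _ ht

theorem minimalPeriod_le (x : W.subdiv.complex.D) (hx : (W.subdiv.complex.face x).isSome) :
    Function.minimalPeriod W.subdiv.complex.next x ≤ 4 * B :=
  W.subdiv.minimalPeriod_next_le W.length_word_le Grid.side Grid.eq_of_side_eq x hx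

/-- The van Kampen diagram of a labelled grid. -/
noncomputable def diagram {M : ℕ} (hM : 4 * B ≤ M) : VanKampenDiagram (shortRelators S M) w where
  toPlanarComplex := W.subdiv.complex
  label := W.label
  label_rev := W.label_revDart
  relator d hd := by
    have hl := length_faceWord W.subdiv.complex W.label d
    refine ⟨?_, hl.trans_le ((W.minimalPeriod_le d hd).trans hM),
      ev_faceWord W.subdiv.complex W.label W.pos W.pos_tgt d⟩
    rw [← List.length_pos_iff, hl]
    exact W.subdiv.complex.minimalPeriod_next_pos d
  base := (Sum.inl none : W.subdiv.Vert)
  boundary i := W.subdiv.first (W.top i)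
  boundary_injective i i' h := W.top_injective (congrArg (fun x : W.subdiv.Dart => x.1.1) h)
  mem_boundary := by
    rintro ⟨⟨d, p⟩, hp⟩
    constructor
    · rintro ⟨i, hi⟩
      rw [← hi]
      exact W.face_topRev i
    · intro h
      obtain ⟨i, j, hi, hj, e, ht⟩ := Grid.eq_left_of_face_eq_none (Grid.rev d) h
      obtain rfl : j = L - 1 := by omega
      have hd : d = W.top ⟨i, W.length_eq ▸ hi⟩ := by
        rw [← Grid.rev_rev d, e]
        rfl
      refine ⟨⟨i, W.length_eq ▸ hi⟩, Subtype.ext (Prod.ext hd.symm ?_)⟩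
      have h1 : p < W.subdiv.len d := hp
      rw [hd, W.len_top] at h1
      change 0 = p
      omega
  boundary_next i := by
    change W.subdiv.nextPerm (W.subdiv.revDart _) = W.subdiv.revDart _
    rw [W.revDart_first_top, W.revDart_first_top]
    refine (W.subdiv.nextPerm_last _ ?_).trans (congrArg W.subdiv.first (W.next_topRev i))
    rw [W.len_topRev]
  boundary_start i hi := by
    change W.subdiv.vertAt (W.top i) 0 = _
    rw [W.subdiv.vertAt_zero]
    change Sum.inl (Grid.vtx m L i _) = _
    rw [hi, Grid.vtx_zero_left]
    rfl
  boundary_label i := by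
    have h := W.word_top i (W.lt_of_fin i)
    simp only [WordLabelling.label, EdgeSubdivision.first, top, h]
    rfl

variable {M : ℕ} (hM : 4 * B ≤ M)

/-- The projection of the diagram of a labelled grid. -/
noncomputable def projection : CellularProjection S (W.diagram hM) where
  onV := W.pos
  onF f := (W.pos (W.subdiv.complex.src (W.subdiv.complex.face_surj f).choose),
    ⟨(W.diagram hM).toPlanarComplex.faceWord (W.diagram hM).label
      (W.subdiv.complex.face_surj f).choose, (W.diagram hM).relator _ (by
        have h := (W.subdiv.complex.face_surj f).choose_spec
        exact (congrArg Option.isSome h).trans rfl)⟩)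
  onV_base := W.elt_base
  onV_tgt := W.pos_tgt
  onF_spec f := ⟨_, (W.subdiv.complex.face_surj f).choose_spec, rfl, rfl⟩

/-! ### The combing of the diagram -/

/-- The combing path to the top of a column. -/
noncomputable def column (k : ℕ) (x : ℝ) : W.subdiv.complex.Space :=
  -- There is no strip m + 1; the remaining column, k = m + 1, is collapsed and its path is
  -- constant.
  if hk : k < m + 1 then Grid.comb W.subdiv W.pos_L k hk 0 x else Grid.gridPt W.subdiv none

theorem comb_one_eq_column {i : ℕ} (hi : i < m + 1) {x : ℝ} (hx : x ∈ Set.Icc (0 : ℝ) (L + 1)) :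
    Grid.comb W.subdiv W.pos_L i hi 1 x = W.column (i + 1) x := by
  unfold column
  split_ifs with h
  · exact Grid.comb_one_eq W.subdiv W.pos_L i (by omega) hx
  · obtain rfl : i = m := by omega
    exact Grid.comb_last_one W.subdiv W.pos_L hx

theorem comb_zero_eq_column {i : ℕ} (hi : i < m + 1) (x : ℝ) :
    Grid.comb W.subdiv W.pos_L i hi 0 x = W.column i x := by
  rw [column, dif_pos hi]

/-- The only coincidence among the tops of the columns is that of columns 0 and m + 1, and both
paths are constant there. -/
theorem column_eq_of_vtx_eq {k k' : ℕ} (hk : k ≤ m + 1) (hk' : k' ≤ m + 1)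
    (h : Grid.vtx m L k L = Grid.vtx m L k' L) {x : ℝ} (hx : x ∈ Set.Icc (0 : ℝ) (L + 1)) :
    W.column k x = W.column k' x := by
  have hL := W.pos_L
  have hout : ∀ k, k ≤ m + 1 → (k = 0 ∨ k = m + 1) → W.column k x = Grid.gridPt W.subdiv none := by
    rintro k - (rfl | rfl)
    · rw [column, dif_pos (Nat.succ_pos m)]
      exact Grid.comb_first_zero W.subdiv W.pos_L hx
    · rw [column, dif_neg (lt_irrefl _)]
  have hin : ∀ k, k ≤ m + 1 → ¬ (k = 0 ∨ k = m + 1) → ∃ hk : k - 1 < m,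
      Grid.vtx m L k L = some (⟨k - 1, hk⟩, ⟨L - 1, Nat.sub_lt hL one_pos⟩) := by
    intro k hk h
    refine ⟨by omega, ?_⟩
    obtain ⟨l, rfl⟩ : ∃ l, L = l + 1 := ⟨L - 1, by omega⟩
    obtain ⟨k, rfl⟩ : ∃ l, k = l + 1 := ⟨k - 1, by omega⟩
    exact Grid.vtx_succ_succ _ _
  have hnone : ∀ k, (k = 0 ∨ k = m + 1) → Grid.vtx m L k L = none := by
    rintro k (rfl | rfl)
    · exact Grid.vtx_zero_left _
    · exact Grid.vtx_last _
  by_cases h1 : k = 0 ∨ k = m + 1 <;> by_cases h2 : k' = 0 ∨ k' = m + 1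
  · rw [hout k hk h1, hout k' hk' h2]
  · obtain ⟨_, e⟩ := hin k' hk' h2
    rw [hnone k h1, e] at h
    simp at h
  · obtain ⟨_, e⟩ := hin k hk h1
    rw [hnone k' h2, e] at h
    simp at h
  · obtain ⟨_, e⟩ := hin k hk h1
    obtain ⟨_, e'⟩ := hin k' hk' h2
    rw [e, e'] at h
    simp only [Option.some.injEq, Prod.mk.injEq, Fin.mk.injEq, and_true] at h
    obtain rfl : k = k' := by omega
    rfl

theorem edgePt_top_endpoint (i : Fin w.length) (s : I) (hs : s = 0 ∨ s = 1) :
    ∃ k ≤ m + 1, W.subdiv.complex.edgePt (W.subdiv.first (W.top i)) s =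
        Grid.gridPt W.subdiv (Grid.vtx m L k L) ∧
      ∀ x ∈ Set.Icc (0 : ℝ) (L + 1),
        Grid.comb W.subdiv W.pos_L i (W.lt_of_fin i) s x = W.column k x := by
  have hi := W.lt_of_fin i
  have hL : L - 1 + 1 = L := by have := W.pos_L; omega
  rcases hs with rfl | rfl
  · refine ⟨i, hi.le, ?_, fun x _ => W.comb_zero_eq_column hi x⟩
    refine (W.subdiv.complex.edgePt_zero _).trans ?_
    change W.subdiv.complex.vertPt (W.subdiv.vertAt (W.top i) 0) = _
    rw [W.subdiv.vertAt_zero]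
    change Grid.gridPt W.subdiv (Grid.vtx m L i (L - 1 + 1)) = _
    rw [hL]
  · refine ⟨i + 1, hi, ?_, fun x hx => W.comb_one_eq_column hi hx⟩
    refine (W.subdiv.complex.edgePt_one _).trans ?_
    rw [W.subdiv.tgt_complex]
    change W.subdiv.complex.vertPt (W.subdiv.vertAt (W.top i) 1) = _
    have h1 := W.subdiv.vertAt_len (W.top i)
    rw [W.len_top] at h1
    rw [h1]
    change Grid.gridPt W.subdiv (Grid.vtx m L (i + 1) (L - 1 + 1)) = _
    rw [hL]

theorem endpoint_of_edgePt_eq_vertPt (Y : PlanarComplex) {d : Y.D} {s : I} {v : Y.V}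
    (h : Y.edgePt d s = Y.vertPt v) : s = 0 ∨ s = 1 := by
  by_contra hn
  rw [not_or] at hn
  exact Y.coord_edgePt_ne_vertPt d s hn.1 hn.2 v (congrArg Y.coord h)

/-- Two boundary parameters give the same point only if they agree or both are endpoints: an
interior point could otherwise only arise from the same rung run backwards, and the boundary uses
all top rungs in one direction. -/
theorem comb_eq_of_edgePt_eq (i i' : Fin w.length) (s s' : I)
    (h : W.subdiv.complex.edgePt (W.subdiv.first (W.top i)) s =
      W.subdiv.complex.edgePt (W.subdiv.first (W.top i')) s')
    {x : ℝ} (hx : x ∈ Set.Icc (0 : ℝ) (L + 1)) :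
    Grid.comb W.subdiv W.pos_L i (W.lt_of_fin i) s x =
      Grid.comb W.subdiv W.pos_L i' (W.lt_of_fin i') s' x := by
  by_cases hs : s = 0 ∨ s = 1
  · obtain ⟨k, hk, e, ec⟩ := W.edgePt_top_endpoint i s hs
    have hs' : s' = 0 ∨ s' = 1 := endpoint_of_edgePt_eq_vertPt _ (h.symm.trans e)
    obtain ⟨k', hk', e', ec'⟩ := W.edgePt_top_endpoint i' s' hs'
    rw [ec x hx, ec' x hx]
    refine W.column_eq_of_vtx_eq hk hk' ?_ hx
    have := W.subdiv.complex.vertPt_injective (e.symm.trans (h.trans e'))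
    exact Sum.inl.inj this
  · rw [not_or] at hs
    rcases W.subdiv.complex.edge_eq_of_coord_eq hs.1 hs.2 (congrArg _ h) with ⟨h1, rfl⟩ | ⟨h1, -⟩
    · rw [W.top_injective (congrArg (fun x : W.subdiv.Dart => x.1.1) h1)]
    · exact absurd (congrArg (fun x : W.subdiv.Dart => x.1.1) h1) (W.top_ne_topRev i i')

/-- The corner of a cell of the grid. -/
noncomputable def corner (i j : ℕ) : W.subdiv.Vert := Sum.inl (Grid.vtx m L i (j + 1))

/-- The combing of the diagram of a labelled grid, which is tame for coarse distances that grow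
tamely along the columns. -/
theorem exists_oneCombing :
    ∃ ψ : (W.diagram hM).bdrySet × I → (W.diagram hM).toPlanarComplex.Space,
      IsOneCombing (W.diagram hM) ψ ∧
      ∀ (c : W.subdiv.complex.toTwoComplex.Cell → ℝ)
        (hc : ∀ d, c (.edge (W.subdiv.complex.rev d)) = c (.edge d)) (h : W.subdiv.Vert → ℝ)
        (f : ℝ → ℝ),
        (∀ v : W.subdiv.Vert, c (.vert v) = h v) →
        (∀ d : W.subdiv.Dart, c (.edge d) =
          min (h (W.subdiv.complex.src d)) (h (W.subdiv.complex.tgt d)) + 1 / 2) →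
        (∀ f, ∃ X : Set ℝ, X.Nonempty ∧ X ⊆ (fun d : W.subdiv.Dart => c (.edge d)) ''
          {d | W.subdiv.complex.face d = some f} ∧ c (.face f) = sSup X - 1 / 4) →
        (∀ d : W.subdiv.Dart,
          |h (W.subdiv.complex.tgt d) - h (W.subdiv.complex.src d)| ≤ 1) →
        (∀ i j j', i < m + 1 → j ≤ j' → j' < L → ∀ x : ℝ, h (W.corner i j') ≤ x + M + 1 →
          h (W.corner i j) + M + 1 ≤ f x) →
        IsTame (W.subdiv.complex.onPoints c hc) f ψ := by
  have hlen : 0 < w.length := by rw [W.length_eq]; exact Nat.succ_pos m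
  have hL1 : (0 : ℝ) < L + 1 := by positivity
  have htime : ∀ t : I, ((L : ℝ) + 1) * t ∈ Set.Icc (0 : ℝ) (L + 1) := fun t =>
    ⟨mul_nonneg hL1.le t.2.1, mul_le_of_le_one_right hL1.le t.2.2⟩
  obtain ⟨ψ, hψc, hψ⟩ := (W.diagram hM).exists_continuous_lift hlen
    -- The unit interval is stretched to L + 1 units: one for each of the L cells and one for the
    -- final slide.
    (fun i s t => Grid.comb W.subdiv W.pos_L i (W.lt_of_fin i) s ((L + 1) * t))
    (fun i => (Grid.continuous_comb W.subdiv W.pos_L i (W.lt_of_fin i)).comp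
      (f := fun q : I × I => (q.1, ((L : ℝ) + 1) * q.2)) (by fun_prop))
    (fun i i' s s' h t => W.comb_eq_of_edgePt_eq i i' s s' h (htime t))
  have hpt : ∀ p : (W.diagram hM).bdrySet, ∃ i s,
      p.1 = (W.diagram hM).toPlanarComplex.edgePt ((W.diagram hM).boundary i) s := by
    rintro ⟨p, hp | ⟨i, s, hp⟩⟩
    · exact ⟨⟨0, hlen⟩, 0, (show p = _ from hp).trans ((W.diagram hM).basePt_eq hlen)⟩
    · exact ⟨i, s, hp⟩
  refine ⟨ψ, ⟨hψc, ?_, ?_, ?_, ?_⟩, ?_⟩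
  · intro p
    obtain ⟨i, s, hp⟩ := hpt p
    rw [hψ p i s hp, Set.Icc.coe_zero, mul_zero]
    exact Grid.comb_zero _ _ _ _ _
  · intro p
    obtain ⟨i, s, hp⟩ := hpt p
    rw [hψ p i s hp, Set.Icc.coe_one, mul_one, Grid.comb_last, hp]
    exact W.subdiv.wedge_of_len_eq_one _ (W.len_top i) s.2
  · intro p hp t
    rw [hψ p ⟨0, hlen⟩ 0 (hp.trans ((W.diagram hM).basePt_eq hlen))]
    exact Grid.comb_first_zero W.subdiv W.pos_L (htime t)
  · rintro p ⟨v, hv⟩ t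
    obtain ⟨i, s, hp⟩ := hpt p
    rw [hψ p i s hp]
    exact Grid.comb_mem_oneSkeleton _ _ _ _ _
      (endpoint_of_edgePt_eq_vertPt _ (hp.symm.trans hv.symm)) (htime t)
  · intro c hc h f hv he hf hh hcorner p s t hst
    obtain ⟨i, u, hp⟩ := hpt p
    rw [hψ p i u hp, hψ p i u hp]
    -- The reference point is the left end of the upper rung of the current cell. The circuit of the
    -- cell has at most M edges, so h varies by at most M on it; edges and the 2-cell contribute the
    -- extra 1.
    have key : ∀ t : I, |W.subdiv.complex.onPoints c hc
        (Grid.comb W.subdiv W.pos_L i (W.lt_of_fin i) u ((L + 1) * t)) -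
          h (W.corner i (Grid.combLevel L ((L + 1) * t)))| ≤ M + 1 := by
      intro t
      obtain ⟨δ, y, r, hδ, e⟩ := Grid.comb_mem W.subdiv W.pos_L i (W.lt_of_fin i) u (htime t)
      rw [e]
      refine W.subdiv.complex.abs_onPoints_facePt_sub_le c hc h hv he hf δ ?_ y r
      intro d hd
      have hq : W.subdiv.complex.src (W.subdiv.first (Grid.right i
          (Grid.combLevel L ((L + 1) * t)) (W.lt_of_fin i) (Grid.combLevel_lt W.pos_L _))) =
          W.corner i (Grid.combLevel L ((L + 1) * t)) := W.subdiv.vertAt_zero _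
      rw [← hq]
      refine W.subdiv.complex.abs_sub_le_of_face_eq h hh ?_
        ((W.minimalPeriod_le _ rfl).trans hM)
      rw [hd, hδ]
      rfl
    have h1 := abs_le.1 (key s)
    have h2 := abs_le.1 (key t)
    have hmono : Grid.combLevel L ((L + 1) * s) ≤ Grid.combLevel L ((L + 1) * t) :=
      Grid.combLevel_mono L (mul_le_mul_of_nonneg_left (show (s : ℝ) ≤ t from hst.le) hL1.le)
    have h3 := hcorner i _ _ (W.lt_of_fin i) hmono (Grid.combLevel_lt W.pos_L _)
      (W.subdiv.complex.onPoints c hc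
        (Grid.comb W.subdiv W.pos_L i (W.lt_of_fin i) u ((L + 1) * t))) (by linarith)
    linarith

end GridLabelling

end Diagram

end TameFilling

namespace TameFilling

open unitInterval

/-! ### Linear functions -/

theorem isLinearFun_linear (a b : ℕ) (ha : 0 < a) : IsLinearFun fun x => a * x + b :=
  ⟨a, b, ha, fun _ _ => rfl⟩

theorem isNondecreasing_linear (a b : ℕ) : IsNondecreasing fun x => a * x + b := by
  refine ⟨?_, fun x _ y _ h => ?_⟩
  · rintro x ⟨n, rfl⟩
    exact ⟨a * n + 4 * b, by push_cast; ring⟩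
  · have := mul_le_mul_of_nonneg_left h (Nat.cast_nonneg (α := ℝ) a)
    dsimp only
    linarith

/-! ### The diagram for the empty word -/

section Trivial

/-- The one-point complex. -/
def pointComplex : PlanarComplex where
  V := Unit
  D := Empty
  src := Empty.elim
  rev := Empty.elim
  rev_rev d := d.elim
  F := Empty
  finite_V := inferInstance
  finite_D := inferInstance
  finite_F := inferInstance
  rev_ne d := d.elim
  next := Equiv.refl _
  face := Empty.elim
  src_eq_iff d := d.elim
  face_eq_iff d := d.elim
  face_surj f := f.elim
  connected := by
    have : Nonempty Unit := ⟨()⟩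
    exact SimpleGraph.Connected.mk (fun _ _ => SimpleGraph.Reachable.refl _)
  euler := by simp

variable {G : Type*} [Group G] {A : Type*} [InvolutiveInv A]

/-- The one-point diagram for the empty word. -/
def pointDiagram (R : Set (List A)) : VanKampenDiagram R ([] : List A) where
  toPlanarComplex := pointComplex
  label := Empty.elim
  label_rev d := Empty.elim d
  relator d := Empty.elim d
  base := ()
  boundary := Fin.elim0
  boundary_injective i := i.elim0
  mem_boundary d := Empty.elim d
  boundary_next i := i.elim0
  boundary_start i := i.elim0
  boundary_label i := i.elim0

theorem pointDiagram_eq_basePt (R : Set (List A)) (p : (pointDiagram R).bdrySet) :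
    p.1 = (pointDiagram R).basePt := by
  obtain ⟨p, hp | ⟨i, s, hp⟩⟩ := p
  · exact hp
  · exact i.elim0

theorem isOneCombing_pointDiagram (R : Set (List A)) :
    IsOneCombing (pointDiagram R) fun q => q.1.1 where
  continuous := continuous_subtype_val.comp continuous_fst
  zero := pointDiagram_eq_basePt R
  one _ := rfl
  base _ hp _ := hp
  vert p _ _ := Or.inl ⟨(), (pointDiagram_eq_basePt R p).symm⟩

/-- The projection of the one-point diagram. -/
def pointProjection (S : SymmGen G A) (R : Set (List A)) :
    CellularProjection S (pointDiagram R) where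
  onV _ := 1
  onF f := Empty.elim f
  onV_base := rfl
  onV_tgt d := Empty.elim d
  onF_spec f := Empty.elim f

theorem isTame_pointDiagram (R : Set (List A)) (c : (pointDiagram R).toPlanarComplex.Space → ℝ)
    (hc : c (pointDiagram R).basePt = 0) (a b : ℕ) :
    IsTame c (fun x => a * x + b) fun q : (pointDiagram R).bdrySet × I => q.1.1 := by
  intro p s t _
  simp only [pointDiagram_eq_basePt R p, hc]
  positivity

end Trivial

/-! ### Coarse distances in the diagram of a labelled grid -/

section Metric

variable {G : Type*} [Group G] {A : Type*} [InvolutiveInv A] {S : SymmGen G A}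

theorem abs_cast_sub_le_one {a b : ℕ} (h : a ≤ b + 1) (h' : b ≤ a + 1) : |(a : ℝ) - b| ≤ 1 := by
  have h1 : (a : ℝ) ≤ b + 1 := by exact_mod_cast h
  have h2 : (b : ℝ) ≤ a + 1 := by exact_mod_cast h'
  rw [abs_le]
  constructor <;> linarith

theorem OneComplex.abs_dist_tgt_sub_le (Y : OneComplex) (hc : Y.graph.Connected) (u : Y.V)
    (d : Y.D) : |(Y.graph.dist u (Y.tgt d) : ℝ) - Y.graph.dist u (Y.src d)| ≤ 1 := by
  refine abs_cast_sub_le_one (Y.dist_tgt_le hc u d) ?_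
  have := Y.dist_tgt_le hc u (Y.rev d)
  rwa [Y.tgt_rev] at this

namespace GridLabelling

variable {w : List A} {m L B : ℕ} (W : GridLabelling S w m L B)

theorem len_le (d : (Grid.complex m L).D) : W.subdiv.len d ≤ B := W.length_word_le d

/-- Distance from the basepoint to the vertices of the grid. -/
noncomputable def gridDist (i j : ℕ) : ℕ :=
  W.subdiv.complex.graph.dist (Sum.inl none : W.subdiv.Vert)
    (Sum.inl (Grid.vtx m L i j) : W.subdiv.Vert)

theorem gridDist_of_vtx_eq_none {i j : ℕ} (h : Grid.vtx m L i j = none) : W.gridDist i j = 0 := by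
  rw [gridDist, h]
  exact SimpleGraph.dist_self

theorem gridDist_up {i j : ℕ} (hi : i < m) (hj : j < L) :
    W.gridDist (i + 1) (j + 1) ≤ W.gridDist (i + 1) j + B :=
  (W.subdiv.dist_tgt_le _ (Grid.up i j hi hj)).trans (Nat.add_le_add_left (W.len_le _) _)

theorem gridDist_right {i j : ℕ} (hi : i < m + 1) (hj : j < L) :
    W.gridDist (i + 1) (j + 1) ≤ W.gridDist i (j + 1) + B :=
  (W.subdiv.dist_tgt_le _ (Grid.right i j hi hj)).trans (Nat.add_le_add_left (W.len_le _) _)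

theorem gridDist_left {i j : ℕ} (hi : i < m + 1) (hj : j < L) :
    W.gridDist i (j + 1) ≤ W.gridDist (i + 1) (j + 1) + B :=
  (W.subdiv.dist_tgt_le _ (Grid.left i j hi hj)).trans (Nat.add_le_add_left (W.len_le _) _)

/-- First of three routes to the basepoint: down the column here, and along the rungs of a level to
column 0 or to column m + 1 in the next two lemmas. -/
theorem gridDist_le_level {i : ℕ} (hi : i ≤ m) (j : ℕ) (hj : j ≤ L) :
    W.gridDist i j ≤ B * j := by
  cases i with
  | zero => rw [W.gridDist_of_vtx_eq_none (Grid.vtx_zero_left _)]; exact Nat.zero_le _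
  | succ i =>
    induction j with
    | zero => rw [W.gridDist_of_vtx_eq_none (Grid.vtx_zero_right _)]; exact Nat.zero_le _
    | succ j ih =>
      have h1 := W.gridDist_up (i := i) (by omega) (show j < L by omega)
      have h2 := ih (by omega)
      rw [Nat.mul_succ]
      omega

theorem gridDist_le_left (i : ℕ) (hi : i ≤ m + 1) {j : ℕ} (hj : j < L) :
    W.gridDist i (j + 1) ≤ B * i := by
  induction i with
  | zero => rw [W.gridDist_of_vtx_eq_none (Grid.vtx_zero_left _)]; exact Nat.zero_le _
  | succ i ih =>
    have h1 := W.gridDist_right (i := i) (by omega) hj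
    have h2 := ih (by omega)
    rw [Nat.mul_succ]
    omega

theorem gridDist_le_right (k : ℕ) (hk : k ≤ m + 1) {j : ℕ} (hj : j < L) :
    W.gridDist (m + 1 - k) (j + 1) ≤ B * k := by
  induction k with
  | zero => rw [Nat.sub_zero, W.gridDist_of_vtx_eq_none (Grid.vtx_last _)]; exact Nat.zero_le _
  | succ k ih =>
    have h1 := W.gridDist_left (i := m + 1 - (k + 1)) (by omega) hj
    have h2 := ih (by omega)
    rw [Nat.mul_succ]
    rw [show m + 1 - (k + 1) + 1 = m + 1 - k by omega] at h1
    omega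

/-- The combinatorial depth of a vertex of the grid. -/
def depth (m L : ℕ) : Grid.Vert m L → ℕ
  | none => 0
  -- The indices are shifted: this vertex is in column i + 1 and at level j + 1, so m - i is its
  -- number of rungs to column m + 1.
  | some (i, j) => min (i + 1) (min (j + 1) (m - i))

theorem depth_vtx {i j : ℕ} (hi : i ≤ m + 1) (hj : j ≤ L) :
    depth m L (Grid.vtx m L i j) = min i (min j (m + 1 - i)) := by
  cases i with
  | zero => rw [Grid.vtx_zero_left]; simp [depth]
  | succ i =>
    cases j with
    | zero => rw [Grid.vtx_zero_right]; simp [depth]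
    | succ j =>
      by_cases h : i < m
      · rw [Grid.vtx_succ_succ h hj]
        simp only [depth]
        omega
      · obtain rfl : i = m := by omega
        rw [Grid.vtx_last]
        simp [depth]

theorem depth_tgt_le (d : (Grid.complex m L).D) :
    depth m L ((Grid.complex m L).tgt d) ≤ depth m L ((Grid.complex m L).src d) + 1 := by
  obtain ⟨⟨⟨i, hi⟩, ⟨j, hj⟩⟩ | ⟨⟨i, hi⟩, ⟨j, hj⟩⟩, _ | _⟩ := d
  · change depth m L (Grid.vtx m L (i + 1) j) ≤ depth m L (Grid.vtx m L (i + 1) (j + 1)) + 1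
    rw [depth_vtx (by omega) (by omega), depth_vtx (by omega) (by omega)]
    omega
  · change depth m L (Grid.vtx m L (i + 1) (j + 1)) ≤ depth m L (Grid.vtx m L (i + 1) j) + 1
    rw [depth_vtx (by omega) (by omega), depth_vtx (by omega) (by omega)]
    omega
  · change depth m L (Grid.vtx m L i (j + 1)) ≤ depth m L (Grid.vtx m L (i + 1) (j + 1)) + 1
    rw [depth_vtx (by omega) (by omega), depth_vtx (by omega) (by omega)]
    omega
  · change depth m L (Grid.vtx m L (i + 1) (j + 1)) ≤ depth m L (Grid.vtx m L i (j + 1)) + 1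
    rw [depth_vtx (by omega) (by omega), depth_vtx (by omega) (by omega)]
    omega

/-- The depth vanishes at the basepoint and changes by at most one along a grid edge, and
subdividing edges cannot shorten paths between grid vertices. -/
theorem depth_le_gridDist {i j : ℕ} (hi : i ≤ m + 1) (hj : j ≤ L) :
    min i (min j (m + 1 - i)) ≤ W.gridDist i j := by
  have h := W.subdiv.le_add_dist (depth m L) depth_tgt_le none (Grid.vtx m L i j)
  rw [depth_vtx hi hj] at h
  rw [show depth m L none = 0 from rfl, zero_add] at h
  exact h

/-- The distance of the lower vertex is at most B times its depth min(i, j + 1, m + 1 - i), one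
bound for each route; raising the level does not decrease the depth, and the depth bounds the
distance of the upper vertex from below. -/
theorem gridDist_le_mul {i j j' : ℕ} (hi : i < m + 1) (hjj : j ≤ j') (hj' : j' < L) :
    W.gridDist i (j + 1) ≤ B * W.gridDist i (j' + 1) := by
  refine le_trans ?_ (Nat.mul_le_mul_left B (W.depth_le_gridDist hi.le hj'))
  have h1 := W.gridDist_le_level (i := i) (by omega) (j + 1) (by omega)
  have h2 := W.gridDist_le_left i hi.le (show j < L by omega)
  have h3 := W.gridDist_le_right (m + 1 - i) (by omega) (show j < L by omega)
  rw [Nat.sub_sub_self hi.le] at h3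
  have h4 : W.gridDist i (j + 1) ≤ B * (j' + 1) :=
    h1.trans (Nat.mul_le_mul_left B (by omega))
  rcases min_choice i (min (j' + 1) (m + 1 - i)) with h | h <;> rw [h]
  · exact h2
  · rcases min_choice (j' + 1) (m + 1 - i) with h | h <;> rw [h]
    · exact h4
    · exact h3

variable {M : ℕ} (hM : 4 * B ≤ M)

/-- The constant collects two errors of M + 1: from the upper corner to the path value x and from
the path to the lower corner, B(x + M + 1) + (M + 1) = Bx + (B + 1)(M + 1). -/
theorem exists_intrinsic_tame :
    ∃ ψ : (W.diagram hM).bdrySet × I → (W.diagram hM).toPlanarComplex.Space,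
      IsOneCombing (W.diagram hM) ψ ∧ IsTame (W.diagram hM).intrinsic
        (fun x => (B : ℝ) * x + ((B + 1) * (M + 1) : ℕ)) ψ := by
  obtain ⟨ψ, h1, h2⟩ := W.exists_oneCombing hM
  refine ⟨ψ, h1, h2 _ _
    (fun v => (W.subdiv.complex.graph.dist (Sum.inl none : W.subdiv.Vert) v : ℝ)) _
    (fun _ => rfl) (fun _ => rfl) ?_ ?_ ?_⟩
  · intro f
    refine ⟨_, ?_, subset_rfl, rfl⟩
    obtain ⟨d, hd⟩ := W.subdiv.complex.face_surj f
    exact ⟨_, d, hd, rfl⟩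
  · exact W.subdiv.complex.abs_dist_tgt_sub_le W.subdiv.complex.connected _
  · intro i j j' hi hjj hj' x hx
    have h : (W.gridDist i (j + 1) : ℝ) ≤ B * W.gridDist i (j' + 1) := by
      exact_mod_cast W.gridDist_le_mul hi hjj hj'
    change (W.gridDist i (j' + 1) : ℝ) ≤ _ at hx
    change (W.gridDist i (j + 1) : ℝ) + M + 1 ≤ _
    have h3 := mul_le_mul_of_nonneg_left hx (Nat.cast_nonneg (α := ℝ) B)
    push_cast
    linarith

/-- The same two errors are fed through l·x + l', with l and l' rounded up to natural numbers: a(x +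
M + 1) + b + (M + 1). -/
theorem exists_extrinsic_tame {l l' : ℝ} (a b : ℕ) (hl : l ≤ a) (hl' : l' ≤ b)
    (hW : ∀ i j j', i < m + 1 → j ≤ j' → j' < L →
      (cayleyDist S 1 (W.elt (Grid.vtx m L i (j + 1))) : ℝ) ≤
        l * cayleyDist S 1 (W.elt (Grid.vtx m L i (j' + 1))) + l') :
    ∃ ψ : (W.diagram hM).bdrySet × I → (W.diagram hM).toPlanarComplex.Space,
      IsOneCombing (W.diagram hM) ψ ∧ IsTame (W.projection hM).extrinsic
        (fun x => (a : ℝ) * x + ((a + 1) * (M + 1) + b : ℕ)) ψ := by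
  obtain ⟨ψ, h1, h2⟩ := W.exists_oneCombing hM
  have hlip := (cayleyGraph S).abs_dist_tgt_sub_le (cayley_connected S) (1 : G)
  have hedge : ∀ d : W.subdiv.Dart,
      (cayleyComplex S (shortRelators S M)).coarseEdge (1 : G)
        ((W.pos (W.subdiv.complex.src d), W.label d) : G × A) =
      min (cayleyDist S 1 (W.pos (W.subdiv.complex.src d)) : ℝ)
        (cayleyDist S 1 (W.pos (W.subdiv.complex.tgt d))) + 1 / 2 := by
    intro d
    rw [W.pos_tgt]
    rfl
  refine ⟨ψ, h1, h2 _ _ (fun v => (cayleyDist S 1 (W.pos v) : ℝ)) _ (fun _ => rfl) hedge ?_ ?_ ?_⟩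
  · intro f
    have hf := (W.subdiv.complex.face_surj f).choose_spec
    set d := (W.subdiv.complex.face_surj f).choose with hd
    have hlen := length_faceWord W.subdiv.complex W.label d
    refine ⟨_, ?_, ?_, rfl⟩
    · refine ⟨_, _, ⟨0, ?_, rfl⟩, rfl⟩
      exact hlen.symm ▸ W.subdiv.complex.minimalPeriod_next_pos d
    -- The i-th edge of the image cell is the image of the i-th edge of the circuit that starts at
    -- the chosen side `d`.
    · rintro _ ⟨_, ⟨i, hi, rfl⟩, rfl⟩
      refine ⟨W.subdiv.complex.next^[i] d, (W.subdiv.complex.face_iterate_next d i).trans hf, ?_⟩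
      refine congrArg ((cayleyComplex S (shortRelators S M)).coarseEdge (1 : G))
        (Prod.ext ?_ ?_)
      · exact ev_take_faceWord W.subdiv.complex W.label W.pos W.pos_tgt d i (le_of_lt hi)
      · change W.label _ = (W.subdiv.complex.faceWord W.label d)[i]
        simp [PlanarComplex.faceWord, Equiv.Perm.iterate_eq_pow]
  · intro d
    have := hlip (W.pos (W.subdiv.complex.src d), W.label d)
    rw [W.pos_tgt]
    exact this
  · intro i j j' hi hjj hj' x hx
    have h := hW i j j' hi hjj hj'
    change (cayleyDist S 1 (W.elt (Grid.vtx m L i (j' + 1))) : ℝ) ≤ _ at hx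
    change (cayleyDist S 1 (W.elt (Grid.vtx m L i (j + 1))) : ℝ) + M + 1 ≤ _
    have h3 := mul_le_mul_of_nonneg_left hx (Nat.cast_nonneg (α := ℝ) a)
    have h4 := mul_le_mul_of_nonneg_right hl
      (Nat.cast_nonneg (α := ℝ) (cayleyDist S 1 (W.elt (Grid.vtx m L i (j' + 1)))))
    push_cast
    linarith

end GridLabelling

end Metric

/-! ### The labelled grid of a word, from normal forms -/

section NormalForms

variable {G : Type*} [Group G] {A : Type*} [InvolutiveInv A] {S : SymmGen G A}

theorem wordInv_wordInv (u : List A) : wordInv (wordInv u) = u := by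
  simp [wordInv, List.map_reverse]

theorem cayleyDist_take_succ_le (g : G) (u : List A) (j : ℕ) :
    cayleyDist S (g * S.ev (u.take j)) (g * S.ev (u.take (j + 1))) ≤ 1 := by
  rw [List.take_add_one, S.ev_append, ← mul_assoc]
  refine (cayleyDist_mul_ev_le S _ _ _).trans ?_
  rw [cayleyDist_self, zero_add]
  cases u[j]? <;> simp

/-- The values of the columns at the vertices of the grid. -/
def gridElt {m L : ℕ} (P : ℕ → ℕ → G) : Grid.Vert m L → G
  | none => 1
  | some (i, j) => P (i + 1) (j + 1)

theorem gridElt_vtx {m L : ℕ} (P : ℕ → ℕ → G) (h0 : ∀ j, P 0 j = 1) (h1 : ∀ j, P (m + 1) j = 1)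
    (h2 : ∀ i, P i 0 = 1) {i j : ℕ} (hi : i ≤ m + 1) (hj : j ≤ L) :
    gridElt P (Grid.vtx m L i j) = P i j := by
  cases i with
  | zero => rw [Grid.vtx_zero_left, h0]; rfl
  | succ i =>
    cases j with
    | zero => rw [Grid.vtx_zero_right, h2]; rfl
    | succ j =>
      by_cases h : i < m
      · rw [Grid.vtx_succ_succ h hj]; rfl
      · obtain rfl : i = m := by omega
        rw [Grid.vtx_last, h1]; rfl

/-- Nearby values at neighbouring vertices of the grid yield a labelling of the grid. -/
theorem exists_gridLabelling [Nonempty A] {w : List A} {m L B : ℕ} (hw : w.length = m + 1)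
    (hL : 0 < L) (hB : 2 ≤ B) (P : ℕ → ℕ → G) (h0 : ∀ j, P 0 j = 1) (h1 : ∀ j, P (m + 1) j = 1)
    (h2 : ∀ i, P i 0 = 1) (hPL : ∀ i ≤ m + 1, P i L = S.ev (w.take i))
    (hup : ∀ i j, cayleyDist S (P i j) (P i (j + 1)) ≤ B)
    (hright : ∀ i j, i < m + 1 → cayleyDist S (P i j) (P (i + 1) j) ≤ B) :
    ∃ W : GridLabelling S w m L B, ∀ i j, i ≤ m + 1 → j ≤ L → W.elt (Grid.vtx m L i j) = P i j := by
  have he : ∀ {i j}, i ≤ m + 1 → j ≤ L → gridElt P (Grid.vtx m L i j) = P i j :=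
    fun hi hj => gridElt_vtx P h0 h1 h2 hi hj
  have hword : ∀ d : Grid.Dart m L, ∃ u : List A, d.2 = true → u ≠ [] ∧ u.length ≤ B ∧
      gridElt P (Grid.src (Grid.rev d)) = gridElt P (Grid.src d) * S.ev u ∧
      ∀ i (hi : i < m + 1), d = Grid.right i (L - 1) hi (Nat.sub_lt hL one_pos) → u = [w[i]] := by
    rintro ⟨⟨⟨i, hi⟩, ⟨j, hj⟩⟩ | ⟨⟨i, hi⟩, ⟨j, hj⟩⟩, _ | _⟩
    · exact ⟨[], fun h => by simp at h⟩
    · obtain ⟨u, hu1, hu2, hu3⟩ := exists_nonempty_word S hB (hup (i + 1) j)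
      refine ⟨u, fun _ => ⟨hu1, hu2, ?_, fun i hi h => by simp [Grid.right] at h⟩⟩
      change gridElt P (Grid.vtx m L (i + 1) (j + 1)) = gridElt P (Grid.vtx m L (i + 1) j) * _
      rw [he (by omega) (by omega), he (by omega) (by omega), hu3]
    · exact ⟨[], fun h => by simp at h⟩
    -- The rungs of the top row must spell w, so there the letter itself is taken and not an
    -- arbitrary short word.
    · by_cases hjL : j = L - 1
      · refine ⟨[w[i]], fun _ => ⟨by simp, by simp; omega, ?_, ?_⟩⟩
        · change gridElt P (Grid.vtx m L (i + 1) (j + 1)) = gridElt P (Grid.vtx m L i (j + 1)) * _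
          rw [he (by omega) (by omega), he (by omega) (by omega), show j + 1 = L by omega,
            hPL _ (by omega), hPL _ (by omega), S.ev_take_succ, S.ev_singleton]
        · intro i' hi' h
          simp only [Grid.right, Prod.mk.injEq, Sum.inr.injEq, Fin.mk.injEq] at h
          simp only [h.1.1]
      · obtain ⟨u, hu1, hu2, hu3⟩ := exists_nonempty_word S hB (hright i (j + 1) hi)
        refine ⟨u, fun _ => ⟨hu1, hu2, ?_, ?_⟩⟩
        · change gridElt P (Grid.vtx m L (i + 1) (j + 1)) = gridElt P (Grid.vtx m L i (j + 1)) * _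
          rw [he (by omega) (by omega), he (by omega) (by omega), hu3]
        · intro i' hi' h
          simp only [Grid.right, Prod.mk.injEq, Sum.inr.injEq, Fin.mk.injEq] at h
          exact absurd h.1.2 hjL
  choose u hu using hword
  have hneg : ∀ d : Grid.Dart m L, d.2 = false → (Grid.rev d).2 = true := fun d h => by
    simp [Grid.rev, h]
  refine ⟨{
    word := fun d : Grid.Dart m L => if d.2 = true then u d else wordInv (u (Grid.rev d))
    word_ne := ?_
    word_rev := ?_
    elt := gridElt P
    elt_tgt := ?_
    dir := fun d : Grid.Dart m L => d.2 = true
    dir_rev := ?_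
    length_eq := hw
    pos_L := hL
    length_word_le := ?_
    word_top := ?_
    elt_base := rfl }, fun i j hi hj => he hi hj⟩
  · intro (d : Grid.Dart m L)
    rcases hd : d.2 with _ | _
    · simp only [Bool.false_eq_true, if_false]
      rw [Ne, ← List.length_eq_zero_iff, length_wordInv, List.length_eq_zero_iff]
      exact (hu _ (hneg d hd)).1
    · simp only [if_true]
      exact (hu d hd).1
  · intro (d : Grid.Dart m L)
    change (if (Grid.rev d).2 = true then u (Grid.rev d) else wordInv (u (Grid.rev (Grid.rev d)))) =
      wordInv (if d.2 = true then u d else wordInv (u (Grid.rev d)))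
    rw [Grid.rev_rev]
    rcases hd : d.2 with _ | _
    · simp [Grid.rev, hd, wordInv_wordInv]
    · simp [Grid.rev, hd]
  · intro (d : Grid.Dart m L)
    change gridElt P (Grid.src (Grid.rev d)) = gridElt P (Grid.src d) * _
    rcases hd : d.2 with _ | _
    · simp only [Bool.false_eq_true, if_false]
      have := (hu _ (hneg d hd)).2.2.1
      rw [Grid.rev_rev] at this
      rw [this, S.ev_wordInv, mul_inv_cancel_right]
    · simp only [if_true]
      exact (hu d hd).2.2.1
  · intro (d : Grid.Dart m L)
    change (!d.2) = true ↔ ¬ d.2 = true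
    simp
  · intro (d : Grid.Dart m L)
    rcases hd : d.2 with _ | _
    · simp only [Bool.false_eq_true, if_false, length_wordInv]
      exact (hu _ (hneg d hd)).2.1
    · simp only [if_true]
      exact (hu d hd).2.1
  · intro i hi
    exact (hu _ rfl).2.2.2 i hi rfl

/-- The vertex in column i at level j is the prefix of length j of the normal form of g_i. Vertical
neighbours are at distance at most 1, horizontal ones at most K by fellow travelling; the edge bound
is K + 2, large enough for a backtracking label. -/
theorem exists_gridLabelling_of_normalForms {C : Set (List A)} (hC : IsNormalFormSet S C) {K : ℕ}
    (hft : FellowTraveller S K C) {l l' : ℝ}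
    (hqg : ∀ y ∈ C, IsQuasiGeodesic S l l' y) {w : List A} (hne : w ≠ [])
    (hw : S.ev w = 1) : ∃ m L, ∃ W : GridLabelling S w m L (K + 2),
      ∀ i j j', i < m + 1 → j ≤ j' → j' < L →
        (cayleyDist S 1 (W.elt (Grid.vtx m L i (j + 1))) : ℝ) ≤
          l * cayleyDist S 1 (W.elt (Grid.vtx m L i (j' + 1))) + l' := by
  have : Nonempty A := ⟨w.head hne⟩
  choose y hyC hy using fun g : G => hC.1.surjOn (Set.mem_univ g)
  -- The empty word is the normal form of the identity; this is what allows the two outer columns to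
  -- collapse.
  have hy1 : y 1 = [] := hC.1.injOn (hyC 1) hC.2 ((hy 1).trans S.ev_nil.symm)
  obtain ⟨m, hm⟩ : ∃ m, w.length = m + 1 :=
    Nat.exists_eq_succ_of_ne_zero (by simpa using hne)
  -- Any positive common bound for the lengths of the columns would do; a shorter normal form waits
  -- at its end.
  set L := 1 + ∑ i ∈ Finset.range (m + 2), (y (S.ev (w.take i))).length with hLdef
  have hlen : ∀ i ≤ m + 1, (y (S.ev (w.take i))).length ≤ L := by
    intro i hi
    have := Finset.single_le_sum (f := fun i => (y (S.ev (w.take i))).length)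
      (fun _ _ => Nat.zero_le _) (Finset.mem_range.2 (show i < m + 2 by omega))
    omega
  obtain ⟨W, hW⟩ := exists_gridLabelling (S := S) (B := K + 2) hm (show 0 < L by omega) (by omega)
    (fun i j => S.ev ((y (S.ev (w.take i))).take j))
    (fun j => by simp [S.ev_nil, hy1])
    (fun j => by rw [← hm, List.take_length, hw, hy1, List.take_nil, S.ev_nil])
    (fun i => by simp [S.ev_nil])
    (fun i hi => by rw [List.take_of_length_le (hlen i hi), hy])
    (fun i j => by
      have := cayleyDist_take_succ_le (S := S) 1 (y (S.ev (w.take i))) j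
      rw [one_mul, one_mul] at this
      omega)
    (fun i j hi => by
      have := hft _ (hyC (S.ev (w.take i))) _ (hyC (S.ev (w.take (i + 1)))) (w[i])
        (by rw [hy, hy, S.ev_take_succ]) j
      omega)
  refine ⟨m, L, W, fun i j j' hi hjj hj' => ?_⟩
  rw [hW i _ hi.le (by omega), hW i _ hi.le hj']
  set u := y (S.ev (w.take i))
  -- Distance is at most prefix length, and prefix length grows with the level. The quasi-geodesic
  -- inequality is then applied to the initial subword ending at the upper vertex.
  have h1 : (cayleyDist S 1 (S.ev (u.take (j + 1))) : ℝ) ≤ (u.take (j' + 1)).length := by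
    refine Nat.cast_le.2 ((cayleyDist_ev_le S _).trans ?_)
    rw [List.length_take, List.length_take]
    omega
  exact h1.trans (hqg u (hyC _) [] (u.take (j' + 1)) (u.drop (j' + 1)) (by simp))

end NormalForms

end TameFilling

/-! ### Choice of the constants and assembly -/

theorem mainTheorem8 {G : Type*} [Group G] {A : Type*} [InvolutiveInv A] [Finite A]
    (S : TameFilling.SymmGen G A) (C : Set (List A))
    (hC : TameFilling.IsNormalFormSet S C)
    (hsimple : ∀ y ∈ C, TameFilling.IsSimpleWord S y)
    (hqg : TameFilling.IsQuasiGeodesicSet S C)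
    (K : ℕ) (hK : 1 ≤ K) (hft : TameFilling.FellowTraveller S K C) :
    ∃ R : Set (List A), TameFilling.IsFiniteSymmPresentation S R ∧
      (∃ f : ℝ → ℝ, TameFilling.IsLinearFun f ∧ TameFilling.IsIntrinsicTFF S R f) ∧
      (∃ f : ℝ → ℝ, TameFilling.IsLinearFun f ∧ TameFilling.IsExtrinsicTFF S R f) := by
  obtain ⟨l, l', hl, -, hq⟩ := hqg
  obtain ⟨a, ha⟩ := exists_nat_ge l
  obtain ⟨b, hb⟩ := exists_nat_ge l'
  have ha0 : 0 < a := by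
    have : (1 : ℝ) ≤ a := hl.trans ha
    exact_mod_cast this
  -- Four sides of at most K + 2 letters each; this also exceeds the 2K + 2 needed for the
  -- presentation.
  set M := 4 * (K + 2) with hM
  refine ⟨TameFilling.shortRelators S M,
    TameFilling.isFiniteSymmPresentation_shortRelators hK (by omega) hC hft,
    ⟨fun x => ((K + 2 : ℕ) : ℝ) * x + ((K + 2 + 1) * (M + 1) : ℕ),
      TameFilling.isLinearFun_linear _ _ (by omega), TameFilling.isNondecreasing_linear _ _, ?_⟩,
    ⟨fun x => (a : ℝ) * x + ((a + 1) * (M + 1) + b : ℕ),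
      TameFilling.isLinearFun_linear _ _ ha0, TameFilling.isNondecreasing_linear _ _, ?_⟩⟩
  · intro w hw
    -- The grid needs at least one strip, so the empty word gets the one-point diagram.
    by_cases hne : w = []
    · subst hne
      exact ⟨_, _, TameFilling.isOneCombing_pointDiagram _,
        TameFilling.isTame_pointDiagram _ _ (congrArg Nat.cast SimpleGraph.dist_self |>.trans
          Nat.cast_zero) _ _⟩
    · obtain ⟨m, L, W, -⟩ := TameFilling.exists_gridLabelling_of_normalForms hC hft hq hne hw
      exact ⟨_, W.exists_intrinsic_tame hM.ge⟩
  · intro w hw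
    by_cases hne : w = []
    · subst hne
      exact ⟨_, TameFilling.pointProjection S _, _, TameFilling.isOneCombing_pointDiagram _,
        TameFilling.isTame_pointDiagram _ _ (congrArg Nat.cast SimpleGraph.dist_self |>.trans
          Nat.cast_zero) _ _⟩
    · obtain ⟨m, L, W, hW⟩ := TameFilling.exists_gridLabelling_of_normalForms hC hft hq hne hw
      exact ⟨_, _, W.exists_extrinsic_tame hM.ge a b ha hb hW⟩
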